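/- **Setting.** Let $\Delta$ be a countably infinite set of constants, $\sigma_D$ a database signature (predicate symbols, each of which is either a CWA- or an OWA-predicate symbol, and the constants in $\Delta$) and $\sigma_Q$ a query signature (predicate and function symbols and the constants in $\Delta$). All symbols are effectively encoded, with computable arities and a decidable set of CWA-predicate symbols. A *database* is a partial function $D$ from the variable-free, equality-free $\sigma_D$-atoms to $\{1,0,-1\}$ such that only finitely many atoms have a value $\ge 0$, $D$ is defined on all atoms with a CWA-predicate symbol, and it is defined on only finitely many atoms with an OWA-predicate symbol. Let $\mathscr D$ be the class of all databases or the class of all databases without the value $0$. Let $\mathscr Q$ be a query language, that is, a recursive class of first-order sentences of $\sigma_Q$ that is closed under conjunction and under renaming of constants by injections $\tau:\Delta\to\Delta$, and contains a non-tautological sentence. Here $\tau(\phi)$ replaces each constant $c$ by $\tau(c)$; $\tau(D)$ has on $\tau(\alpha)$ the value of $D$ on $\alpha$ (and is undefined there if $D(\alpha)$ is), has the value $-1$ on all CWA-atoms not of the form $\tau(\alpha)$, and is undefined on all other atoms. A *knowledge base (KB)* over $(\mathscr D,\mathscr Q)$ is a class $K\subseteq\mathscr D\times\mathscr Q$ such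 that (1) $(D,\phi)\in K$ for all $D\in\mathscr D$ and all tautologies $\phi\in\mathscr Q$; (2) if $(D,\phi)\in K$, $\psi\in\mathscr Q$ and $\phi\vDash\psi$, then $(D,\psi)\in K$; (3) if $(D,\phi),(D,\psi)\in K$, then $(D,\phi\wedge\psi)\in K$; (4) if $(D,\phi)\in K$ and $D_0\in\mathscr D$ extends $D$ as a partial function, then $(D_0,\phi)\in K$; (5) if $(D,\phi)\in K$ and $\tau:\Delta\to\Delta$ is injective, then $(\tau(D),\tau(\phi))\in K$. For $K\subseteq\mathscr D\times\mathscr Q$ let $\mathrm{cl}(K)$ be the least KB that includes $K$. Fix an injective effective encoding $\langle\cdot\rangle$ of finite objects by strings in $\{0,1\}^*$. A *knowledge representation formalism (KRF)* over $(\mathscr D,\mathscr Q)$ is a mapping $\Gamma$ from a recursive set $\mathrm{dom}(\Gamma)\subseteq\{0,1\}^*$ to KBs over $(\mathscr D,\mathscr Q)$ such that $\{\langle\pi,D,\phi\rangle:\pi\in\mathrm{dom}(\Gamma),\ (D,\phi)\in\Gamma(\pi)\}$ is recursively enumerable. A KRF $\Gamma$ is *reducible* to a KRF $\Gamma_0$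 if $\Gamma(\pi)=\Gamma_0(p(\pi))$ for all $\pi\in\mathrm{dom}(\Gamma)$, for some recursive function $p:\mathrm{dom}(\Gamma)\to\mathrm{dom}(\Gamma_0)$. A KRF is *universal* if every KRF over $(\mathscr D,\mathscr Q)$ is reducible to it. It is *expressively complete* if its range is exactly the set of recursively enumerable KBs over $(\mathscr D,\mathscr Q)$. For a Turing machine $M$ let $\mathbb K(M)=\{(D,\phi)\in\mathscr D\times\mathscr Q: M\text{ accepts }\langle D,\phi\rangle\}$. A Turing machine $P$ *implements the closure procedure* if, for all Turing machines $M$, all $D\in\mathscr D$ and all $\phi\in\mathscr Q$, it accepts $\langle M,D,\phi\rangle$ iff $(D,\phi)\in\mathrm{cl}(\mathbb K(M))$. Given $P$, let $M^*$ be the Turing machine that performs $P$ with $M$ built in: on an input $w$ it writes $\langle M\rangle$, in self-delimiting form, in front of $w$ and continues as $P$. The *canonical mapping* $\Theta$ is defined on the strings $\langle M^*\rangle$, where $M$ is any Turing machine, by $\Theta(\langle M^*\rangle)=\mathbb K(M^*)$. **Theorem.** There is a Turing machine $P$ that implements the closure procedure. For every such $P$, we have $\mathbb K(M^*)=\mathrm{cl}(\mathbb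 K(M))$ for every Turing machine $M$, and the canonical mapping $\Theta$ is a universal KRF over $(\mathscr D,\mathscr Q)$ and is expressively complete. -/

import Mathlib

open FirstOrder

namespace KR

/-! ### Strings and encodings -/

/-- The binary string that encodes an element of an effectively encoded type. -/
def enc {α : Type} [Encodable α] (a : α) : List Bool :=
  (Encodable.encode a).bits

/-- The self-delimiting form of a string: every bit `b` becomes `1b`, and `0` ends the string. -/
def delimit (u : List Bool) : List Bool :=
  (u.flatMap fun b => [true, b]) ++ [false]

/-- The encoding of an ordered pair of strings. -/
def pairStr (u v : List Bool) : List Bool :=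
  delimit u ++ v

theorem enc_injective {α : Type} [Encodable α] : Function.Injective (enc : α → List Bool) := by
  intro a b h
  apply Encodable.encode_injective
  have h2 : Nat.digits 2 (Encodable.encode a) = Nat.digits 2 (Encodable.encode b) := by
    rw [Nat.digits_two_eq_bits, Nat.digits_two_eq_bits]
    exact congrArg _ h
  exact Nat.digits_inj_iff.1 h2

theorem pairStr_injective {u u' v v' : List Bool} (h : pairStr u v = pairStr u' v') :
    u = u' ∧ v = v' := by
  induction u generalizing u' with
  | nil => cases u' <;> simp_all [pairStr, delimit]
  | cons a u ih =>
    cases u' with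
    | nil => simp [pairStr, delimit] at h
    | cons b u' =>
      simp only [pairStr, delimit, List.flatMap_cons, List.cons_append, List.nil_append,
        List.cons.injEq, true_and] at h
      have := ih (u' := u') (by simpa [pairStr, delimit] using h.2)
      exact ⟨by rw [h.1, this.1], this.2⟩

/-- A partial function on strings is recursive if it is partial recursive and its domain is
recursive. -/
def IsRecursive (p : List Bool →. List Bool) : Prop :=
  Partrec p ∧ ComputablePred fun w => w ∈ p.Dom

/-! ### Turing machines

One two-way infinite tape over `{0, 1, B}`, where `some false` is `0`, `some true` is `1`, and
`none` is the blank `B`. States are natural numbers. -/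

/-- The quintuple `(src, read, dst, write, dir)`: in the state `src`, scanning the symbol `read`,
print `write`, move the head one cell to `dir`, and enter the state `dst`. -/
structure Instr where
  src : ℕ
  read : Option Bool
  dst : ℕ
  write : Option Bool
  dir : Turing.Dir

/-- Deterministic Turing machines: a starting state, the **yes** states and the **no** states
(the halting states), and a finite table of instructions. -/
structure TM where
  start : ℕ
  yes : List ℕ
  no : List ℕ
  instr : List Instr
  halting_nonempty : yes ++ no ≠ []
  halting_disjoint : ∀ q ∈ yes, q ∉ no
  deterministic : ∀ i ∈ instr, ∀ j ∈ instr, i.src = j.src → i.read = j.read → i = j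

/-- Configurations: a state and a tape (with a head on it). -/
structure Cfg where
  state : ℕ
  tape : Turing.Tape (Option Bool)

namespace TM

/-- The input stands on the tape, otherwise blank, with the head on its first symbol. -/
def init (M : TM) (w : List Bool) : Cfg :=
  ⟨M.start, Turing.Tape.mk₁ (w.map some)⟩

/-- One step of computation; there is none in a halting state. -/
def step (M : TM) (c : Cfg) : Option Cfg :=
  if c.state ∈ M.yes ∨ c.state ∈ M.no then none
  else (M.instr.find? fun i => decide (i.src = c.state ∧ i.read = c.tape.head)).map
    fun i => ⟨i.dst, (c.tape.write i.write).move i.dir⟩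

/-- `M` halts on the input `w` at a **yes** state. -/
def Accepts (M : TM) (w : List Bool) : Prop :=
  ∃ c, StateTransition.Reaches M.step (M.init w) c ∧ c.state ∈ M.yes

end TM

/-- The components of an instruction; the move to the right is coded as `true`. -/
def Instr.toTuple (i : Instr) : ℕ × Option Bool × ℕ × Option Bool × Bool :=
  (i.src, i.read, i.dst, i.write, match i.dir with | .left => false | .right => true)

/-- The string `⟨M⟩` that encodes the Turing machine `M`. -/
def encTM (M : TM) : List Bool :=
  enc (M.start, M.yes, M.no, M.instr.map Instr.toTuple)

theorem Instr.toTuple_injective : Function.Injective Instr.toTuple := by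
  rintro ⟨a, b, c, d, e⟩ ⟨a', b', c', d', e'⟩ h
  cases e <;> cases e' <;> simp_all [Instr.toTuple]

theorem encTM_injective : Function.Injective encTM := by
  rintro ⟨a, b, c, d, _, _, _⟩ ⟨a', b', c', d', _, _, _⟩ h
  have := enc_injective h
  simp only [Prod.mk.injEq, List.map_inj_right (fun _ _ h => Instr.toTuple_injective h)] at this
  obtain ⟨rfl, rfl, rfl, rfl⟩ := this
  rfl

/-- The instructions of `TM.hardwire`: leave the input to the left (state `0`), print `s` from
right to left (states `1, …, |s|`), return to the first symbol of `s` (state `|s| + 1`), and go on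
as `P`, whose states are shifted by `|s| + 2`. -/
def hardwireInstr (P : TM) (s : List Bool) : List Instr :=
  ([none, some false, some true].map fun a => ⟨0, a, 1, a, .left⟩) ++
  ((List.range s.length).map fun j => ⟨j + 1, none, j + 2, s.reverse[j]?, .left⟩) ++
  [⟨s.length + 1, none, P.start + (s.length + 2), none, .right⟩] ++
  (P.instr.map fun i => ⟨i.src + (s.length + 2), i.read, i.dst + (s.length + 2), i.write, i.dir⟩)

/-- The Turing machine that on the input `w` first writes the string `s` in front of `w`, and then
works as `P` on the input `sw`. -/
def TM.hardwire (P : TM) (s : List Bool) : TM where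
  start := 0
  yes := P.yes.map (· + (s.length + 2))
  no := P.no.map (· + (s.length + 2))
  instr := hardwireInstr P s
  halting_nonempty := by
    have := P.halting_nonempty
    simpa using this
  halting_disjoint := by
    intro q hq hq'
    simp only [List.mem_map] at hq hq'
    obtain ⟨a, ha, rfl⟩ := hq
    obtain ⟨b, hb, hab⟩ := hq'
    obtain rfl : b = a := by omega
    exact P.halting_disjoint _ ha hb
  deterministic := by
    intro i hi j hj h1 h2
    simp only [hardwireInstr, List.mem_append, List.mem_map, List.mem_range,
      List.mem_singleton] at hi hj
    rcases hi with ((⟨a, _, rfl⟩ | ⟨a, ha, rfl⟩) | rfl) | ⟨a, ha, rfl⟩ <;>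
    rcases hj with ((⟨b, _, rfl⟩ | ⟨b, hb, rfl⟩) | rfl) | ⟨b, hb, rfl⟩ <;>
    simp only at h1 h2 <;> try omega
    · subst h2; rfl
    · obtain rfl : a = b := by omega
      rfl
    · rfl
    · rw [P.deterministic a ha b hb (by omega) h2]

/-! ### Signatures, databases and queries

The type `Δ` of constants is common to databases and queries. All symbols are effectively encoded,
as the type class `Primcodable` says. -/

/-- The symbols of a database signature besides the constants in `Δ`: predicate symbols, with
their arities, divided into CWA-predicate symbols and OWA-predicate symbols. -/
structure DatabaseSignature where
  Pred : Type
  [primcodable : Primcodable Pred]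
  arity : Pred → ℕ
  CWA : Pred → Prop
  computable_arity : Computable arity
  computable_CWA : ComputablePred CWA

/-- The symbols of a query signature besides the constants in `Δ`: (OWA-)predicate symbols and
function symbols, with their arities. -/
structure QuerySignature where
  Pred : Type
  Func : Type
  [primcodablePred : Primcodable Pred]
  [primcodableFunc : Primcodable Func]
  predArity : Pred → ℕ
  funcArity : Func → ℕ
  computable_predArity : Computable predArity
  computable_funcArity : Computable funcArity

attribute [instance] DatabaseSignature.primcodable QuerySignature.primcodablePred
  QuerySignature.primcodableFunc

/-- Variable-free and equality-free atoms of a database signature. -/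
structure Fact (σ : DatabaseSignature) (Δ : Type) where
  pred : σ.Pred
  args : Fin (σ.arity pred) → Δ

/-- A database: a partial function from facts to `{1, 0, -1}`, where `1` (`0`) stands for a fact
that was observed to be true (false). Only finitely many facts are observed, and the function is
defined on every fact with a CWA-predicate symbol. In order that databases be finite objects, it is
defined on finitely many facts with OWA-predicate symbols. -/
structure Database (σ : DatabaseSignature) (Δ : Type) where
  val : Fact σ Δ → Option SignType
  finite_observed : {α | ∃ s, val α = some s ∧ 0 ≤ s}.Finite
  complete : ∀ α, σ.CWA α.pred → (val α).isSome
  finite_OWA : {α | ¬ σ.CWA α.pred ∧ (val α).isSome}.Finite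

section Databases

variable {σ : DatabaseSignature} {Δ : Type}

/-- No fact was observed to be false. -/
def Database.Positive (D : Database σ Δ) : Prop :=
  ∀ α, D.val α ≠ some 0

/-- `D₀` extends `D`, as partial functions. -/
def Database.Extends (D₀ D : Database σ Δ) : Prop :=
  ∀ α s, D.val α = some s → D₀.val α = some s

/-- The atom `τ(α)`. -/
def Fact.rename (τ : Δ → Δ) (α : Fact σ Δ) : Fact σ Δ :=
  ⟨α.pred, fun k => τ (α.args k)⟩

theorem Fact.rename_injective {τ : Δ → Δ} (hτ : Function.Injective τ) :
    Function.Injective (Fact.rename (σ := σ) τ) := by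
  rintro ⟨p, a⟩ ⟨q, b⟩ h
  simp only [Fact.rename, Fact.mk.injEq] at h
  obtain ⟨rfl, h⟩ := h
  have h := eq_of_heq h
  congr
  funext k
  exact hτ (congrFun h k)

open Classical in
/-- The database `τ(D)`: it has on `τ(α)` the value that `D` has on `α`. The facts with
CWA-predicate symbols that are not of the form `τ(α)` are unobserved. -/
noncomputable def Database.rename (D : Database σ Δ) (τ : Δ → Δ) (hτ : Function.Injective τ) :
    Database σ Δ where
  val := Function.extend (Fact.rename τ) D.val fun β => if σ.CWA β.pred then some (-1) else none
  finite_observed := by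
    refine (D.finite_observed.image (Fact.rename τ)).subset ?_
    rintro β ⟨s, hs, h0⟩
    by_cases h : ∃ α, Fact.rename τ α = β
    · obtain ⟨α, rfl⟩ := h
      rw [(Fact.rename_injective hτ).extend_apply] at hs
      exact ⟨α, ⟨s, hs, h0⟩, rfl⟩
    · rw [Function.extend_apply' _ _ _ h] at hs
      split_ifs at hs
      cases hs
      exact absurd h0 (by decide)
  complete := by
    intro β hβ
    by_cases h : ∃ α, Fact.rename τ α = β
    · obtain ⟨α, rfl⟩ := h
      rw [(Fact.rename_injective hτ).extend_apply]
      exact D.complete α hβ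
    · rw [Function.extend_apply' _ _ _ h, if_pos hβ]
      rfl
  finite_OWA := by
    refine (D.finite_OWA.image (Fact.rename τ)).subset ?_
    rintro β ⟨hβ, hs⟩
    by_cases h : ∃ α, Fact.rename τ α = β
    · obtain ⟨α, rfl⟩ := h
      rw [(Fact.rename_injective hτ).extend_apply] at hs
      exact ⟨α, ⟨hβ, hs⟩, rfl⟩
    · rw [Function.extend_apply' _ _ _ h, if_neg hβ] at hs
      cases hs

/-- The facts on which the value of `D` is not determined by default: those that are observed, and
those with an OWA-predicate symbol. -/
def Database.support (D : Database σ Δ) : Set (Fact σ Δ × SignType) :=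
  {x | D.val x.1 = some x.2 ∧ (0 ≤ x.2 ∨ ¬ σ.CWA x.1.pred)}

theorem Database.finite_support (D : Database σ Δ) : D.support.Finite := by
  refine ((D.finite_observed.union D.finite_OWA).prod (Set.finite_univ (α := SignType))).subset ?_
  rintro ⟨α, s⟩ ⟨h, h' | h'⟩
  · exact ⟨Or.inl ⟨s, h, h'⟩, trivial⟩
  · exact ⟨Or.inr ⟨h', by rw [h]; rfl⟩, trivial⟩

variable [Primcodable Δ]

/-- The code of a fact: its predicate symbol with the list of its arguments. -/
def Fact.code (α : Fact σ Δ) : ℕ :=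
  Encodable.encode (α.pred, List.ofFn α.args)

/-- The code of a value of a database. -/
def signCode (s : SignType) : ℕ :=
  match s with
  | 0 => 0
  | 1 => 1
  | -1 => 2

/-- The string `⟨D⟩`: the facts of the support with their values, listed in the order of their
codes. -/
noncomputable def encDB (D : Database σ Δ) : List Bool :=
  enc ((D.finite_support.toFinset.image
    fun x => Nat.pair x.1.code (signCode x.2)).sort (· ≤ ·))

theorem Fact.code_injective : Function.Injective (Fact.code (σ := σ) (Δ := Δ)) := by
  rintro ⟨p, a⟩ ⟨q, b⟩ h
  have h := Encodable.encode_injective h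
  simp only [Prod.mk.injEq] at h
  obtain ⟨rfl, h⟩ := h
  rw [List.ofFn_injective h]

theorem encDB_injective : Function.Injective (encDB (σ := σ) (Δ := Δ)) := by
  intro D E h
  have h1 := congrArg List.toFinset (enc_injective h)
  simp only [Finset.sort_toFinset] at h1
  have hinj : Function.Injective
      fun x : Fact σ Δ × SignType => Nat.pair x.1.code (signCode x.2) := by
    rintro ⟨α, s⟩ ⟨β, t⟩ hx
    simp only [Nat.pair_eq_pair] at hx
    have hs : s = t := by
      have : ∀ s t, signCode s = signCode t → s = t := by decide
      exact this s t hx.2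
    rw [Fact.code_injective hx.1, hs]
  have h2 : D.support = E.support := by
    have := Finset.image_injective hinj h1
    simpa using this
  have key : ∀ α, D.val α = E.val α := by
    intro α
    have h3 : ∀ s, (D.val α = some s ∧ (0 ≤ s ∨ ¬ σ.CWA α.pred)) ↔
        (E.val α = some s ∧ (0 ≤ s ∨ ¬ σ.CWA α.pred)) := fun s =>
      Set.ext_iff.1 h2 (α, s)
    by_cases hα : σ.CWA α.pred
    · obtain ⟨s, hs⟩ := Option.isSome_iff_exists.1 (D.complete α hα)
      obtain ⟨t, ht⟩ := Option.isSome_iff_exists.1 (E.complete α hα)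
      simp only [hs, ht, hα, not_true_eq_false, or_false, Option.some.injEq] at h3 ⊢
      have h4 : ∀ s t : SignType, (s = s ∧ 0 ≤ s ↔ t = s ∧ 0 ≤ s) →
          (s = t ∧ 0 ≤ t ↔ t = t ∧ 0 ≤ t) → s = t := by decide
      exact h4 s t (h3 s) (h3 t)
    · ext s
      simpa [hα] using h3 s
  cases D; cases E
  congr
  funext α
  exact key α

end Databases

/-! ### First-order sentences -/

/-- Function symbols of a query signature, the constants in `Δ` included. -/
inductive QFun (σ : QuerySignature) (Δ : Type) : ℕ → Type
  | const (c : Δ) : QFun σ Δ 0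
  | func (f : σ.Func) : QFun σ Δ (σ.funcArity f)

/-- Predicate symbols of a query signature. -/
inductive QRel (σ : QuerySignature) : ℕ → Type
  | pred (R : σ.Pred) : QRel σ (σ.predArity R)

/-- The first-order language of a query signature. -/
def QuerySignature.lang (σ : QuerySignature) (Δ : Type) : Language :=
  ⟨QFun σ Δ, QRel σ⟩

/-- First-order sentences of a query signature. -/
abbrev QuerySignature.Sentence (σ : QuerySignature) (Δ : Type) : Type :=
  (σ.lang Δ).Sentence

section Queries

variable {σ : QuerySignature} {Δ : Type}

/-- The replacement of every constant `c` by `τ c` in symbols. -/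
def QFun.rename (τ : Δ → Δ) {n : ℕ} (f : QFun σ Δ n) : QFun σ Δ n :=
  match f with
  | .const c => .const (τ c)
  | .func f => .func f

/-- The replacement of every constant `c` by `τ c` as a morphism of languages. -/
def renameHom (σ : QuerySignature) (τ : Δ → Δ) : σ.lang Δ →ᴸ σ.lang Δ :=
  ⟨fun _ f => QFun.rename τ f, fun _ R => R⟩

/-- The sentence `τ(φ)`. -/
def renameSentence (τ : Δ → Δ) (φ : σ.Sentence Δ) : σ.Sentence Δ :=
  (renameHom σ τ).onSentence φ

/-- `φ` is true in all structures. -/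
def Tautology (φ : σ.Sentence Δ) : Prop :=
  (∅ : (σ.lang Δ).Theory) ⊨ᵇ φ

/-- `ψ` is true in all models of `φ`. -/
def Entails (φ ψ : σ.Sentence Δ) : Prop :=
  ({φ} : (σ.lang Δ).Theory) ⊨ᵇ ψ

variable [Primcodable Δ]

/-- The code of a function symbol. -/
def QFun.code {n : ℕ} (f : QFun σ Δ n) : ℕ :=
  match f with
  | .const c => 2 * Encodable.encode c
  | .func f => 2 * Encodable.encode f + 1

/-- The code of a predicate symbol. -/
def QRel.code {n : ℕ} (R : QRel σ n) : ℕ :=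
  match R with
  | .pred R => Encodable.encode R

/-- The code of a term whose variables are `0, …, n - 1`. -/
def termCode {n : ℕ} : (σ.lang Δ).Term (Empty ⊕ Fin n) → ℕ
  | .var (.inr k) => 2 * (k : ℕ)
  | .func (f : QFun σ Δ _) ts =>
      2 * Nat.pair f.code (Encodable.encode (List.ofFn fun k => termCode (ts k))) + 1

/-- The code of a formula. -/
def formulaCode : {n : ℕ} → (σ.lang Δ).BoundedFormula Empty n → ℕ
  | _, .falsum => 0
  | _, .equal s t => 4 * Nat.pair (termCode s) (termCode t) + 1
  | _, .rel (R : QRel σ _) ts =>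
      4 * Nat.pair R.code (Encodable.encode (List.ofFn fun k => termCode (ts k))) + 2
  | _, .imp φ ψ => 4 * Nat.pair (formulaCode φ) (formulaCode ψ) + 3
  | _, .all φ => 4 * formulaCode φ + 4

/-- The string `⟨φ⟩` that encodes the sentence `φ`. -/
def encSentence (φ : σ.Sentence Δ) : List Bool :=
  enc (formulaCode φ)

theorem QFun.code_injective {m n : ℕ} {f : QFun σ Δ m} {g : QFun σ Δ n} (h : f.code = g.code) :
    m = n ∧ f ≍ g := by
  cases f <;> cases g <;> simp only [QFun.code] at h <;> try omega
  · rw [Encodable.encode_injective (Nat.eq_of_mul_eq_mul_left two_pos h)]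
    exact ⟨rfl, HEq.rfl⟩
  · rw [Encodable.encode_injective (Nat.eq_of_mul_eq_mul_left two_pos (Nat.succ_injective h))]
    exact ⟨rfl, HEq.rfl⟩

theorem QRel.code_injective {m n : ℕ} {R : QRel σ m} {S : QRel σ n} (h : R.code = S.code) :
    m = n ∧ R ≍ S := by
  cases R; cases S
  rw [Encodable.encode_injective h]
  exact ⟨rfl, HEq.rfl⟩

theorem termCode_injective {n : ℕ} :
    Function.Injective (termCode (σ := σ) (Δ := Δ) (n := n)) := by
  intro s
  induction s with
  | var x =>
    intro t h
    rcases x with x | k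
    · exact x.elim
    · rcases t with (x | l) | ⟨g, us⟩
      · exact x.elim
      · simp only [termCode] at h
        rw [Fin.ext (Nat.eq_of_mul_eq_mul_left two_pos h)]
      · simp only [termCode] at h
        omega
  | func f ts ih =>
    intro t h
    rcases t with (x | l) | ⟨g, us⟩
    · exact x.elim
    · simp only [termCode] at h
      omega
    · simp only [termCode] at h
      have h := Nat.eq_of_mul_eq_mul_left two_pos (Nat.succ_injective h)
      rw [Nat.pair_eq_pair] at h
      obtain ⟨rfl, hf⟩ := QFun.code_injective h.1
      obtain rfl := eq_of_heq hf
      have h2 := List.ofFn_injective (Encodable.encode_injective h.2)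
      congr
      funext k
      exact ih k (congrFun h2 k)

theorem formulaCode_injective {n : ℕ} :
    Function.Injective (formulaCode (σ := σ) (Δ := Δ) (n := n)) := by
  intro φ
  induction φ with
  | falsum => intro ψ h; cases ψ <;> simp only [formulaCode] at h <;> first | rfl | omega
  | equal s t =>
    intro ψ h
    cases ψ <;> simp only [formulaCode] at h <;> try omega
    have h := Nat.eq_of_mul_eq_mul_left four_pos (Nat.succ_injective h)
    rw [Nat.pair_eq_pair] at h
    rw [termCode_injective h.1, termCode_injective h.2]
  | rel R ts =>
    intro ψ h
    cases ψ <;> simp only [formulaCode] at h <;> try omega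
    have h := Nat.eq_of_mul_eq_mul_left four_pos (Nat.add_right_cancel h)
    rw [Nat.pair_eq_pair] at h
    obtain ⟨rfl, hf⟩ := QRel.code_injective h.1
    obtain rfl := eq_of_heq hf
    have h2 := List.ofFn_injective (Encodable.encode_injective h.2)
    congr
    funext k
    exact termCode_injective (congrFun h2 k)
  | imp φ ψ ih₁ ih₂ =>
    intro χ h
    cases χ <;> simp only [formulaCode] at h <;> try omega
    have h := Nat.eq_of_mul_eq_mul_left four_pos (Nat.add_right_cancel h)
    rw [Nat.pair_eq_pair] at h
    rw [ih₁ h.1, ih₂ h.2]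
  | all φ ih =>
    intro χ h
    cases χ <;> simp only [formulaCode] at h <;> try omega
    rw [ih (Nat.eq_of_mul_eq_mul_left four_pos (Nat.add_right_cancel h))]

theorem encSentence_injective : Function.Injective (encSentence (σ := σ) (Δ := Δ)) :=
  fun _ _ h => formulaCode_injective (enc_injective h)

/-- Query languages: recursive classes of sentences, closed under conjunctions and constant
renaming, with at least one non-tautological sentence. -/
structure IsQueryLanguage (Q : Set (σ.Sentence Δ)) : Prop where
  recursive : ComputablePred fun w => ∃ φ ∈ Q, encSentence φ = w
  inf_mem : ∀ φ ∈ Q, ∀ ψ ∈ Q, φ ⊓ ψ ∈ Q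
  rename_mem : ∀ τ : Δ → Δ, Function.Injective τ → ∀ φ ∈ Q, renameSentence τ φ ∈ Q
  exists_not_tautology : ∃ φ ∈ Q, ¬ Tautology φ

end Queries

/-! ### Knowledge bases and knowledge representation formalisms -/

section Formalisms

variable {σD : DatabaseSignature} {σQ : QuerySignature} {Δ : Type}

/-- Knowledge bases over `(𝒟, 𝒬)`. -/
structure IsKB (𝒟 : Set (Database σD Δ)) (𝒬 : Set (σQ.Sentence Δ))
    (K : Set (Database σD Δ × σQ.Sentence Δ)) : Prop where
  subset : K ⊆ 𝒟 ×ˢ 𝒬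
  tautology : ∀ D ∈ 𝒟, ∀ φ ∈ 𝒬, Tautology φ → (D, φ) ∈ K
  entails : ∀ D φ ψ, (D, φ) ∈ K → ψ ∈ 𝒬 → Entails φ ψ → (D, ψ) ∈ K
  inf : ∀ D φ ψ, (D, φ) ∈ K → (D, ψ) ∈ K → (D, φ ⊓ ψ) ∈ K
  extend : ∀ D φ, (D, φ) ∈ K → ∀ D₀ ∈ 𝒟, D₀.Extends D → (D₀, φ) ∈ K
  rename : ∀ D φ, (D, φ) ∈ K → ∀ (τ : Δ → Δ) (hτ : Function.Injective τ),
    (D.rename τ hτ, renameSentence τ φ) ∈ K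

/-- `cl(K)`: the least knowledge base over `(𝒟, 𝒬)` that includes `K`. -/
def cl (𝒟 : Set (Database σD Δ)) (𝒬 : Set (σQ.Sentence Δ))
    (K : Set (Database σD Δ × σQ.Sentence Δ)) : Set (Database σD Δ × σQ.Sentence Δ) :=
  ⋂₀ {K' | IsKB 𝒟 𝒬 K' ∧ K ⊆ K'}

variable [Primcodable Δ]

/-- The string `⟨D, φ⟩`. -/
noncomputable def encPair (D : Database σD Δ) (φ : σQ.Sentence Δ) : List Bool :=
  pairStr (encDB D) (encSentence φ)

/-- `K` is recursively enumerable. -/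
def IsRE (K : Set (Database σD Δ × σQ.Sentence Δ)) : Prop :=
  REPred fun w => ∃ D φ, (D, φ) ∈ K ∧ encPair D φ = w

/-- Quasi knowledge representation formalisms over `(𝒟, 𝒬)`. -/
structure IsQKRF (𝒟 : Set (Database σD Δ)) (𝒬 : Set (σQ.Sentence Δ))
    (Γ : List Bool →. Set (Database σD Δ × σQ.Sentence Δ)) : Prop where
  recursive_dom : ComputablePred fun π => π ∈ Γ.Dom
  isKB : ∀ π, ∀ K ∈ Γ π, IsKB 𝒟 𝒬 K

/-- Knowledge representation formalisms over `(𝒟, 𝒬)`: the set of all strings `⟨π, D, φ⟩` with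
`(D, φ) ∈ Γ(π)` is recursively enumerable. -/
structure IsKRF (𝒟 : Set (Database σD Δ)) (𝒬 : Set (σQ.Sentence Δ))
    (Γ : List Bool →. Set (Database σD Δ × σQ.Sentence Δ)) : Prop extends IsQKRF 𝒟 𝒬 Γ where
  re : REPred fun w => ∃ π, ∃ K ∈ Γ π, ∃ D φ, (D, φ) ∈ K ∧ pairStr π (encPair D φ) = w

/-- The range of `Γ` consists of all the recursively enumerable knowledge bases. -/
def ExpressivelyComplete (𝒟 : Set (Database σD Δ)) (𝒬 : Set (σQ.Sentence Δ))
    (Γ : List Bool →. Set (Database σD Δ × σQ.Sentence Δ)) : Prop :=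
  Γ.ran = {K | IsKB 𝒟 𝒬 K ∧ IsRE K}

/-- There is a recursive function `p` from the domain of `Γ` to that of `Γ₀` such that
`Γ(π) = Γ₀(p(π))`. -/
def Reducible (Γ Γ₀ : List Bool →. Set (Database σD Δ × σQ.Sentence Δ)) : Prop :=
  ∃ p : List Bool →. List Bool, IsRecursive p ∧ p.Dom = Γ.Dom ∧ Γ = Γ₀.comp p

/-- Universal knowledge representation formalisms. -/
def IsUniversalKRF (𝒟 : Set (Database σD Δ)) (𝒬 : Set (σQ.Sentence Δ))
    (Γ : List Bool →. Set (Database σD Δ × σQ.Sentence Δ)) : Prop :=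
  IsKRF 𝒟 𝒬 Γ ∧ ∀ Γ', IsKRF 𝒟 𝒬 Γ' → Reducible Γ' Γ

/-! ### The canonical mapping -/

/-- `𝕂(M)`: the pairs in `𝒟 × 𝒬` that `M` accepts. -/
def TM.kb (𝒟 : Set (Database σD Δ)) (𝒬 : Set (σQ.Sentence Δ)) (M : TM) :
    Set (Database σD Δ × σQ.Sentence Δ) :=
  {x | x.1 ∈ 𝒟 ∧ x.2 ∈ 𝒬 ∧ M.Accepts (encPair x.1 x.2)}

/-- The Turing machine `P` performs the closure procedure: given a Turing machine `M` and an input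
`D ∈ 𝒟`, `φ ∈ 𝒬`, it accepts iff `(D, φ) ∈ cl(𝕂(M))`. -/
def ImplementsClosure (𝒟 : Set (Database σD Δ)) (𝒬 : Set (σQ.Sentence Δ)) (P : TM) : Prop :=
  ∀ M : TM, ∀ D ∈ 𝒟, ∀ φ ∈ 𝒬,
    P.Accepts (pairStr (encTM M) (encPair D φ)) ↔ (D, φ) ∈ cl 𝒟 𝒬 (M.kb 𝒟 𝒬)

/-- The Turing machine `M*`, which performs the procedure `P` with `M` as a built-in parameter: on
the input `w`, it works as `P` on the input `⟨M, w⟩`. -/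
def TM.star (M P : TM) : TM :=
  P.hardwire (delimit (encTM M))

/-- The canonical mapping `Θ`: it is defined on the strings `⟨M*⟩`, where `M` is any Turing machine,
and maps `⟨M*⟩` to `𝕂(M*)`. -/
def Theta (𝒟 : Set (Database σD Δ)) (𝒬 : Set (σQ.Sentence Δ)) (P : TM) :
    List Bool →. Set (Database σD Δ × σQ.Sentence Δ) :=
  fun w => ⟨∃ M : TM, encTM (M.star P) = w,
    fun _ => {x | ∃ M : TM, encTM (M.star P) = w ∧ x ∈ (M.star P).kb 𝒟 𝒬}⟩

end Formalisms

end KR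

open KR

/-!
The closure `cl K` has a one-step description (`cl_eq_derivable`): a pair `(D, φ)` belongs to it iff
`φ` follows from finitely many sentences `τ(ψ)`, where `(D', ψ)` is in `K`, `τ` is an injection, and
`D` extends `τ(D')`. The pairs with this property form a knowledge base, since extension and
consequence are invariant under renaming, and every knowledge base that includes `K` contains them.

If `K` is the class of pairs accepted by a Turing machine, this description makes the closure
recursively enumerable, uniformly in the machine (`re_derivableCode`, `derivableCode_iff`).
* Consequence is recursively enumerable (`re_codeEntails`). The counterexamples to an entailment
  correspond to the models of an effectively given set of propositional clauses, which describe
  truth and equality in a structure whose elements are named by terms and by Henkin witnesses.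
  By propositional compactness (`exists_satClause_iff`), the unsatisfiability of such a set shows at
  a finite stage (`re_unsat`).
* Acceptance by a Turing machine is recursively enumerable (`re_accepts`), by simulation on finite
  presentations of configurations.
* A database is determined by its finite support, so that it can be replaced by a list
  (`Represents`, `isDB_iff`), on which extension is decidable.
* An injection matters only on the finitely many constants that occur in the sentence and the
  database, where it agrees with a composition of transpositions (`exists_swaps_eq`). Such
  compositions can be enumerated.

In turn, every recursively enumerable set of strings is accepted by a Turing machine
(`exists_TM_of_re`). By Kleene's normal form, it suffices to search for a zero of a primitive
recursive function. The machine keeps a list of registers, in unary representation, on its tape and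
uses the tape as a queue: rotating the list gives access to every register, and the increment, the
decrement and the test for zero of a register suffice to compute all primitive recursive functions
(`regComputable_of_primrec`). This gives the machine `P` (`exists_implementsClosure`).

Now let `P` be any machine that implements the closure procedure. A string that is built into a
machine acts as a prefix of the input (`TM.hardwire_accepts`), so that `𝕂(M*)` is the closure of
`𝕂(M)` (`TM.star_kb`). The domain of the canonical mapping is decidable, because the string `⟨M⟩`
can be no longer than the list of instructions of `M*`, which bounds the search for `M`
(`computablePred_star`). A knowledge representation formalism `Γ` is enumerated by a machine, and
building `π` into it gives a machine for `Γ(π)`, which is its own closure as it is a knowledge base;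
this is the reduction of `Γ` to the canonical mapping (`IsKRF.reducible_theta`). Finally, a
recursively enumerable knowledge base is `𝕂(M)` for some `M`, and thus equal to `𝕂(M*)`
(`theta_expressivelyComplete`).
-/

namespace KR

/-! ### Closure properties of recursively enumerable predicates -/

section REPred

variable {α β : Type} [Primcodable α] [Primcodable β]

/-- Kleene's normal form: a recursively enumerable predicate is the projection of a primitive
recursive one, which may be taken to be monotone in the search bound. -/
theorem exists_primrec_of_re {p : α → Prop} (h : REPred p) :
    ∃ f : α → ℕ → Bool, Primrec₂ f ∧ (∀ a m n, m ≤ n → f a m = true → f a n = true) ∧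
      ∀ a, p a ↔ ∃ n, f a n = true := by
  obtain ⟨c, hc⟩ := Nat.Partrec.Code.exists_code.1 h
  refine ⟨fun a n => (Nat.Partrec.Code.evaln n c (Encodable.encode a)).isSome, ?_, ?_, ?_⟩
  · exact Primrec.option_isSome.comp (Nat.Partrec.Code.primrec_evaln.comp
      (Primrec.pair (Primrec.pair Primrec.snd (Primrec.const c))
        (Primrec.encode.comp Primrec.fst)))
  · intro a m n hmn h
    obtain ⟨x, hx⟩ := Option.isSome_iff_exists.1 h
    exact Option.isSome_iff_exists.2 ⟨x, Nat.Partrec.Code.evaln_mono hmn hx⟩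
  · intro a
    have h1 : p a ↔ ∃ x, x ∈ Nat.Partrec.Code.eval c (Encodable.encode a) := by
      rw [hc]
      simp [Part.mem_assert_iff]
    rw [h1]
    constructor
    · rintro ⟨x, hx⟩
      obtain ⟨k, hk⟩ := Nat.Partrec.Code.evaln_complete.1 hx
      exact ⟨k, Option.isSome_iff_exists.2 ⟨x, hk⟩⟩
    · rintro ⟨k, hk⟩
      obtain ⟨x, hx⟩ := Option.isSome_iff_exists.1 hk
      exact ⟨x, Nat.Partrec.Code.evaln_sound hx⟩

theorem re_of_exists_nat {f : α → ℕ → Bool} (hf : Computable₂ f) :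
    REPred fun a => ∃ n, f a n = true := by
  have h : Partrec fun a => Nat.rfind fun n => (Part.some (f a n) : Part Bool) :=
    Partrec.rfind hf.partrec₂
  refine h.dom_re.of_eq fun a => ?_
  refine Nat.rfind_dom.trans ⟨?_, ?_⟩
  · rintro ⟨n, hn, _⟩
    exact ⟨n, (Part.mem_some_iff.1 hn).symm⟩
  · rintro ⟨n, hn⟩
    exact ⟨n, Part.mem_some_iff.2 hn.symm, fun _ => trivial⟩

theorem re_comp {p : β → Prop} (h : REPred p) {f : α → β} (hf : Computable f) :
    REPred fun a => p (f a) :=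
  Partrec.comp h hf

theorem re_of_primrecPred {p : α → Prop} (h : PrimrecPred p) : REPred p :=
  h.computablePred.to_re

theorem re_and {p q : α → Prop} (hp : REPred p) (hq : REPred q) :
    REPred fun a => p a ∧ q a := by
  obtain ⟨f, hf, hfm, hfp⟩ := exists_primrec_of_re hp
  obtain ⟨g, hg, hgm, hgq⟩ := exists_primrec_of_re hq
  refine (re_of_exists_nat (Primrec.and.comp₂ hf hg).to_comp).of_eq fun a => ?_
  rw [hfp, hgq]
  constructor
  · rintro ⟨n, hn⟩
    rw [Bool.and_eq_true] at hn
    exact ⟨⟨n, hn.1⟩, n, hn.2⟩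
  · rintro ⟨⟨m, hm⟩, n, hn⟩
    exact ⟨max m n, by
      rw [hfm a m _ (le_max_left _ _) hm, hgm a n _ (le_max_right _ _) hn]; rfl⟩

theorem re_or {p q : α → Prop} (hp : REPred p) (hq : REPred q) :
    REPred fun a => p a ∨ q a := by
  obtain ⟨f, hf, -, hfp⟩ := exists_primrec_of_re hp
  obtain ⟨g, hg, -, hgq⟩ := exists_primrec_of_re hq
  refine (re_of_exists_nat (Primrec.or.comp₂ hf hg).to_comp).of_eq fun a => ?_
  rw [hfp, hgq, ← exists_or]
  simp only [Bool.or_eq_true]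

theorem re_exists {p : α → β → Prop} (h : REPred fun x : α × β => p x.1 x.2) :
    REPred fun a => ∃ b, p a b := by
  obtain ⟨f, hf, -, hfp⟩ := exists_primrec_of_re h
  have hg : Primrec₂ fun (a : α) (n : ℕ) =>
      Option.casesOn (motive := fun _ => Bool) (Encodable.decode (α := β) n.unpair.1) false
        fun b => f (a, b) n.unpair.2 := by
    refine Primrec.option_casesOn (Primrec.decode.comp
      (Primrec.fst.comp (Primrec.unpair.comp Primrec.snd))) (Primrec.const false) ?_
    exact hf.comp (Primrec.pair (Primrec.fst.comp Primrec.fst) Primrec.snd)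
      (Primrec.snd.comp (Primrec.unpair.comp (Primrec.snd.comp Primrec.fst)))
  refine (re_of_exists_nat hg.to_comp).of_eq fun a => ?_
  constructor
  · rintro ⟨n, hn⟩
    cases h : Encodable.decode (α := β) n.unpair.1 with
    | none => simp [h] at hn
    | some b => exact ⟨b, (hfp (a, b)).2 ⟨_, by simpa [h] using hn⟩⟩
  · rintro ⟨b, hb⟩
    obtain ⟨n, hn⟩ := (hfp (a, b)).1 hb
    exact ⟨Nat.pair (Encodable.encode b) n, by simpa using hn⟩

/-- The searches for the finitely many elements of a list have a common bound, because the predicate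
of Kleene's normal form is monotone. -/
theorem re_forall_mem {p : α → β → Prop} (h : REPred fun x : α × β => p x.1 x.2)
    {l : α → List β} (hl : Primrec l) : REPred fun a => ∀ b ∈ l a, p a b := by
  obtain ⟨f, hf, hfm, hfp⟩ := exists_primrec_of_re h
  have hR : PrimrecRel fun (b : β) (x : α × ℕ) => f (x.1, b) x.2 = true :=
    Primrec.eq.comp (hf.comp (Primrec.pair (Primrec.fst.comp Primrec.snd) Primrec.fst)
      (Primrec.snd.comp Primrec.snd)) (Primrec.const true)
  have hg : PrimrecPred fun x : α × ℕ => ∀ b ∈ l x.1, f (x.1, b) x.2 = true :=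
    hR.forall_mem_list.comp (hl.comp Primrec.fst) Primrec.id
  refine (re_of_exists_nat (f := fun a n => decide (∀ b ∈ l a, f (a, b) n = true))
    hg.decide.to_comp).of_eq fun a => ?_
  simp only [decide_eq_true_eq]
  constructor
  · rintro ⟨n, hn⟩ b hb
    exact (hfp (a, b)).2 ⟨n, hn b hb⟩
  · intro hp
    have key : ∀ l' : List β, (∀ b ∈ l', p a b) → ∃ n, ∀ b ∈ l', f (a, b) n = true := by
      intro l'
      induction l' with
      | nil => intro _; exact ⟨0, by simp⟩
      | cons b l' ih =>
        intro hl'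
        obtain ⟨n, hn⟩ := ih fun b' hb' => hl' b' (List.mem_cons_of_mem _ hb')
        obtain ⟨m, hm⟩ := (hfp (a, b)).1 (hl' b List.mem_cons_self)
        refine ⟨max m n, fun b' hb' => ?_⟩
        rcases List.mem_cons.1 hb' with rfl | hb'
        · exact hfm _ _ _ (le_max_left _ _) hm
        · exact hfm _ _ _ (le_max_right _ _) (hn b' hb')
    exact key _ hp

end REPred

/-! ### Strings as finite objects -/

theorem primrec_bits : Primrec Nat.bits := by
  have h : Primrec₂ fun (_ : Unit) (n : ℕ) => n.bits := by
    refine Primrec.nat_strong_rec _ (g := fun _ l =>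
      if l.length = 0 then some [] else
        (l[l.length / 2]?).map fun u => (l.length).bodd :: u) ?_ ?_
    · refine Primrec.ite (Primrec.eq.comp (Primrec.list_length.comp Primrec.snd)
        (Primrec.const 0)) (Primrec.const _) ?_
      refine Primrec.option_map (Primrec.list_getElem?.comp Primrec.snd (Primrec.nat_div.comp
        (Primrec.list_length.comp Primrec.snd) (Primrec.const 2))) ?_
      exact Primrec.list_cons.comp (Primrec.nat_bodd.comp (Primrec.list_length.comp
        (Primrec.snd.comp Primrec.fst))) Primrec.snd
    · intro _ n
      rcases Nat.eq_zero_or_pos n with rfl | hn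
      · simp
      · have h2 : n / 2 < n := Nat.div_lt_self hn one_lt_two
        simp only [List.length_map, List.length_range, hn.ne', if_false]
        rw [List.getElem?_map, List.getElem?_range h2]
        simp only [Option.map_some, Option.some.injEq]
        have h3 : Nat.bit n.bodd n.div2 = n := Nat.bit_bodd_div2 n
        rw [← Nat.div2_val]
        conv_rhs => rw [← h3]
        rw [Nat.bits_append_bit]
        intro h0
        rw [h0] at h3
        cases hb : n.bodd
        · rw [hb] at h3; simp at h3; omega
        · rfl
  exact h.comp (Primrec.const ()) Primrec.id

theorem primrec_enc {α : Type} [Primcodable α] : Primrec (enc : α → List Bool) :=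
  primrec_bits.comp Primrec.encode

theorem primrec_delimit : Primrec delimit := by
  unfold delimit
  refine Primrec.list_append.comp (Primrec.list_flatMap Primrec.id ?_) (Primrec.const _)
  exact Primrec.list_cons.comp (Primrec.const true)
    (Primrec.list_cons.comp Primrec.snd (Primrec.const []))

theorem primrec_pairStr : Primrec₂ pairStr :=
  Primrec.list_append.comp (primrec_delimit.comp Primrec.fst) Primrec.snd

/-! ### Compactness and enumerability of propositional unsatisfiability -/

section Propositional

variable {A : Type} [Primcodable A]

/-- A valuation satisfies a clause, that is, a disjunction of atoms with prescribed values. -/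
def SatClause (V : A → Bool) (c : List (A × Bool)) : Prop :=
  ∃ l ∈ c, V l.1 = l.2

/-- The partial valuation given by a bit string falsifies every literal of the clause. -/
def Falsifies (s : List Bool) (c : List (A × Bool)) : Prop :=
  ∀ l ∈ c, s[Encodable.encode l.1]? = some (!l.2)

/-- Propositional compactness: a set of clauses is satisfiable as soon as no finite depth of the
tree of partial valuations is refuted. -/
theorem exists_satClause_iff (C : List (A × Bool) → Prop) :
    (∃ V : A → Bool, ∀ c, C c → SatClause V c) ↔
      ∀ N, ∃ s : List Bool, s.length = N ∧ ∀ c, C c → ¬ Falsifies s c := by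
  constructor
  · rintro ⟨V, hV⟩ N
    refine ⟨List.ofFn fun i : Fin N => (Encodable.decode (α := A) i).elim false V,
      List.length_ofFn, fun c hc hf => ?_⟩
    obtain ⟨l, hl, hVl⟩ := hV c hc
    have h := hf l hl
    rw [List.getElem?_ofFn] at h
    split_ifs at h with h1
    simp [hVl] at h
  · intro h
    have hclosed : ∀ c : {c // C c}, IsClosed {V : A → Bool | SatClause V c.1} := by
      intro c
      have : {V : A → Bool | SatClause V c.1} =
          ⋃ l ∈ {l | l ∈ c.1}, {V : A → Bool | V l.1 = l.2} := by
        ext V; simp [SatClause]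
      rw [this]
      exact (List.finite_toSet c.1).isClosed_biUnion fun l _ =>
        isClosed_eq (continuous_apply _) continuous_const
    obtain ⟨V, hV⟩ := CompactSpace.iInter_nonempty hclosed (by
      intro F
      obtain ⟨N, hN⟩ : ∃ N, ∀ c ∈ F, ∀ l ∈ c.1, Encodable.encode l.1 < N := by
        refine ⟨F.sup (fun c => (c.1.map fun l => Encodable.encode l.1 + 1).sum), ?_⟩
        intro c hc l hl
        refine lt_of_lt_of_le (Nat.lt_succ_self _) (le_trans ?_ (Finset.le_sup hc))
        exact List.single_le_sum (by simp) _ (List.mem_map.2 ⟨l, hl, rfl⟩)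
      obtain ⟨s, hs, hsC⟩ := h N
      refine ⟨fun a => s[Encodable.encode a]?.getD false, Set.mem_iInter₂.2 fun c hc => ?_⟩
      by_contra hsat
      refine hsC c.1 c.2 fun l hl => ?_
      have hlt : Encodable.encode l.1 < s.length := hs ▸ hN c hc l hl
      have h1 : ¬ (s[Encodable.encode l.1]?.getD false) = l.2 := fun h1 => hsat ⟨l, hl, h1⟩
      rw [List.getElem?_eq_getElem hlt] at h1 ⊢
      simp only [Option.getD_some] at h1
      rw [Option.some.injEq]
      cases hh : l.2 <;> simp_all)
    exact ⟨V, fun c hc => Set.mem_iInter.1 hV ⟨c, hc⟩⟩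

/-- All bit strings of a given length. -/
def bitLists (N : ℕ) : List (List Bool) :=
  Nat.rec [List.nil] (fun _ L => L.flatMap fun s => [true :: s, false :: s]) N

theorem mem_bitLists {N : ℕ} {s : List Bool} : s ∈ bitLists N ↔ s.length = N := by
  induction N generalizing s with
  | zero => simp [bitLists]
  | succ N ih =>
    have : bitLists (N + 1) = (bitLists N).flatMap fun s => [true :: s, false :: s] := rfl
    rw [this, List.mem_flatMap]
    simp only [ih]
    constructor
    · rintro ⟨t, ht, h⟩
      simp only [List.mem_cons, List.not_mem_nil, or_false] at h
      rcases h with rfl | rfl <;> simp [ht]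
    · intro h
      cases s with
      | nil => simp at h
      | cons b s => exact ⟨s, by simpa using h, by cases b <;> simp⟩

theorem primrec_bitLists : Primrec bitLists := by
  refine Primrec.nat_rec₁ (f := fun (_ : ℕ) (L : List (List Bool)) =>
    L.flatMap fun s => [true :: s, false :: s]) _ ?_
  refine Primrec.list_flatMap Primrec.snd ?_
  refine Primrec.list_cons.comp ?_ (Primrec.list_cons.comp ?_ (Primrec.const []))
  · exact Primrec.list_cons.comp (Primrec.const true) Primrec.snd
  · exact Primrec.list_cons.comp (Primrec.const false) Primrec.snd

/-- By compactness, a clause set is unsatisfiable iff all bit strings of some length falsify one of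
its clauses, and such a length can be searched for. -/
theorem re_unsat {X : Type} [Primcodable X] {C : X → List (A × Bool) → Prop}
    (hC : REPred fun x : X × List (A × Bool) => C x.1 x.2) :
    REPred fun x => ¬ ∃ V : A → Bool, ∀ c, C x c → SatClause V c := by
  have h1 : REPred fun x : ((X × ℕ) × List Bool) × List (A × Bool) =>
      C x.1.1.1 x.2 ∧ Falsifies x.1.2 x.2 := by
    refine re_and (re_comp hC (f := fun x : ((X × ℕ) × List Bool) × List (A × Bool) =>
      (x.1.1.1, x.2)) ?_) ?_
    · exact ((Primrec.fst.comp (Primrec.fst.comp Primrec.fst)).pair Primrec.snd).to_comp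
    · refine re_forall_mem (p := fun (x : ((X × ℕ) × List Bool) × List (A × Bool))
        (l : A × Bool) => x.1.2[Encodable.encode l.1]? = some (!l.2)) ?_ Primrec.snd
      refine re_of_primrecPred (Primrec.eq.comp ?_ ?_)
      · exact Primrec.list_getElem?.comp (Primrec.snd.comp (Primrec.fst.comp Primrec.fst))
          (Primrec.encode.comp (Primrec.fst.comp Primrec.snd))
      · exact Primrec.option_some.comp (Primrec.not.comp (Primrec.snd.comp Primrec.snd))
  have h2 : REPred fun x : X × ℕ => ∀ s ∈ bitLists x.2, ∃ c, C x.1 c ∧ Falsifies s c :=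
    re_forall_mem (p := fun (x : X × ℕ) s => ∃ c, C x.1 c ∧ Falsifies s c)
      (re_exists (p := fun (x : (X × ℕ) × List Bool) c => C x.1.1 c ∧ Falsifies x.2 c) h1)
      (primrec_bitLists.comp Primrec.snd)
  refine (re_exists (p := fun x N => ∀ s ∈ bitLists N, ∃ c, C x c ∧ Falsifies s c)
    h2).of_eq fun x => ?_
  rw [exists_satClause_iff]
  push Not
  simp only [mem_bitLists]

end Propositional

/-! ### First-order logic on codes -/

section Untyped

/-- The list of numbers with a given code. -/
def natList (n : ℕ) : List ℕ := Denumerable.ofNat (List ℕ) n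

@[simp] theorem natList_encode (l : List ℕ) : natList (Encodable.encode l) = l :=
  Denumerable.ofNat_encode l

@[simp] theorem encode_natList (n : ℕ) : Encodable.encode (natList n) = n :=
  Denumerable.encode_ofNat n

theorem lt_encode_of_mem {l : List ℕ} {x : ℕ} (h : x ∈ l) : x < Encodable.encode l := by
  induction l with
  | nil => simp at h
  | cons y l ih =>
    rw [Encodable.encode_list_cons]
    rcases List.mem_cons.1 h with rfl | h
    · exact Nat.lt_succ_of_le (Nat.left_le_pair _ _)
    · exact lt_of_lt_of_le (ih h) (le_trans (Nat.right_le_pair _ _) (Nat.le_succ _))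

theorem lt_of_mem_natList {n x : ℕ} (h : x ∈ natList n) : x < n := by
  simpa using lt_encode_of_mem h

/-- The code of a variable. Codes of terms and formulas are built from codes of their parts; terms
and formulas have separate codings. -/
def cVar (k : ℕ) : ℕ := 2 * k
/-- The code of the application of a function symbol. -/
def cFun (f : ℕ) (l : List ℕ) : ℕ := 2 * Nat.pair f (Encodable.encode l) + 1
/-- The code of an equation. -/
def cEq (s t : ℕ) : ℕ := 4 * Nat.pair s t + 1
/-- The code of an atomic formula. -/
def cRel (R : ℕ) (l : List ℕ) : ℕ := 4 * Nat.pair R (Encodable.encode l) + 2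
/-- The code of an implication. -/
def cImp (p q : ℕ) : ℕ := 4 * Nat.pair p q + 3
/-- The code of a universal formula. -/
def cAll (p : ℕ) : ℕ := 4 * p + 4

theorem lt_cFun {f : ℕ} {l : List ℕ} {t : ℕ} (h : t ∈ l) : t < cFun f l := by
  have h1 := lt_encode_of_mem h
  have h2 := Nat.right_le_pair f (Encodable.encode l)
  unfold cFun; omega

theorem term_cases (n : ℕ) : (∃ k, n = cVar k) ∨ ∃ f l, n = cFun f l := by
  rcases Nat.even_or_odd' n with ⟨k, rfl | rfl⟩
  · exact Or.inl ⟨k, rfl⟩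
  · exact Or.inr ⟨k.unpair.1, natList k.unpair.2, by simp [cFun]⟩

theorem formula_cases (n : ℕ) : n = 0 ∨ (∃ s t, n = cEq s t) ∨ (∃ R l, n = cRel R l) ∨
    (∃ p q, n = cImp p q ∧ p < n ∧ q < n) ∨ ∃ p, n = cAll p ∧ p < n := by
  rcases Nat.eq_zero_or_pos n with h | h
  · exact Or.inl h
  have h1 : n = 4 * ((n - 1) / 4) + 1 ∨ n = 4 * ((n - 1) / 4) + 2 ∨
    n = 4 * ((n - 1) / 4) + 3 ∨ n = 4 * ((n - 1) / 4) + 4 := by omega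
  generalize (n - 1) / 4 = k at h1
  have h2 := Nat.unpair_left_le k
  have h3 := Nat.unpair_right_le k
  rcases h1 with rfl | rfl | rfl | rfl
  · exact Or.inr (Or.inl ⟨k.unpair.1, k.unpair.2, by simp [cEq]⟩)
  · exact Or.inr (Or.inr (Or.inl ⟨k.unpair.1, natList k.unpair.2, by simp [cRel]⟩))
  · exact Or.inr (Or.inr (Or.inr (Or.inl ⟨k.unpair.1, k.unpair.2, by simp [cImp], by omega,
      by omega⟩)))
  · exact Or.inr (Or.inr (Or.inr (Or.inr ⟨k, by simp [cAll], by omega⟩)))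

/-- Structures for codes: every number is a function symbol and a predicate symbol, of every
arity. -/
structure CodeStructure (M : Type) where
  funI : ℕ → List M → M
  relI : ℕ → List M → Prop

namespace CodeStructure

variable {M : Type} (S : CodeStructure M)

/-- The value of the term with a given code. A variable beyond the assignment has the value of the
term `cFun 0 []`. -/
def tval (n : ℕ) (a : List M) : M :=
  if n % 2 = 0 then a[n / 2]?.getD (S.funI 0 [])
  else S.funI (n / 2).unpair.1
    ((natList (n / 2).unpair.2).attach.map fun t => tval t.1 a)
termination_by n
decreasing_by
  have h1 := lt_of_mem_natList t.2
  have h2 := Nat.unpair_right_le (n / 2)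
  omega

/-- The truth of the formula with a given code. -/
def truth (n : ℕ) (a : List M) : Prop :=
  match n with
  | 0 => False
  | n + 1 =>
    if n % 4 = 0 then S.tval (n / 4).unpair.1 a = S.tval (n / 4).unpair.2 a
    else if n % 4 = 1 then
      S.relI (n / 4).unpair.1 ((natList (n / 4).unpair.2).map fun t => S.tval t a)
    else if n % 4 = 2 then truth (n / 4).unpair.1 a → truth (n / 4).unpair.2 a
    else ∀ x, truth (n / 4) (a ++ [x])
termination_by n
decreasing_by
  · have := Nat.unpair_left_le (n / 4); omega
  · have := Nat.unpair_right_le (n / 4); omega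
  · omega

@[simp] theorem tval_cVar (k : ℕ) (a : List M) :
    S.tval (cVar k) a = a[k]?.getD (S.funI 0 []) := by
  rw [tval]; simp [cVar]

@[simp] theorem tval_cFun (f : ℕ) (l : List ℕ) (a : List M) :
    S.tval (cFun f l) a = S.funI f (l.map fun t => S.tval t a) := by
  rw [tval]
  have h1 : (2 * Nat.pair f (Encodable.encode l) + 1) % 2 = 1 := by omega
  have h2 : (2 * Nat.pair f (Encodable.encode l) + 1) / 2 = Nat.pair f (Encodable.encode l) := by
    omega
  simp only [cFun, h1, h2, one_ne_zero, if_false, Nat.unpair_pair]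
  congr 1
  rw [List.attach_map_val (f := fun t => S.tval t a), h2, Nat.unpair_pair, natList_encode]

@[simp] theorem truth_zero (a : List M) : S.truth 0 a ↔ False := by
  rw [truth]

@[simp] theorem truth_cEq (s t : ℕ) (a : List M) :
    S.truth (cEq s t) a ↔ S.tval s a = S.tval t a := by
  rw [cEq, truth]
  simp

@[simp] theorem truth_cRel (R : ℕ) (l : List ℕ) (a : List M) :
    S.truth (cRel R l) a ↔ S.relI R (l.map fun t => S.tval t a) := by
  rw [cRel, truth]
  have h1 : (4 * Nat.pair R (Encodable.encode l) + 1) % 4 = 1 := by omega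
  have h2 : (4 * Nat.pair R (Encodable.encode l) + 1) / 4 = Nat.pair R (Encodable.encode l) := by
    omega
  simp [h1, h2]

@[simp] theorem truth_cImp (p q : ℕ) (a : List M) :
    S.truth (cImp p q) a ↔ (S.truth p a → S.truth q a) := by
  rw [cImp, truth]
  have h1 : (4 * Nat.pair p q + 2) % 4 = 2 := by omega
  have h2 : (4 * Nat.pair p q + 2) / 4 = Nat.pair p q := by omega
  simp [h1, h2]

@[simp] theorem truth_cAll (p : ℕ) (a : List M) :
    S.truth (cAll p) a ↔ ∀ x, S.truth p (a ++ [x]) := by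
  rw [cAll, truth]
  have h1 : (4 * p + 3) % 4 = 3 := by omega
  have h2 : (4 * p + 3) / 4 = p := by omega
  simp [h1, h2]

end CodeStructure

/-- Semantic consequence on codes of sentences. -/
def CodeEntails (Γ : List ℕ) (φ : ℕ) : Prop :=
  ∀ (M : Type) (S : CodeStructure M), (∀ γ ∈ Γ, S.truth γ []) → S.truth φ []

end Untyped

/-! ### Enumerability of semantic consequence -/

section Clauses

/-- The atoms of the propositional description of a structure: `inl (c, a)` says that the formula
with code `c` is true under the assignment `a`, and `inr (m, n)` that the elements `m` and `n` are
equal. Elements are numbers. -/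
abbrev HAtom : Type := (ℕ × List ℕ) ⊕ (ℕ × ℕ)

/-- The element that is named by the term with code `t` under an assignment. -/
def closure (t : ℕ) (a : List ℕ) : ℕ := 2 * Nat.pair t (Encodable.encode a)

/-- The element that falsifies the formula with code `p`, as the value of its last variable, if
some element does. -/
def witness (p : ℕ) (a : List ℕ) : ℕ := 2 * Nat.pair p (Encodable.encode a) + 1

/-- The parameters of the clauses: numbers `p`, `q`, `m`, assignments `a`, `b`, and a list of
pairs of terms. -/
abbrev ClauseParam : Type := (ℕ × ℕ × ℕ) × (List ℕ × List ℕ) × List (ℕ × ℕ)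

/-- Literal: the formula `c` has the truth value `v` under the assignment `a`. -/
def litT (c : ℕ) (a : List ℕ) (v : Bool) : HAtom × Bool := (Sum.inl (c, a), v)

/-- Literal: the equation of the elements `m` and `n` has the truth value `v`. -/
def litE (m n : ℕ) (v : Bool) : HAtom × Bool := (Sum.inr (m, n), v)

/-- The instances with given parameters of the clauses that describe truth and equality: the truth
conditions of the logical symbols, with `witness` as the counterexample to a false universal
formula, the laws of equivalence relations, the values of variables, and congruence. Congruence
concerns two assignments, because the same element can have a name under each of them. Variables
without a value are treated as the constant `cFun 0 []`. -/
def logicClauses (x : ClauseParam) : List (List (HAtom × Bool)) :=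
  let p := x.1.1
  let q := x.1.2.1
  let m := x.1.2.2
  let a := x.2.1.1
  let b := x.2.1.2
  let ts := x.2.2
  let l := ts.map Prod.fst
  let r := ts.map Prod.snd
  let prem := ts.map fun y => litE (closure y.1 a) (closure y.2 b) false
  [ [litT 0 a false],
   [litT (cEq p q) a false, litE (closure p a) (closure q a) true],
   [litT (cEq p q) a true, litE (closure p a) (closure q a) false],
   [litT (cImp p q) a false, litT p a false, litT q a true],
   [litT (cImp p q) a true, litT p a true],
   [litT (cImp p q) a true, litT q a false],
   [litT (cAll p) a false, litT p (a ++ [m]) true],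
   [litT (cAll p) a true, litT p (a ++ [witness p a]) false],
   [litE p p true],
   [litE p q false, litE q p true],
   [litE p q false, litE q m false, litE p m true],
   [litE (closure (cVar p) a) (a[p]?.getD (closure (cFun 0 []) [])) true],
   litE (closure (cFun p l) a) (closure (cFun p r) b) true :: prem,
   litT (cRel p l) a false :: litT (cRel p r) b true :: prem ]

/-- The clauses saying that the sentences in `Γ` are true and that `φ` is false. -/
def goalClauses (x : List ℕ × ℕ) : List (List (HAtom × Bool)) :=
  [litT x.2 [] false] :: x.1.map fun γ => [litT γ [] true]

/-- The clauses whose models are the counterexamples to the entailment of `φ` by `Γ`. -/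
def HClause (x : List ℕ × ℕ) (c : List (HAtom × Bool)) : Prop :=
  c ∈ goalClauses x ∨ ∃ y, c ∈ logicClauses y

section Primrec

variable {α : Type} [Primcodable α]

theorem primrec_cFun : Primrec₂ cFun :=
  Primrec.nat_double_succ.comp (Primrec₂.natPair.comp Primrec.fst (Primrec.encode.comp Primrec.snd))

theorem primrec_closure : Primrec₂ closure :=
  Primrec.nat_double.comp (Primrec₂.natPair.comp Primrec.fst (Primrec.encode.comp Primrec.snd))

theorem primrec_witness : Primrec₂ witness :=
  Primrec.nat_double_succ.comp (Primrec₂.natPair.comp Primrec.fst (Primrec.encode.comp Primrec.snd))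

theorem primrec_cVar : Primrec cVar := Primrec.nat_double

theorem primrec_cEq : Primrec₂ cEq :=
  Primrec.nat_add.comp (Primrec.nat_mul.comp (Primrec.const 4)
    (Primrec₂.natPair.comp Primrec.fst Primrec.snd)) (Primrec.const 1)

theorem primrec_cImp : Primrec₂ cImp :=
  Primrec.nat_add.comp (Primrec.nat_mul.comp (Primrec.const 4)
    (Primrec₂.natPair.comp Primrec.fst Primrec.snd)) (Primrec.const 3)

theorem primrec_cRel : Primrec₂ cRel :=
  Primrec.nat_add.comp (Primrec.nat_mul.comp (Primrec.const 4)
    (Primrec₂.natPair.comp Primrec.fst (Primrec.encode.comp Primrec.snd))) (Primrec.const 2)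

theorem primrec_cAll : Primrec cAll :=
  Primrec.nat_add.comp (Primrec.nat_mul.comp (Primrec.const 4) Primrec.id) (Primrec.const 4)

theorem primrec_litT {f : α → ℕ} {g : α → List ℕ} (hf : Primrec f) (hg : Primrec g) (v : Bool) :
    Primrec fun x => litT (f x) (g x) v :=
  (Primrec.sumInl.comp (hf.pair hg)).pair (Primrec.const v)

theorem primrec_litE {f g : α → ℕ} (hf : Primrec f) (hg : Primrec g) (v : Bool) :
    Primrec fun x => litE (f x) (g x) v :=
  (Primrec.sumInr.comp (hf.pair hg)).pair (Primrec.const v)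

theorem primrec_logicClauses : Primrec logicClauses := by
  have p : Primrec fun x : ClauseParam => x.1.1 := Primrec.fst.comp Primrec.fst
  have q : Primrec fun x : ClauseParam => x.1.2.1 :=
    Primrec.fst.comp (Primrec.snd.comp Primrec.fst)
  have m : Primrec fun x : ClauseParam => x.1.2.2 :=
    Primrec.snd.comp (Primrec.snd.comp Primrec.fst)
  have a : Primrec fun x : ClauseParam => x.2.1.1 :=
    Primrec.fst.comp (Primrec.fst.comp Primrec.snd)
  have b : Primrec fun x : ClauseParam => x.2.1.2 :=
    Primrec.snd.comp (Primrec.fst.comp Primrec.snd)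
  have ts : Primrec fun x : ClauseParam => x.2.2 := Primrec.snd.comp Primrec.snd
  have l : Primrec fun x : ClauseParam => x.2.2.map Prod.fst :=
    Primrec.list_map ts (Primrec.fst.comp Primrec.snd)
  have r : Primrec fun x : ClauseParam => x.2.2.map Prod.snd :=
    Primrec.list_map ts (Primrec.snd.comp Primrec.snd)
  have prem : Primrec fun x : ClauseParam =>
      x.2.2.map fun y => litE (closure y.1 x.2.1.1) (closure y.2 x.2.1.2) false :=
    Primrec.list_map ts (primrec_litE
      (primrec_closure.comp (Primrec.fst.comp Primrec.snd) (a.comp Primrec.fst))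
      (primrec_closure.comp (Primrec.snd.comp Primrec.snd) (b.comp Primrec.fst)) false)
  have am : Primrec fun x : ClauseParam => x.2.1.1 ++ [x.1.2.2] := Primrec.list_concat.comp a m
  have aw : Primrec fun x : ClauseParam => x.2.1.1 ++ [witness x.1.1 x.2.1.1] :=
    Primrec.list_concat.comp a (primrec_witness.comp p a)
  have c1 := fun v => primrec_litT (primrec_cEq.comp p q) a v
  have c2 := fun v => primrec_litE (primrec_closure.comp p a) (primrec_closure.comp q a) v
  have c3 := fun v => primrec_litT (primrec_cImp.comp p q) a v
  have c4 := fun v => primrec_litT (primrec_cAll.comp p) a v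
  have nil {β : Type} [Primcodable β] : Primrec fun _ : ClauseParam => ([] : List β) :=
    Primrec.const []
  have cons {β : Type} [Primcodable β] {f : ClauseParam → β} {g : ClauseParam → List β}
    (hf : Primrec f) (hg : Primrec g) : Primrec fun x => f x :: g x := Primrec.list_cons.comp hf hg
  refine cons (cons (primrec_litT (Primrec.const 0) a false) nil) ?_
  refine cons (cons (c1 false) (cons (c2 true) nil)) ?_
  refine cons (cons (c1 true) (cons (c2 false) nil)) ?_
  refine cons (cons (c3 false) (cons (primrec_litT p a false)
    (cons (primrec_litT q a true) nil))) ?_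
  refine cons (cons (c3 true) (cons (primrec_litT p a true) nil)) ?_
  refine cons (cons (c3 true) (cons (primrec_litT q a false) nil)) ?_
  refine cons (cons (c4 false) (cons (primrec_litT p am true) nil)) ?_
  refine cons (cons (c4 true) (cons (primrec_litT p aw false) nil)) ?_
  refine cons (cons (primrec_litE p p true) nil) ?_
  refine cons (cons (primrec_litE p q false) (cons (primrec_litE q p true) nil)) ?_
  refine cons (cons (primrec_litE p q false) (cons (primrec_litE q m false)
    (cons (primrec_litE p m true) nil))) ?_
  refine cons (cons (primrec_litE (primrec_closure.comp (primrec_cVar.comp p) a)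
    (Primrec.option_getD.comp (Primrec.list_getElem?.comp a p) (Primrec.const _)) true) nil) ?_
  refine cons (cons (primrec_litE (primrec_closure.comp (primrec_cFun.comp p l) a)
    (primrec_closure.comp (primrec_cFun.comp p r) b) true) prem) ?_
  exact cons (cons (primrec_litT (primrec_cRel.comp p l) a false)
    (cons (primrec_litT (primrec_cRel.comp p r) b true) prem)) nil

theorem primrec_goalClauses : Primrec goalClauses := by
  refine Primrec.list_cons.comp (Primrec.list_cons.comp
    (primrec_litT Primrec.snd (Primrec.const []) false) (Primrec.const [])) ?_
  exact Primrec.list_map Primrec.fst (Primrec.list_cons.comp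
    (primrec_litT Primrec.snd (Primrec.const []) true) (Primrec.const []))

theorem primrecPred_mem_list {β : Type} [Primcodable β] :
    PrimrecRel fun (b : β) (l : List β) => b ∈ l :=
  ((Primrec.eq (α := β)).exists_mem_list.swap).of_eq fun b l => by
    simp [Function.swap]

theorem re_hClause : REPred fun x : (List ℕ × ℕ) × List (HAtom × Bool) => HClause x.1 x.2 := by
  refine re_or (re_of_primrecPred (primrecPred_mem_list.comp Primrec.snd
    (primrec_goalClauses.comp Primrec.fst))) ?_
  refine re_exists (p := fun (x : (List ℕ × ℕ) × List (HAtom × Bool)) y => x.2 ∈ logicClauses y) ?_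
  exact re_of_primrecPred (primrecPred_mem_list.comp (Primrec.snd.comp Primrec.fst)
    (primrec_logicClauses.comp Primrec.snd))

end Primrec

/-! ### From structures to valuations -/

section Soundness

variable {M : Type} (S : CodeStructure M)

open Classical in
/-- The element of a structure that a number stands for. -/
noncomputable def CodeStructure.elem (n : ℕ) : M :=
  if n % 2 = 0 then
    S.tval (n / 2).unpair.1 ((natList (n / 2).unpair.2).attach.map fun t => CodeStructure.elem t.1)
  else @Classical.epsilon M ⟨S.funI 0 []⟩ fun x => ¬ S.truth (n / 2).unpair.1
    ((natList (n / 2).unpair.2).attach.map (fun t => CodeStructure.elem t.1) ++ [x])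
termination_by n
decreasing_by
  all_goals
    have h1 := lt_of_mem_natList t.2
    have h2 := Nat.unpair_right_le (n / 2)
    omega

/-- An element `closure t a` stands for the value of `t`; this is the recursion equation of
`CodeStructure.elem` in terms of `closure`. -/
theorem CodeStructure.elem_closure (t : ℕ) (a : List ℕ) :
    S.elem (closure t a) = S.tval t (a.map S.elem) := by
  rw [elem]
  have h2 : 2 * Nat.pair t (Encodable.encode a) / 2 = Nat.pair t (Encodable.encode a) := by omega
  simp only [closure, Nat.mul_mod_right, if_true]
  rw [List.attach_map_val (f := S.elem), h2, Nat.unpair_pair, natList_encode]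

/-- If the witness satisfies a formula, then so does every element. -/
theorem CodeStructure.elem_witness (p : ℕ) (a : List ℕ) (x : M)
    (h : S.truth p (a.map S.elem ++ [S.elem (witness p a)])) :
    S.truth p (a.map S.elem ++ [x]) := by
  by_contra hx
  have key := @Classical.epsilon_spec_aux M ⟨x⟩ (fun x => ¬ S.truth p (a.map S.elem ++ [x])) ⟨x, hx⟩
  refine key ?_
  convert h
  rw [elem]
  have h2 : (2 * Nat.pair p (Encodable.encode a) + 1) / 2 = Nat.pair p (Encodable.encode a) := by
    omega
  have h3 : (2 * Nat.pair p (Encodable.encode a) + 1) % 2 = 1 := by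
    omega
  simp only [witness, h3, one_ne_zero, if_false]
  rw [List.attach_map_val (f := S.elem), h2, Nat.unpair_pair, natList_encode]

open Classical in
/-- Every structure induces a valuation that satisfies all clauses, where a number stands for the
element `CodeStructure.elem`. -/
theorem CodeStructure.satClause_logic (y : ClauseParam) (c : List (HAtom × Bool))
    (hc : c ∈ logicClauses y) :
    SatClause (Sum.elim (fun u : ℕ × List ℕ => decide (S.truth u.1 (u.2.map S.elem)))
      fun u : ℕ × ℕ => decide (S.elem u.1 = S.elem u.2)) c := by
  obtain ⟨⟨p, q, m⟩, ⟨a, b⟩, ts⟩ := y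
  have hprem : (∃ t ∈ ts, ¬ S.tval t.1 (a.map S.elem) = S.tval t.2 (b.map S.elem)) ∨
      (ts.map Prod.fst).map (fun t => S.tval t (a.map S.elem)) =
      (ts.map Prod.snd).map (fun t => S.tval t (b.map S.elem)) := by
    by_cases h : ∃ t ∈ ts, ¬ S.tval t.1 (a.map S.elem) = S.tval t.2 (b.map S.elem)
    · exact Or.inl h
    · push Not at h
      right
      rw [List.map_map, List.map_map]
      exact List.map_congr_left fun t ht => h t ht
  simp only [logicClauses, List.mem_cons, List.not_mem_nil, or_false] at hc
  rcases hc with rfl | rfl | rfl | rfl | rfl | rfl | rfl | rfl | rfl | rfl | rfl | rfl | rfl |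
    rfl <;>
  simp only [SatClause, litT, litE, List.mem_cons, List.not_mem_nil, or_false, exists_eq_or_imp,
    exists_eq_left, Sum.elim_inl, Sum.elim_inr, decide_eq_false_iff_not, decide_eq_true_eq,
    truth_zero, truth_cEq, truth_cImp, truth_cAll, truth_cRel, elem_closure, List.map_append,
    List.map_cons, List.map_nil, tval_cFun, tval_cVar, List.mem_map, ↓existsAndEq, and_true,
    true_and]
  · tauto
  · tauto
  · tauto
  · tauto
  · tauto
  · tauto
  · by_cases h : ∀ x, S.truth p (a.map S.elem ++ [x])
    · exact Or.inr (h _)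
    · exact Or.inl h
  · by_cases h : S.truth p (a.map S.elem ++ [S.elem (witness p a)])
    · exact Or.inl fun x => S.elem_witness p a x h
    · exact Or.inr h
  · by_cases h : S.elem p = S.elem q
    · exact Or.inr h.symm
    · exact Or.inl h
  · by_cases h : S.elem p = S.elem q
    · by_cases h' : S.elem q = S.elem m
      · exact Or.inr (Or.inr (h.trans h'))
      · exact Or.inr (Or.inl h')
    · exact Or.inl h
  · rw [List.getElem?_map]
    cases a[p]? <;> simp [elem_closure]
  · rcases hprem with h | h
    · exact Or.inr h
    · left; rw [h]
  · rcases hprem with h | h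
    · exact Or.inr (Or.inr h)
    · rw [h]; tauto

end Soundness

end Clauses

/-! ### From valuations to structures -/

section Completeness

/-- The valuation satisfies all clauses that describe truth and equality. -/
def LogicModel (V : HAtom → Bool) : Prop :=
  ∀ y, ∀ c ∈ logicClauses y, SatClause V c

variable {V : HAtom → Bool}

/-- What the clauses say, apart from the congruence clauses. -/
theorem LogicModel.basic (h : LogicModel V) (p q m : ℕ) (a : List ℕ) :
    V (Sum.inl (0, a)) = false ∧
    (V (Sum.inl (cEq p q, a)) = true ↔ V (Sum.inr (closure p a, closure q a)) = true) ∧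
    (V (Sum.inl (cImp p q, a)) = true ↔
      (V (Sum.inl (p, a)) = true → V (Sum.inl (q, a)) = true)) ∧
    (V (Sum.inl (cAll p, a)) = true → V (Sum.inl (p, a ++ [m])) = true) ∧
    (V (Sum.inl (p, a ++ [witness p a])) = true → V (Sum.inl (cAll p, a)) = true) ∧
    V (Sum.inr (p, p)) = true ∧
    (V (Sum.inr (p, q)) = true → V (Sum.inr (q, p)) = true) ∧
    (V (Sum.inr (p, q)) = true → V (Sum.inr (q, m)) = true → V (Sum.inr (p, m)) = true) ∧
    V (Sum.inr (closure (cVar p) a, a[p]?.getD (closure (cFun 0 []) []))) = true := by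
  have h1 := h ((p, q, m), (a, []), [])
  simp only [logicClauses, List.forall_mem_cons] at h1
  simp only [SatClause, litT, litE, List.mem_cons,
    List.not_mem_nil, or_false, exists_eq_or_imp, exists_eq_left] at h1
  obtain ⟨h0, h1, h2, h3, h4, h5, h6, h7, h8, h9, h10, h11, -, -⟩ := h1
  refine ⟨h0, ⟨?_, ?_⟩, ⟨?_, ?_⟩, ?_, ?_, h8, ?_, ?_, h11⟩ <;> clear h
  all_goals grind

theorem LogicModel.congr_fun (h : LogicModel V) (f : ℕ) (a b : List ℕ) (ts : List (ℕ × ℕ))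
    (hts : ∀ t ∈ ts, V (Sum.inr (closure t.1 a, closure t.2 b)) = true) :
    V (Sum.inr (closure (cFun f (ts.map Prod.fst)) a, closure (cFun f (ts.map Prod.snd)) b))
      = true := by
  have h1 := h ((f, 0, 0), (a, b), ts) (litE (closure (cFun f (ts.map Prod.fst)) a)
    (closure (cFun f (ts.map Prod.snd)) b) true ::
      ts.map fun y => litE (closure y.1 a) (closure y.2 b) false) (by simp [logicClauses])
  obtain ⟨l, hl, hV⟩ := h1
  rcases List.mem_cons.1 hl with rfl | hl
  · exact hV
  · obtain ⟨t, ht, rfl⟩ := List.mem_map.1 hl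
    have := hts t ht
    simp only [litE] at hV
    rw [this] at hV
    cases hV

theorem LogicModel.congr_rel (h : LogicModel V) (R : ℕ) (a b : List ℕ) (ts : List (ℕ × ℕ))
    (hts : ∀ t ∈ ts, V (Sum.inr (closure t.1 a, closure t.2 b)) = true)
    (hR : V (Sum.inl (cRel R (ts.map Prod.fst), a)) = true) :
    V (Sum.inl (cRel R (ts.map Prod.snd), b)) = true := by
  have h1 := h ((R, 0, 0), (a, b), ts) (litT (cRel R (ts.map Prod.fst)) a false ::
    litT (cRel R (ts.map Prod.snd)) b true ::
      ts.map fun y => litE (closure y.1 a) (closure y.2 b) false) (by simp [logicClauses])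
  obtain ⟨l, hl, hV⟩ := h1
  rcases List.mem_cons.1 hl with rfl | hl
  · simp only [litT] at hV
    rw [hR] at hV
    cases hV
  rcases List.mem_cons.1 hl with rfl | hl
  · exact hV
  · obtain ⟨t, ht, rfl⟩ := List.mem_map.1 hl
    have := hts t ht
    simp only [litE] at hV
    rw [this] at hV
    cases hV

/-- Equality of elements according to a valuation. -/
def LogicModel.setoid (h : LogicModel V) : Setoid ℕ where
  r m n := V (Sum.inr (m, n)) = true
  iseqv :=
    ⟨fun p => (h.basic p 0 0 []).2.2.2.2.2.1,
      fun {p q} => (h.basic p q 0 []).2.2.2.2.2.2.1,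
      fun {p q m} => (h.basic p q m []).2.2.2.2.2.2.2.1⟩

/-- The variables `0, …, n - 1`. -/
def varList (n : ℕ) : List ℕ := (List.range n).map cVar

open Classical in
/-- The structure that a valuation describes. -/
noncomputable def LogicModel.structure (h : LogicModel V) : CodeStructure (Quotient h.setoid) where
  funI f l := Quotient.mk _ (closure (cFun f (varList l.length)) (l.map Quotient.out))
  relI R l := V (Sum.inl (cRel R (varList l.length), l.map Quotient.out)) = true

/-- Terms `ts` under an assignment, matched with variables under the list of representatives of
their values. -/
theorem LogicModel.zip_equiv (h : LogicModel V) (ts : List ℕ) (a : List ℕ) :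
    let b := (ts.map fun t => (Quotient.mk h.setoid (closure t a))).map Quotient.out
    ∀ t ∈ ts.zip (varList ts.length),
      V (Sum.inr (closure t.1 a, closure t.2 b)) = true := by
  intro b t ht
  obtain ⟨i, hi, rfl⟩ := List.mem_iff_getElem.1 ht
  have hi' : i < ts.length := by simp [varList] at hi; exact hi
  have h1 := (h.basic i 0 0 b).2.2.2.2.2.2.2.2
  have h2 : b[i]? = some (Quotient.mk h.setoid (closure ts[i] a)).out := by
    simp [b, List.getElem?_eq_getElem hi']
  rw [h2, Option.getD_some] at h1
  have h3 : V (Sum.inr ((Quotient.mk h.setoid (closure ts[i] a)).out, closure ts[i] a)) = true :=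
    Quotient.mk_out (s := h.setoid) (closure ts[i] a)
  simp only [varList, List.getElem_zip, List.getElem_map, List.getElem_range]
  exact h.setoid.symm (h.setoid.trans h1 h3)

theorem LogicModel.tval_structure (h : LogicModel V) (t : ℕ) (a : List ℕ) :
    h.structure.tval t (a.map (Quotient.mk h.setoid)) = Quotient.mk h.setoid (closure t a) := by
  have hfun : ∀ f (ts : List ℕ), (∀ t ∈ ts, h.structure.tval t (a.map (Quotient.mk h.setoid)) =
      Quotient.mk h.setoid (closure t a)) →
      h.structure.tval (cFun f ts) (a.map (Quotient.mk h.setoid)) =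
        Quotient.mk h.setoid (closure (cFun f ts) a) := by
    intro f ts ih
    rw [CodeStructure.tval_cFun, List.map_congr_left ih]
    refine (Quotient.sound (s := h.setoid) ?_ : Quotient.mk h.setoid _ = _)
    have h1 := h.congr_fun f a _ _ (h.zip_equiv ts a)
    rw [List.map_fst_zip (by simp [varList]), List.map_snd_zip (by simp [varList])] at h1
    rw [List.length_map]
    exact h.setoid.symm h1
  induction t using Nat.strong_induction_on with
  | _ t ih =>
    rcases term_cases t with ⟨k, rfl⟩ | ⟨f, ts, rfl⟩
    · have h1 := (h.basic k 0 0 a).2.2.2.2.2.2.2.2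
      rw [CodeStructure.tval_cVar, List.getElem?_map]
      have h2 : h.structure.funI 0 [] = Quotient.mk h.setoid (closure (cFun 0 []) []) := rfl
      have h3 := (Quotient.sound (s := h.setoid) h1).symm
      rw [← h3, h2]
      cases a[k]? <;> rfl
    · exact hfun f ts fun t ht => ih t (lt_cFun ht)

theorem LogicModel.truth_structure (h : LogicModel V) (c : ℕ) (a : List ℕ) :
    h.structure.truth c (a.map (Quotient.mk h.setoid)) ↔ V (Sum.inl (c, a)) = true := by
  induction c using Nat.strong_induction_on generalizing a with
  | _ c ih =>
    rcases formula_cases c with rfl | ⟨s, t, rfl⟩ | ⟨R, ts, rfl⟩ | ⟨p, q, rfl, hp, hq⟩ |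
      ⟨p, rfl, hp⟩
    · simp [(h.basic 0 0 0 a).1]
    · rw [CodeStructure.truth_cEq, h.tval_structure, h.tval_structure, (h.basic s t 0 a).2.1]
      exact ⟨fun h1 => Quotient.exact h1, fun h1 => Quotient.sound (s := h.setoid) h1⟩
    · rw [CodeStructure.truth_cRel, List.map_congr_left fun t _ => h.tval_structure t a]
      have hz := h.zip_equiv ts a
      have e1 : (ts.zip (varList ts.length)).map Prod.fst = ts :=
        List.map_fst_zip (by simp [varList])
      have e2 : (ts.zip (varList ts.length)).map Prod.snd = varList ts.length :=
        List.map_snd_zip (by simp [varList])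
      have h1 := h.congr_rel R a _ _ hz
      have h2 := h.congr_rel R _ a ((ts.zip (varList ts.length)).map Prod.swap) (by
        intro t ht
        obtain ⟨u, hu, rfl⟩ := List.mem_map.1 ht
        exact h.setoid.symm (hz u hu))
      have e3 : ((ts.zip (varList ts.length)).map Prod.swap).map Prod.fst = varList ts.length := by
        rw [List.map_map]; exact e2
      have e4 : ((ts.zip (varList ts.length)).map Prod.swap).map Prod.snd = ts := by
        rw [List.map_map]; exact e1
      rw [e3, e4] at h2
      rw [e1, e2] at h1
      simp only [LogicModel.structure, List.length_map]
      exact ⟨h2, h1⟩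
    · rw [CodeStructure.truth_cImp, ih p hp, ih q hq, (h.basic p q 0 a).2.2.1]
    · rw [CodeStructure.truth_cAll]
      constructor
      · intro h1
        refine (h.basic p 0 0 a).2.2.2.2.1 ?_
        rw [← ih p hp]
        simpa using h1 (Quotient.mk h.setoid (witness p a))
      · intro h1 x
        induction x using Quotient.inductionOn with
        | h m =>
          have h2 := (h.basic p 0 m a).2.2.2.1 h1
          rw [← ih p hp] at h2
          simpa using h2

/-- A counterexample to an entailment exists iff the clauses that describe it are satisfiable. -/
theorem not_codeEntails_iff (x : List ℕ × ℕ) :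
    ¬ CodeEntails x.1 x.2 ↔ ∃ V : HAtom → Bool, ∀ c, HClause x c → SatClause V c := by
  classical
  constructor
  · intro h
    unfold CodeEntails at h
    push Not at h
    obtain ⟨M, S, hΓ, hφ⟩ := h
    refine ⟨_, fun c hc => hc.elim (fun hc => ?_) fun ⟨y, hc⟩ => S.satClause_logic y c hc⟩
    rcases List.mem_cons.1 hc with rfl | hc
    · simpa [SatClause, litT] using hφ
    · obtain ⟨γ, hγ, rfl⟩ := List.mem_map.1 hc
      simpa [SatClause, litT] using hΓ γ hγ
  · rintro ⟨V, hV⟩ h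
    have hL : LogicModel V := fun y c hc => hV c (Or.inr ⟨y, hc⟩)
    have h1 := h _ hL.structure (fun γ hγ => by
      have h2 := hV [litT γ [] true] (Or.inl (List.mem_cons_of_mem _ (List.mem_map.2 ⟨γ, hγ, rfl⟩)))
      exact (hL.truth_structure γ []).2 (by simpa [SatClause, litT] using h2))
    have h2 := hV [litT x.2 [] false] (Or.inl List.mem_cons_self)
    have h3 := (hL.truth_structure x.2 []).1 h1
    simp [SatClause, litT, h3] at h2

/-- Semantic consequence is recursively enumerable. -/
theorem re_codeEntails : REPred fun x : List ℕ × ℕ => CodeEntails x.1 x.2 :=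
  (re_unsat re_hClause).of_eq fun x => by rw [← not_codeEntails_iff, not_not]

end Completeness

/-! ### Sentences and their codes -/

section Sentences

variable {σ : QuerySignature} {Δ : Type} [Primcodable Δ]

/-- The structure for codes agrees with the structure for the language on the codes of symbols. -/
def Agrees {M : Type} (S : CodeStructure M) [(σ.lang Δ).Structure M] : Prop :=
  (∀ n (f : QFun σ Δ n) (v : Fin n → M),
    Language.Structure.funMap (L := σ.lang Δ) (M := M) f v = S.funI f.code (List.ofFn v)) ∧
  ∀ n (R : QRel σ n) (v : Fin n → M),
    Language.Structure.RelMap (L := σ.lang Δ) (M := M) R v ↔ S.relI R.code (List.ofFn v)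

theorem Agrees.tval {M : Type} {S : CodeStructure M} [(σ.lang Δ).Structure M]
    (h : Agrees (σ := σ) (Δ := Δ) S) {n : ℕ} (t : (σ.lang Δ).Term (Empty ⊕ Fin n))
    (v : Fin n → M) (e : Empty → M) :
    S.tval (termCode t) (List.ofFn v) = t.realize (Sum.elim e v) := by
  induction t with
  | var x =>
    rcases x with x | k
    · exact x.elim
    · have : termCode (σ := σ) (Δ := Δ) (Language.Term.var (Sum.inr k) : _) = cVar k := rfl
      rw [this]
      simp
  | func f ts ih =>
    refine (S.tval_cFun (QFun.code (σ := σ) f) (List.ofFn fun k => termCode (ts k)) _).trans ?_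
    rw [List.map_ofFn, Language.Term.realize_func]
    refine Eq.trans ?_ (h.1 _ f _).symm
    congr 2
    funext k
    exact ih k

theorem Agrees.truth {M : Type} {S : CodeStructure M} [(σ.lang Δ).Structure M]
    (h : Agrees (σ := σ) (Δ := Δ) S) {n : ℕ} (φ : (σ.lang Δ).BoundedFormula Empty n)
    (v : Fin n → M) (e : Empty → M) :
    S.truth (formulaCode φ) (List.ofFn v) ↔ φ.Realize e v := by
  induction φ with
  | falsum => exact S.truth_zero _
  | equal s t =>
    refine (S.truth_cEq _ _ _).trans ?_
    rw [h.tval s v e, h.tval t v e]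
    rfl
  | @rel n l R ts =>
    refine (S.truth_cRel (QRel.code (σ := σ) R) (List.ofFn fun k => termCode (ts k)) _).trans ?_
    rw [List.map_ofFn]
    refine Iff.trans ?_ (h.2 l R _).symm
    have : ((fun t => S.tval t (List.ofFn v)) ∘ fun k => termCode (ts k)) =
      fun i => (ts i).realize (Sum.elim e v) := funext fun k => h.tval (ts k) v e
    rw [this]
  | imp φ ψ ih₁ ih₂ =>
    refine (S.truth_cImp _ _ _).trans ?_
    rw [ih₁, ih₂]
    rfl
  | all φ ih =>
    refine (S.truth_cAll _ _).trans ?_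
    refine forall_congr' fun x => ?_
    rw [← ih]
    have : List.ofFn v ++ [x] = List.ofFn (Fin.snoc (α := fun _ => M) v x) := by
      rw [List.ofFn_succ', List.concat_eq_append]
      simp
    rw [this]

/-- Entailment from finitely many sentences. -/
theorem codeEntails_iff (Γ : List (σ.Sentence Δ)) (φ : σ.Sentence Δ) :
    CodeEntails (Γ.map formulaCode) (formulaCode φ) ↔
      ({ψ | ψ ∈ Γ} : (σ.lang Δ).Theory) ⊨ᵇ φ := by
  classical
  rw [Language.Theory.models_sentence_iff]
  have hr : ∀ {M : Type} {S : CodeStructure M} [(σ.lang Δ).Structure M],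
      Agrees (σ := σ) (Δ := Δ) S → ∀ ψ : σ.Sentence Δ, S.truth (formulaCode ψ) [] ↔ M ⊨ ψ := by
    intro M S _ h ψ
    have := h.truth ψ (default : Fin 0 → M) default
    rwa [List.ofFn_zero] at this
  constructor
  · intro h M
    let S : CodeStructure M :=
      { funI := fun c l =>
          if h : ∃ x : Σ n, QFun σ Δ n × (Fin n → M), x.2.1.code = c ∧ List.ofFn x.2.2 = l then
            Language.Structure.funMap (L := σ.lang Δ) (M := M) (n := h.choose.1)
              h.choose.2.1 h.choose.2.2
          else Classical.arbitrary M
        relI := fun c l => ∃ (n : ℕ) (R : QRel σ n) (v : Fin n → M), R.code = c ∧ List.ofFn v = l ∧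
            Language.Structure.RelMap (L := σ.lang Δ) (M := M) R v }
    have hS : Agrees (σ := σ) (Δ := Δ) S := by
      constructor
      · intro n f v
        have hex : ∃ x : Σ n, QFun σ Δ n × (Fin n → M),
          x.2.1.code = f.code ∧ List.ofFn x.2.2 = List.ofFn v := ⟨⟨n, f, v⟩, rfl, rfl⟩
        have hS : S.funI f.code (List.ofFn v) = Language.Structure.funMap (L := σ.lang Δ) (M := M)
            (n := hex.choose.1) hex.choose.2.1 hex.choose.2.2 := dif_pos hex
        rw [hS]
        obtain ⟨h1, h2⟩ := hex.choose_spec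
        generalize hex.choose = x at h1 h2
        obtain ⟨m, g, w⟩ := x
        obtain ⟨rfl, hg⟩ := QFun.code_injective h1
        obtain rfl := eq_of_heq hg
        rw [List.ofFn_injective h2]
      · intro n R v
        constructor
        · intro h
          exact ⟨n, R, v, rfl, rfl, h⟩
        · rintro ⟨m, R', w, h1, h2, h3⟩
          obtain ⟨rfl, hg⟩ := QRel.code_injective h1
          obtain rfl := eq_of_heq hg
          rwa [← List.ofFn_injective h2]
    rw [← hr hS]
    refine h M S ?_
    intro γ hγ
    obtain ⟨ψ, hψ, rfl⟩ := List.mem_map.1 hγ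
    rw [hr hS]
    exact Language.Theory.realize_sentence_of_mem ({ψ | ψ ∈ Γ} : (σ.lang Δ).Theory) hψ
  · intro h M S hΓ
    let _ : (σ.lang Δ).Structure M :=
      ⟨fun {n} (f : QFun σ Δ n) v => S.funI f.code (List.ofFn v),
        fun {n} (R : QRel σ n) v => S.relI R.code (List.ofFn v)⟩
    have hS : Agrees (σ := σ) (Δ := Δ) S := ⟨fun _ _ _ => rfl, fun _ _ _ => Iff.rfl⟩
    have : Nonempty M := ⟨S.funI 0 []⟩
    have : M ⊨ ({ψ | ψ ∈ Γ} : (σ.lang Δ).Theory) := by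
      rw [Language.Theory.model_iff]
      intro ψ hψ
      rw [← hr hS]
      exact hΓ _ (List.mem_map.2 ⟨ψ, hψ, rfl⟩)
    rw [hr hS]
    exact h (Language.Theory.ModelType.of _ M)

end Sentences

/-! ### Structured programs for Turing machines -/

/-- Structured programs that act on a tape: `act f d` replaces the scanned symbol `a` by `f a` and
moves to `d`, and `loop c p` repeats `p` as long as the scanned symbol satisfies `c`. -/
inductive TProg : Type
  | act (f : Option Bool → Option Bool) (d : Turing.Dir)
  | seq (p q : TProg)
  | loop (c : Option Bool → Bool) (p : TProg)

/-- `Exec p t t'`: the program `p` transforms the tape `t` into `t'`. -/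
inductive Exec : TProg → Turing.Tape (Option Bool) → Turing.Tape (Option Bool) → Prop
  | act (f : Option Bool → Option Bool) (d : Turing.Dir) (t : Turing.Tape (Option Bool)) :
      Exec (.act f d) t ((t.write (f t.head)).move d)
  | seq {p q : TProg} {t t' t'' : Turing.Tape (Option Bool)} :
      Exec p t t' → Exec q t' t'' → Exec (.seq p q) t t''
  | done {c : Option Bool → Bool} {p : TProg} {t : Turing.Tape (Option Bool)} :
      c t.head = false → Exec (.loop c p) t t
  | step {c : Option Bool → Bool} {p : TProg} {t t' t'' : Turing.Tape (Option Bool)} :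
      c t.head = true → Exec p t t' → Exec (.loop c p) t' t'' → Exec (.loop c p) t t''

/-- The instructions for one state: for every scanned symbol, the next state, the symbol to be
printed, and the direction. -/
abbrev Row : Type := Option Bool → ℕ × Option Bool × Turing.Dir

/-- The number of states of a program. -/
def TProg.size : TProg → ℕ
  | act _ _ => 1
  | seq p q => p.size + q.size
  | loop _ p => p.size + 4

/-- The rows of a program whose states start at `o`; the program is left at the state `o + size`.
A test is a step to the right and back. -/
def TProg.compile : TProg → ℕ → List Row
  | act f d, o => [fun a => (o + 1, f a, d)]
  | seq p q, o => p.compile o ++ q.compile (o + p.size)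
  | loop c p, o =>
    let test : Row := fun a => (if c a then o + 1 else o + p.size + 3, a, .right)
    (test :: (fun a => (o + 2, a, .left)) :: p.compile (o + 2)) ++
      [test, fun a => (o + p.size + 4, a, .left)]

theorem TProg.length_compile (p : TProg) (o : ℕ) : (p.compile o).length = p.size := by
  induction p generalizing o with
  | act f d => rfl
  | seq p q ihp ihq => simp [compile, size, ihp, ihq]
  | loop c p ih => simp [compile, size, ih]

/-- The Turing machine with one row for every state, which accepts as soon as it leaves the
table for the state after the last one. -/
def TM.ofTable (T : List Row) : TM where
  start := 0
  yes := [T.length]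
  no := []
  instr := T.zipIdx.flatMap fun r => [none, some false, some true].map fun a =>
    ⟨r.2, a, (r.1 a).1, (r.1 a).2.1, (r.1 a).2.2⟩
  halting_nonempty := by simp
  halting_disjoint := by simp
  deterministic := by
    intro i hi j hj h1 h2
    obtain ⟨⟨r, q⟩, hr, hi⟩ := List.mem_flatMap.1 hi
    obtain ⟨⟨r', q'⟩, hr', hj⟩ := List.mem_flatMap.1 hj
    obtain ⟨a, _, rfl⟩ := List.mem_map.1 hi
    obtain ⟨b, _, rfl⟩ := List.mem_map.1 hj
    simp only at h1 h2
    subst h1 h2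
    have e1 := List.mk_mem_zipIdx_iff_getElem?.1 hr
    have e2 := List.mk_mem_zipIdx_iff_getElem?.1 hr'
    rw [e1] at e2
    cases e2
    rfl

theorem TM.step_eq {M : TM} {c : Cfg} {i : Instr} (hi : i ∈ M.instr) (h1 : i.src = c.state)
    (h2 : i.read = c.tape.head) (h3 : c.state ∉ M.yes) (h4 : c.state ∉ M.no) :
    M.step c = some ⟨i.dst, (c.tape.write i.write).move i.dir⟩ := by
  have hf : M.instr.find? (fun i => decide (i.src = c.state ∧ i.read = c.tape.head)) = some i := by
    cases hj : M.instr.find? fun i => decide (i.src = c.state ∧ i.read = c.tape.head) with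
    | none => simpa [h1, h2] using List.find?_eq_none.1 hj i hi
    | some j =>
      have hj1 := List.mem_of_find?_eq_some hj
      have hj2 := List.find?_some hj
      simp only [decide_eq_true_eq] at hj2
      rw [M.deterministic j hj1 i hi (hj2.1.trans h1.symm) (hj2.2.trans h2.symm)]
  rw [TM.step, if_neg (by tauto), hf]
  rfl

theorem TM.ofTable_step {T : List Row} {q : ℕ} {r : Row} (h : T[q]? = some r)
    (t : Turing.Tape (Option Bool)) :
    (TM.ofTable T).step ⟨q, t⟩ =
      some ⟨(r t.head).1, (t.write (r t.head).2.1).move (r t.head).2.2⟩ := by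
  obtain ⟨hq, -⟩ := List.getElem?_eq_some_iff.1 h
  refine TM.step_eq (i := ⟨q, t.head, (r t.head).1, (r t.head).2.1, (r t.head).2.2⟩) ?_ rfl rfl
    ?_ ?_
  · refine List.mem_flatMap.2 ⟨(r, q), List.mk_mem_zipIdx_iff_getElem?.2 h, ?_⟩
    refine List.mem_map.2 ⟨t.head, ?_, rfl⟩
    rcases t.head with _ | _ | _ <;> simp
  · simp only [ofTable, List.mem_singleton]; omega
  · simp [ofTable]

/-- The rows of the program stand in the table from the state `o` on. -/
def Loaded (T : List Row) (o : ℕ) (p : TProg) : Prop :=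
  ∃ A B, T = A ++ p.compile o ++ B ∧ A.length = o

theorem Loaded.seq_left {T : List Row} {o : ℕ} {p q : TProg} (h : Loaded T o (.seq p q)) :
    Loaded T o p := by
  obtain ⟨A, B, rfl, rfl⟩ := h
  exact ⟨A, q.compile (A.length + p.size) ++ B, by simp [TProg.compile], rfl⟩

theorem Loaded.seq_right {T : List Row} {o : ℕ} {p q : TProg} (h : Loaded T o (.seq p q)) :
    Loaded T (o + p.size) q := by
  obtain ⟨A, B, rfl, rfl⟩ := h
  exact ⟨A ++ p.compile A.length, B, by simp [TProg.compile], by simp [TProg.length_compile]⟩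

theorem Loaded.loop_body {T : List Row} {o : ℕ} {c : Option Bool → Bool} {p : TProg}
    (h : Loaded T o (.loop c p)) : Loaded T (o + 2) p := by
  obtain ⟨A, B, rfl, rfl⟩ := h
  simp only [TProg.compile]
  generalize hx : (fun a => (if c a = true then A.length + 1 else A.length + p.size + 3, a,
    Turing.Dir.right) : Row) = x
  generalize hy : (fun a => (A.length + 2, a, Turing.Dir.left) : Row) = y
  generalize hz : (fun a => (A.length + p.size + 4, a, Turing.Dir.left) : Row) = z
  exact ⟨A ++ [x, y], [x, z] ++ B, by simp, by simp⟩

section LoopSteps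

variable {T : List Row} {o : ℕ} {c : Option Bool → Bool} {p : TProg}

theorem Loaded.rows (h : Loaded T o (.loop c p)) :
    T[o]? = some (fun a => (if c a then o + 1 else o + p.size + 3, a, .right)) ∧
    T[o + 1]? = some (fun a => (o + 2, a, .left)) ∧
    T[o + 2 + p.size]? = some (fun a => (if c a then o + 1 else o + p.size + 3, a, .right)) ∧
    T[o + p.size + 3]? = some (fun a => (o + p.size + 4, a, .left)) := by
  obtain ⟨A, B, rfl, rfl⟩ := h
  simp only [TProg.compile]
  have hl := p.length_compile (A.length + 2)
  generalize (p.compile (A.length + 2)) = C at hl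
  rw [← hl]
  refine ⟨?_, ?_, ?_, ?_⟩
  · simp
  · simp
  · rw [List.append_assoc, List.getElem?_append_right (by omega)]
    simp [show A.length + 2 + C.length - A.length = C.length + 1 + 1 by omega]
  · rw [List.append_assoc, List.getElem?_append_right (by omega)]
    simp [show A.length + C.length + 3 - A.length = C.length + 1 + 1 + 1 by omega]

theorem Loaded.enter (h : Loaded T o (.loop c p)) {t : Turing.Tape (Option Bool)}
    (hc : c t.head = true) :
    (TM.ofTable T).step ⟨o, t⟩ = some ⟨o + 1, t.move .right⟩ := by
  rw [TM.ofTable_step h.rows.1]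
  simp [hc]

theorem Loaded.repeat (h : Loaded T o (.loop c p)) {t : Turing.Tape (Option Bool)}
    (hc : c t.head = true) :
    (TM.ofTable T).step ⟨o + 2 + p.size, t⟩ = some ⟨o + 1, t.move .right⟩ := by
  rw [TM.ofTable_step h.rows.2.2.1]
  simp [hc]

theorem Loaded.begin (h : Loaded T o (.loop c p)) (t : Turing.Tape (Option Bool)) :
    (TM.ofTable T).step ⟨o + 1, t.move .right⟩ = some ⟨o + 2, t⟩ := by
  rw [TM.ofTable_step h.rows.2.1]
  simp

theorem Loaded.leave (h : Loaded T o (.loop c p)) (t : Turing.Tape (Option Bool)) :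
    (TM.ofTable T).step ⟨o + p.size + 3, t.move .right⟩ = some ⟨o + p.size + 4, t⟩ := by
  rw [TM.ofTable_step h.rows.2.2.2]
  simp

theorem Loaded.skip (h : Loaded T o (.loop c p)) {t : Turing.Tape (Option Bool)}
    (hc : c t.head = false) :
    (TM.ofTable T).step ⟨o, t⟩ = some ⟨o + p.size + 3, t.move .right⟩ := by
  rw [TM.ofTable_step h.rows.1]
  simp [hc]

theorem Loaded.exit (h : Loaded T o (.loop c p)) {t : Turing.Tape (Option Bool)}
    (hc : c t.head = false) :
    (TM.ofTable T).step ⟨o + 2 + p.size, t⟩ = some ⟨o + p.size + 3, t.move .right⟩ := by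
  rw [TM.ofTable_step h.rows.2.2.1]
  simp [hc]

end LoopSteps

theorem reaches_of_step {σ : Type} {f : σ → Option σ} {a b c : σ} (h : f a = some b)
    (h' : StateTransition.Reaches f b c) : StateTransition.Reaches f a c :=
  Relation.ReflTransGen.head h h'

/-- The compiled program does what the program does. In a loop, the statement is needed both for
the entry point and for the test after the body. -/
theorem Exec.reaches {p : TProg} {t t' : Turing.Tape (Option Bool)} (h : Exec p t t') :
    ∀ {T : List Row} {o : ℕ}, Loaded T o p →
      StateTransition.Reaches (TM.ofTable T).step ⟨o, t⟩ ⟨o + p.size, t'⟩ ∧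
      ∀ c q, p = .loop c q →
        StateTransition.Reaches (TM.ofTable T).step ⟨o + 2 + q.size, t⟩ ⟨o + p.size, t'⟩ := by
  induction h with
  | act f d t =>
    intro T o hT
    refine ⟨?_, by simp⟩
    obtain ⟨A, B, rfl, rfl⟩ := hT
    refine reaches_of_step (TM.ofTable_step (r := fun a => (A.length + 1, f a, d)) ?_ t)
      Relation.ReflTransGen.refl
    simp [TProg.compile]
  | @seq p q t t' t'' _ _ ih₁ ih₂ =>
    intro T o hT
    refine ⟨?_, by simp⟩
    have h1 := (ih₁ hT.seq_left).1
    have h2 := (ih₂ hT.seq_right).1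
    rw [Nat.add_assoc] at h2
    exact h1.trans h2
  | @done c p t hc =>
    intro T o hT
    refine ⟨reaches_of_step (hT.skip hc) (reaches_of_step (hT.leave t) ?_), ?_⟩
    · exact Relation.ReflTransGen.refl
    · rintro _ _ ⟨⟩
      exact reaches_of_step (hT.exit hc) (reaches_of_step (hT.leave t) Relation.ReflTransGen.refl)
  | @step c p t t' t'' hc _ _ ih₁ ih₂ =>
    intro T o hT
    have h1 := (ih₁ hT.loop_body).1
    have h2 := (ih₂ hT).2 c p rfl
    refine ⟨reaches_of_step (hT.enter hc) (reaches_of_step (hT.begin t) (h1.trans h2)), ?_⟩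
    rintro _ _ ⟨⟩
    exact reaches_of_step (hT.repeat hc) (reaches_of_step (hT.begin t) (h1.trans h2))

/-- A computation that visits a set of configurations again and again does not stop. -/
theorem not_reaches_of_chain {σ : Type} {f : σ → Option σ} {H : Set σ}
    (hH : ∀ a ∈ H, ∃ b ∈ H, StateTransition.Reaches₁ f a b) {a : σ} (ha : a ∈ H) {b : σ}
    (hb : f b = none) : ¬ StateTransition.Reaches f a b := by
  intro hab
  have key : ∀ x, StateTransition.Reaches f x b → ¬ ∃ y ∈ H, StateTransition.Reaches f x y := by
    intro x hx
    induction hx using Relation.ReflTransGen.head_induction_on with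
    | refl =>
      rintro ⟨y, hy, hby⟩
      obtain ⟨z, -, hz⟩ := hH y hy
      obtain rfl : y = b := by
        rcases hby.cases_head with h | ⟨c, hc, -⟩
        · exact h.symm
        · rw [hb] at hc; cases hc
      obtain ⟨c, hc, -⟩ := Relation.TransGen.head'_iff.1 hz
      rw [hb] at hc; cases hc
    | @head x x' hxx' _ ih =>
      rintro ⟨y, hy, hxy⟩
      rcases hxy.cases_head with rfl | ⟨c, hc, hcy⟩
      · obtain ⟨z, hzH, hz⟩ := hH x hy
        obtain ⟨c, hc, hcz⟩ := Relation.TransGen.head'_iff.1 hz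
        obtain rfl : x' = c := Option.some.inj (hxx'.symm.trans hc)
        exact ih ⟨z, hzH, hcz⟩
      · obtain rfl : x' = c := Option.some.inj (hxx'.symm.trans hc)
        exact ih ⟨y, hy, hcy⟩
  exact key a hab ⟨a, ha, Relation.ReflTransGen.refl⟩

/-- A loop with an invariant that implies the condition is never left. -/
theorem Loaded.not_reaches {T : List Row} {o : ℕ} {c : Option Bool → Bool} {p : TProg}
    (h : Loaded T o (.loop c p)) {I : Turing.Tape (Option Bool) → Prop}
    (hI : ∀ t, I t → c t.head = true ∧ ∃ t', Exec p t t' ∧ I t')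
    {t : Turing.Tape (Option Bool)} (ht : I t) {b : Cfg} (hb : (TM.ofTable T).step b = none) :
    ¬ StateTransition.Reaches (TM.ofTable T).step ⟨o, t⟩ b := by
  intro hr
  refine not_reaches_of_chain (H := {x : Cfg | ∃ t, I t ∧ x = ⟨o + 1, t.move .right⟩}) ?_
    ⟨t, ht, rfl⟩ hb ?_
  · rintro _ ⟨t, ht, rfl⟩
    obtain ⟨-, t', hp, ht'⟩ := hI t ht
    refine ⟨_, ⟨t', ht', rfl⟩, Relation.TransGen.head' (h.begin t) ?_⟩
    exact ((hp.reaches h.loop_body).1).tail (h.repeat (hI t' ht').1)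
  · rcases hr.cases_head with rfl | ⟨x, hx, hxb⟩
    · rw [h.enter (hI t ht).1] at hb; cases hb
    · rw [h.enter (hI t ht).1] at hx
      cases hx
      exact hxb

/-! ### Tapes as pairs of lists -/

/-- The tape with the symbols `r` from the head to the right, and `l` to the left of the head, in
the order of their distance. -/
def tp (l r : List (Option Bool)) : Turing.Tape (Option Bool) :=
  Turing.Tape.mk₂ l r

theorem mk_append_none (l : List (Option Bool)) :
    Turing.ListBlank.mk (l ++ [none]) = Turing.ListBlank.mk l :=
  Quotient.sound' (Or.inr ⟨1, rfl⟩)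

@[simp] theorem tp_append_none_left (l r : List (Option Bool)) : tp (l ++ [none]) r = tp l r := by
  rw [tp, tp, Turing.Tape.mk₂, Turing.Tape.mk₂, mk_append_none]

@[simp] theorem tp_append_none_right (l r : List (Option Bool)) :
    tp l (r ++ [none]) = tp l r := by
  rw [tp, tp, Turing.Tape.mk₂, Turing.Tape.mk₂, mk_append_none]

@[simp] theorem tp_none_left (r : List (Option Bool)) : tp [none] r = tp [] r :=
  tp_append_none_left [] r

@[simp] theorem tp_none_right (l : List (Option Bool)) : tp l [none] = tp l [] :=
  tp_append_none_right l []

@[simp] theorem head_tp (l r : List (Option Bool)) : (tp l r).head = r.headI := rfl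

@[simp] theorem write_tp (l r : List (Option Bool)) (b : Option Bool) :
    (tp l r).write b = tp l (b :: r.tail) := rfl

@[simp] theorem right_tp (l r : List (Option Bool)) :
    (tp l r).move .right = tp (r.headI :: l) r.tail := by
  simp [tp, Turing.Tape.mk₂]

@[simp] theorem left_tp (l r : List (Option Bool)) :
    (tp l r).move .left = tp l.tail (l.headI :: r) := by
  simp [tp, Turing.Tape.mk₂]

theorem Exec.act_eq {f : Option Bool → Option Bool} {d : Turing.Dir}
    {t t' : Turing.Tape (Option Bool)} (h : (t.write (f t.head)).move d = t') :
    Exec (.act f d) t t' :=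
  h ▸ Exec.act f d t

namespace TProg

/-- Move to the right. -/
def moveR : TProg := act id .right

/-- Move to the left. -/
def moveL : TProg := act id .left

/-- Do nothing. -/
def skip : TProg := loop (fun _ => false) moveR

/-- Move to the right up to the next blank. -/
def runR : TProg := loop Option.isSome moveR

/-- Move to the left up to the next blank, and go back by one cell. -/
def home : TProg := seq (loop Option.isSome moveL) moveR

/-- Erase the scanned symbol and move to the right. -/
def pop : TProg := act (fun _ => none) .right

/-- Append a symbol to the block that starts at the head, and return to its first symbol. -/
def push (b : Bool) : TProg := seq runR (seq (act (fun _ => some b) .left) home)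

end TProg

open TProg

theorem exec_skip (t : Turing.Tape (Option Bool)) : Exec skip t t := Exec.done rfl

theorem exec_moveR (t : Turing.Tape (Option Bool)) : Exec moveR t (t.move .right) :=
  Exec.act_eq (by simp)

theorem exec_moveL (t : Turing.Tape (Option Bool)) : Exec moveL t (t.move .left) :=
  Exec.act_eq (by simp)

theorem exec_runR (u : List Bool) (l r : List (Option Bool)) :
    Exec runR (tp l (u.map some ++ none :: r)) (tp ((u.map some).reverse ++ l) (none :: r)) := by
  induction u generalizing l with
  | nil => exact Exec.done rfl
  | cons b u ih =>
    refine Exec.step rfl (exec_moveR _) ?_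
    simpa [runR] using ih (some b :: l)

theorem exec_runR_end (u : List Bool) (l : List (Option Bool)) :
    Exec runR (tp l (u.map some)) (tp ((u.map some).reverse ++ l) []) := by
  simpa using exec_runR u l []

/-- The head starts immediately to the left of the symbols `r`, which have been passed already; the
block to be passed is `u`, read from right to left. -/
theorem exec_runL (u : List Bool) (l r : List (Option Bool)) :
    Exec (loop Option.isSome moveL) ((tp (u.map some ++ none :: l) r).move .left)
      (tp l (none :: ((u.map some).reverse ++ r))) := by
  induction u generalizing r with
  | nil =>
    rw [left_tp]
    exact Exec.done rfl
  | cons b u ih =>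
    rw [left_tp]
    refine Exec.step rfl (exec_moveL _) ?_
    simpa using ih (some b :: r)

theorem exec_home (u : List Bool) (l r : List (Option Bool)) :
    Exec home ((tp (u.map some ++ none :: l) r).move .left)
      (tp (none :: l) ((u.map some).reverse ++ r)) := by
  refine Exec.seq (exec_runL u l r) ?_
  simpa using exec_moveR (tp l (none :: ((u.map some).reverse ++ r)))

theorem exec_home_end (u : List Bool) (r : List (Option Bool)) :
    Exec home ((tp (u.map some) r).move .left) (tp [] ((u.map some).reverse ++ r)) := by
  have h := exec_home u [] r
  rwa [tp_append_none_left, tp_none_left] at h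

/-! ### Tapes as queues -/

/-- The tape with a string on it, and the head at its first symbol. -/
def queue (u : List Bool) : Turing.Tape (Option Bool) := tp [] (u.map some)

theorem exec_push (b : Bool) (u : List Bool) : Exec (push b) (queue u) (queue (u ++ [b])) := by
  refine Exec.seq (exec_runR_end u []) (Exec.seq (Exec.act _ _ _) ?_)
  have h := exec_home_end u.reverse [some b]
  simpa [queue] using h

theorem exec_pop (b : Bool) (u : List Bool) : Exec pop (queue (b :: u)) (queue u) :=
  Exec.act_eq (by simp [queue])

/-- The scanned symbol is `1`. -/
def isOne (a : Option Bool) : Bool := a == some true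

/-- Move the first block `1…10` of a queue to its end. -/
def TProg.rot : TProg := seq (loop isOne (seq pop (push true))) (seq pop (push false))

/-- The unary representation of a number, with an end marker. -/
def block (n : ℕ) : List Bool := List.replicate n true ++ [false]

theorem exec_rot (n : ℕ) (u : List Bool) :
    Exec rot (queue (block n ++ u)) (queue (u ++ block n)) := by
  have h : ∀ u, Exec (loop isOne (seq pop (push true))) (queue (block n ++ u))
      (queue (false :: u ++ List.replicate n true)) := by
    induction n with
    | zero => intro u; simpa [block] using Exec.done rfl
    | succ n ih =>
      intro u
      refine Exec.step rfl (Exec.seq (exec_pop true (block n ++ u)) (exec_push true _)) ?_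
      have h1 := ih (u ++ [true])
      simpa [List.replicate_succ] using h1
  refine Exec.seq (h u) (Exec.seq (exec_pop false _) ?_)
  simpa [block] using exec_push false (u ++ List.replicate n true)

/-- The tape with a list of numbers on it. -/
def regs (s : List ℕ) : Turing.Tape (Option Bool) := queue (s.flatMap block)

/-- Rotate a list of numbers. -/
def TProg.rotN : ℕ → TProg
  | 0 => skip
  | n + 1 => seq rot (rotN n)

theorem exec_rotN (A B : List ℕ) : Exec (rotN A.length) (regs (A ++ B)) (regs (B ++ A)) := by
  induction A generalizing B with
  | nil => simpa [rotN] using exec_skip (regs B)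
  | cons a A ih =>
    refine Exec.seq (t' := regs (A ++ B ++ [a])) ?_ ?_
    · simpa [regs] using exec_rot a ((A ++ B).flatMap block)
    · simpa using ih (B ++ [a])

/-! ### Register programs -/

/-- The tape that holds the registers `0, …, k - 1`. -/
def RS (k : ℕ) (s : ℕ → ℕ) : Turing.Tape (Option Bool) := regs ((List.range k).map s)

/-- The tape that holds the registers, rotated such that the register `i` is scanned. -/
def RSat (k i : ℕ) (s : ℕ → ℕ) : Turing.Tape (Option Bool) :=
  regs (((List.range k).map s).drop i ++ ((List.range k).map s).take i)

theorem exec_goto {k i : ℕ} (hi : i ≤ k) (s : ℕ → ℕ) : Exec (rotN i) (RS k s) (RSat k i s) := by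
  have h := exec_rotN (((List.range k).map s).take i) (((List.range k).map s).drop i)
  rw [List.take_append_drop] at h
  simpa [hi, RS, RSat] using h

theorem exec_back {k i : ℕ} (s : ℕ → ℕ) : Exec (rotN (k - i)) (RSat k i s) (RS k s) := by
  have h := exec_rotN (((List.range k).map s).drop i) (((List.range k).map s).take i)
  rw [List.take_append_drop] at h
  simpa [RS, RSat] using h

theorem drop_range_eq {k i : ℕ} (hi : i < k) (s : ℕ → ℕ) :
    ((List.range k).map s).drop i = s i :: ((List.range k).map s).drop (i + 1) := by
  rw [List.drop_eq_getElem_cons (by simpa using hi)]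
  simp

theorem RSat_head {k i : ℕ} (hi : i < k) (s : ℕ → ℕ) :
    isOne (RSat k i s).head = decide (s i ≠ 0) := by
  rw [RSat, drop_range_eq hi]
  cases h : s i <;> simp [regs, queue, block, isOne, List.replicate_succ]

theorem take_update (k i n : ℕ) (s : ℕ → ℕ) :
    ((List.range k).map (Function.update s i n)).take i = ((List.range k).map s).take i := by
  refine List.ext_getElem (by simp) fun j h1 h2 => ?_
  simp only [List.length_take, List.length_map, List.length_range] at h1
  simp only [List.getElem_take, List.getElem_map, List.getElem_range]
  rw [Function.update_of_ne (by omega)]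

theorem drop_update (k i n : ℕ) (s : ℕ → ℕ) :
    ((List.range k).map (Function.update s i n)).drop (i + 1) =
      ((List.range k).map s).drop (i + 1) := by
  refine List.ext_getElem (by simp) fun j h1 h2 => ?_
  simp only [List.getElem_drop, List.getElem_map, List.getElem_range]
  rw [Function.update_of_ne (by omega)]

/-- The list of registers, split at the register `i`. -/
theorem RS_update {k i : ℕ} (hi : i < k) (n : ℕ) (s : ℕ → ℕ) :
    RS k (Function.update s i n) = regs (((List.range k).map s).take i ++
      n :: ((List.range k).map s).drop (i + 1)) := by
  have h := List.take_append_drop i ((List.range k).map (Function.update s i n))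
  rw [drop_range_eq hi, take_update, drop_update, Function.update_self] at h
  rw [RS, ← h]

namespace TProg

/-- Increment the register `i` of `k` registers. -/
def inc (k i : ℕ) : TProg := seq (rotN i) (seq (push true) (seq rot (rotN (k - (i + 1)))))

/-- Decrement the register `i` of `k` registers, if it is positive. -/
def dec (k i : ℕ) : TProg := seq (rotN i) (seq pop (rotN (k - i)))

/-- Repeat a program as long as the register `i` of `k` registers is positive. -/
def whl (k i : ℕ) (p : TProg) : TProg :=
  seq (rotN i) (seq (loop isOne (seq (rotN (k - i)) (seq p (rotN i)))) (rotN (k - i)))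

end TProg

theorem exec_inc {k i : ℕ} (hi : i < k) (s : ℕ → ℕ) :
    Exec (inc k i) (RS k s) (RS k (Function.update s i (s i + 1))) := by
  refine Exec.seq (exec_goto hi.le s) ?_
  rw [RSat, drop_range_eq hi, RS_update hi]
  have hlen : (((List.range k).map s).drop (i + 1)).length = k - (i + 1) := by simp
  generalize ((List.range k).map s).take i = A
  generalize ((List.range k).map s).drop (i + 1) = B at hlen
  refine Exec.seq (exec_push true _) (Exec.seq (t' := regs (B ++ (A ++ [s i + 1]))) ?_ ?_)
  · have h := exec_rot (s i) ((B ++ A).flatMap block ++ [true])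
    simpa [regs, block, List.replicate_succ] using h
  · rw [← hlen]
    simpa using exec_rotN B (A ++ [s i + 1])

theorem exec_dec {k i n : ℕ} (hi : i < k) {s : ℕ → ℕ} (hn : s i = n + 1) :
    Exec (dec k i) (RS k s) (RS k (Function.update s i n)) := by
  refine Exec.seq (exec_goto hi.le s) ?_
  rw [RSat, drop_range_eq hi, RS_update hi, hn]
  have hlen : (((List.range k).map s).drop (i + 1)).length = k - (i + 1) := by simp
  generalize ((List.range k).map s).take i = A
  generalize ((List.range k).map s).drop (i + 1) = B at hlen
  refine Exec.seq (t' := regs (n :: B ++ A)) ?_ ?_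
  · have h := exec_pop true ((n :: B ++ A).flatMap block)
    simpa [regs, block, List.replicate_succ] using h
  · have : k - i = (n :: B).length := by simp; omega
    rw [this]
    exact exec_rotN (n :: B) A

/-- One iteration of the loop in `whl`. The head scans the register `i` between the iterations, and
the body starts and ends with the head at the register `0`. -/
theorem exec_inner_step {k i : ℕ} (hi : i < k) {s s' : ℕ → ℕ} {p : TProg}
    {t : Turing.Tape (Option Bool)} (h0 : s i ≠ 0) (hp : Exec p (RS k s) (RS k s'))
    (h : Exec (loop isOne (seq (rotN (k - i)) (seq p (rotN i)))) (RSat k i s') t) :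
    Exec (loop isOne (seq (rotN (k - i)) (seq p (rotN i)))) (RSat k i s) t :=
  Exec.step (by rw [RSat_head hi]; simpa using h0)
    (Exec.seq (exec_back s) (Exec.seq hp (exec_goto hi.le s'))) h

theorem exec_inner_done {k i : ℕ} (hi : i < k) {s : ℕ → ℕ} {p : TProg} (h0 : s i = 0) :
    Exec (loop isOne (seq (rotN (k - i)) (seq p (rotN i)))) (RSat k i s) (RSat k i s) :=
  Exec.done (by rw [RSat_head hi]; simpa using h0)

theorem exec_whl {k i : ℕ} (hi : i < k) {s s' : ℕ → ℕ} {p : TProg}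
    (h : Exec (loop isOne (seq (rotN (k - i)) (seq p (rotN i)))) (RSat k i s) (RSat k i s')) :
    Exec (whl k i p) (RS k s) (RS k s') :=
  Exec.seq (exec_goto hi.le s) (Exec.seq h (exec_back s'))

/-- The rule for loops whose number of iterations stands in the register. -/
theorem exec_for {k i : ℕ} (hi : i < k) {p : TProg} (f : ℕ → ℕ → ℕ) (N : ℕ)
    (hf : ∀ n ≤ N, f n i = n) (hp : ∀ n < N, Exec p (RS k (f (n + 1))) (RS k (f n))) :
    Exec (whl k i p) (RS k (f N)) (RS k (f 0)) := by
  refine exec_whl hi ?_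
  induction N with
  | zero => exact exec_inner_done hi (hf 0 le_rfl)
  | succ N ih =>
    refine exec_inner_step hi (by rw [hf _ le_rfl]; omega) (hp N (Nat.lt_succ_self N)) ?_
    exact ih (fun n hn => hf n (by omega)) fun n hn => hp n (by omega)

open TProg Function

/-! ### Register programs for primitive recursive functions -/

theorem Exec.of_eq {p : TProg} {t : Turing.Tape (Option Bool)} {k : ℕ} {s s' : ℕ → ℕ}
    (h : Exec p t (RS k s)) (hs : s = s') : Exec p t (RS k s') := hs ▸ h

namespace TProg

/-- Set a register to `0`. -/
def clear (k x : ℕ) : TProg := whl k x (dec k x)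

/-- Add the register `x` to the register `y`, and set `x` to `0`. -/
def move (k x y : ℕ) : TProg := whl k x (seq (dec k x) (inc k y))

/-- Add the register `x` to the register `y`, with the register `z` as a temporary store. -/
def copy (k x y z : ℕ) : TProg :=
  seq (whl k x (seq (dec k x) (seq (inc k y) (inc k z)))) (move k z x)

/-- Set the registers `b, …, b + n - 1` to `0`. -/
def clearRange (k b : ℕ) : ℕ → TProg
  | 0 => skip
  | n + 1 => seq (clearRange k b n) (clear k (b + n))

end TProg

theorem exec_clear {k x : ℕ} (hx : x < k) (s : ℕ → ℕ) :
    Exec (clear k x) (RS k s) (RS k (update s x 0)) := by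
  have h := exec_for hx (p := dec k x) (fun n => update s x n) (s x) (fun n _ => by simp)
    (fun n _ => (exec_dec hx (n := n) (by simp)).of_eq (by simp))
  rwa [update_eq_self] at h

theorem exec_move {k x y : ℕ} (hx : x < k) (hy : y < k) (hxy : x ≠ y) (s : ℕ → ℕ) :
    Exec (move k x y) (RS k s) (RS k (update (update s y (s y + s x)) x 0)) := by
  have h := exec_for hx (p := seq (dec k x) (inc k y))
    (fun n => update (update s y (s y + (s x - n))) x n) (s x) (fun n _ => by simp)
    (fun n hn => Exec.seq (exec_dec hx (n := n) (by simp)) ((exec_inc hy _).of_eq (by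
      funext r
      simp only [update_apply]
      split_ifs <;> omega)))
  simp only [Nat.sub_self, Nat.add_zero, Nat.sub_zero, update_eq_self] at h
  exact h

theorem exec_copy {k x y z : ℕ} (hx : x < k) (hy : y < k) (hz : z < k) (hxy : x ≠ y) (hxz : x ≠ z)
    (hyz : y ≠ z) (s : ℕ → ℕ) (h0 : s z = 0) :
    Exec (copy k x y z) (RS k s) (RS k (update s y (s y + s x))) := by
  have h := exec_for hx (p := seq (dec k x) (seq (inc k y) (inc k z)))
    (fun n => update (update (update s y (s y + (s x - n))) z (s x - n)) x n) (s x)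
    (fun n _ => by simp)
    (fun n hn => Exec.seq (exec_dec hx (n := n) (by simp)) (Exec.seq (exec_inc hy _)
      ((exec_inc hz _).of_eq (by
        funext r
        simp only [update_apply]
        split_ifs <;> omega))))
  refine Exec.seq (t' := RS k (update (update (update s y (s y + s x)) z (s x)) x 0)) ?_
    ((exec_move hz hx hxz.symm _).of_eq ?_)
  · have e : update (update (update s y (s y + (s x - s x))) z (s x - s x)) x (s x) = s := by
      funext r
      simp only [update_apply]
      split_ifs <;> simp_all
    rw [e] at h
    simpa using h
  · funext r
    simp only [update_apply]
    split_ifs <;> first | omega | simp_all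

theorem exec_clearRange {k b n : ℕ} (hk : b + n ≤ k) (s : ℕ → ℕ) :
    Exec (clearRange k b n) (RS k s) (RS k fun r => if b ≤ r ∧ r < b + n then 0 else s r) := by
  induction n with
  | zero =>
    refine (exec_skip _).of_eq ?_
    funext r
    rw [if_neg (by omega)]
  | succ n ih =>
    refine Exec.seq (ih (by omega)) ((exec_clear (by omega) _).of_eq ?_)
    funext r
    simp only [update_apply]
    split_ifs <;> omega

/-- A function can be computed by register programs, with any choice of the registers `ins` for the
arguments, `out` for the value, and for the auxiliary registers, which start at `b` and are `0`
before and after the computation. The number `k` of all registers only has to be large enough. -/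
def RegComputable {n : ℕ} (f : List.Vector ℕ n → ℕ) : Prop :=
  ∀ (ins : Fin n → ℕ) (out b : ℕ), (∀ i, ins i < b) → out < b → (∀ i, ins i ≠ out) →
    ∃ K, ∀ k, K ≤ k → ∃ p : TProg, ∀ s : ℕ → ℕ, (∀ j, b ≤ j → s j = 0) → s out = 0 →
      Exec p (RS k s) (RS k (update s out (f (List.Vector.ofFn fun i => s (ins i)))))

theorem RegComputable.get {n : ℕ} (i : Fin n) : RegComputable fun v => v.get i := by
  intro ins out b hins hout hne
  refine ⟨b + 1, fun k hk => ⟨copy k (ins i) out b, fun s hs h0 => ?_⟩⟩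
  have h := exec_copy (k := k) (x := ins i) (y := out) (z := b) (by have := hins i; omega)
    (by omega) (by omega) (hne i) (hins i).ne (by omega) s (hs b le_rfl)
  simpa [h0] using h

theorem RegComputable.succ : RegComputable (n := 1) fun v => Nat.succ v.head := by
  intro ins out b hins hout hne
  refine ⟨b + 1, fun k hk => ⟨seq (copy k (ins 0) out b) (inc k out), fun s hs h0 => ?_⟩⟩
  have h := exec_copy (k := k) (x := ins 0) (y := out) (z := b) (by have := hins 0; omega)
    (by omega) (by omega) (hne 0) (hins 0).ne (by omega) s (hs b le_rfl)
  refine Exec.seq h ((exec_inc (by omega) _).of_eq ?_)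
  simp [h0]

theorem RegComputable.zero : RegComputable (n := 0) fun _ => 0 := by
  intro ins out b hins hout hne
  refine ⟨0, fun k hk => ⟨skip, fun s hs h0 => (exec_skip _).of_eq ?_⟩⟩
  exact (update_eq_iff.2 ⟨h0.symm, fun _ _ => rfl⟩).symm

theorem RegComputable.comp {m n : ℕ} {f : List.Vector ℕ n → ℕ}
    {g : Fin n → List.Vector ℕ m → ℕ} (hf : RegComputable f) (hg : ∀ i, RegComputable (g i)) :
    RegComputable fun a => f (List.Vector.ofFn fun i => g i a) := by
  intro ins out b hins hout hne
  -- the values of `g` are stored in the registers `b, …, b + n - 1`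
  let G : (ℕ → ℕ) → ℕ → ℕ → ℕ := fun s j r =>
    if h : b ≤ r ∧ r < b + j ∧ r < b + n then
      g ⟨r - b, by omega⟩ (List.Vector.ofFn fun i => s (ins i)) else s r
  have key : ∀ j, j ≤ n → ∃ K, ∀ k, K ≤ k → ∃ p : TProg, ∀ s : ℕ → ℕ, (∀ j, b ≤ j → s j = 0) →
      Exec p (RS k s) (RS k (G s j)) := by
    intro j
    induction j with
    | zero =>
      intro _
      refine ⟨0, fun k _ => ⟨skip, fun s _ => (exec_skip _).of_eq ?_⟩⟩
      funext r
      simp only [G]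
      rw [dif_neg (by omega)]
    | succ j ih =>
      intro hj
      obtain ⟨K₁, h₁⟩ := ih (by omega)
      obtain ⟨K₂, h₂⟩ := hg ⟨j, hj⟩ ins (b + j) (b + n) (fun i => by have := hins i; omega)
        (by omega) (fun i => by have := hins i; omega)
      refine ⟨max K₁ K₂, fun k hk => ?_⟩
      obtain ⟨p₁, hp₁⟩ := h₁ k (le_trans (le_max_left _ _) hk)
      obtain ⟨p₂, hp₂⟩ := h₂ k (le_trans (le_max_right _ _) hk)
      refine ⟨seq p₁ p₂, fun s hs => Exec.seq (hp₁ s hs) ((hp₂ _ ?_ ?_).of_eq ?_)⟩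
      · intro r hr
        simp only [G]
        rw [dif_neg (by omega), hs r (by omega)]
      · simp only [G]
        rw [dif_neg (by omega), hs _ (by omega)]
      · have e : (fun i => G s j (ins i)) = fun i => s (ins i) := by
          funext i
          have := hins i
          simp only [G]
          rw [dif_neg (by omega)]
        rw [e]
        funext r
        rw [update_apply]
        simp only [G]
        by_cases hr : r = b + j
        · subst hr
          rw [if_pos rfl, dif_pos (by omega)]
          exact congrFun (congrArg g (Fin.ext (by simp))) _
        · rw [if_neg hr]
          by_cases h : b ≤ r ∧ r < b + j ∧ r < b + n
          · rw [dif_pos h, dif_pos (by omega)]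
          · rw [dif_neg h, dif_neg (by omega)]
  obtain ⟨K₁, h₁⟩ := key n le_rfl
  obtain ⟨K₂, h₂⟩ := hf (fun i => b + i) out (b + n) (fun i => by omega) (by omega)
    (fun i => by omega)
  refine ⟨max (max K₁ K₂) (b + n), fun k hk => ?_⟩
  obtain ⟨p₁, hp₁⟩ := h₁ k (le_trans (le_max_left _ _) (le_trans (le_max_left _ _) hk))
  obtain ⟨p₂, hp₂⟩ := h₂ k (le_trans (le_max_right _ _) (le_trans (le_max_left _ _) hk))
  refine ⟨seq p₁ (seq p₂ (clearRange k b n)), fun s hs h0 => Exec.seq (hp₁ s hs)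
    (Exec.seq (hp₂ _ ?_ ?_) ((exec_clearRange (le_trans (le_max_right _ _) hk) _).of_eq ?_))⟩
  · intro r hr
    simp only [G]
    rw [dif_neg (by omega), hs r (by omega)]
  · simp only [G]
    rw [dif_neg (by omega), h0]
  · have e : (fun i : Fin n => G s n (b + i)) =
        fun i => g i (List.Vector.ofFn fun i => s (ins i)) := by
      funext i
      have := i.2
      simp only [G]
      rw [dif_pos (by omega)]
      exact congrFun (congrArg g (Fin.ext (by simp))) _
    rw [e]
    funext r
    simp only [update_apply, G]
    by_cases hr : r = out
    · rw [if_neg (by omega), if_pos hr, if_pos hr]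
    · rw [if_neg hr, if_neg hr]
      by_cases h : b ≤ r ∧ r < b + n
      · rw [if_pos h, hs r h.1]
      · rw [if_neg h, dif_neg (by omega)]

theorem RegComputable.prec {n : ℕ} {f : List.Vector ℕ n → ℕ} {g : List.Vector ℕ (n + 2) → ℕ}
    (hf : RegComputable f) (hg : RegComputable g) :
    RegComputable fun v : List.Vector ℕ (n + 1) =>
      v.head.rec (f v.tail) fun y IH => g (y ::ᵥ IH ::ᵥ v.tail) := by
  intro ins out b hins hout hne
  -- `b` counts down, `b + 1` counts up, and `b + 2` holds the intermediate values
  obtain ⟨K₁, h₁⟩ := hf (fun i => ins i.succ) (b + 2) (b + 4)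
    (fun i => by have := hins i.succ; omega) (by omega) (fun i => by have := hins i.succ; omega)
  let ins' : Fin (n + 2) → ℕ := Fin.cons (b + 1) (Fin.cons (b + 2) fun i => ins i.succ)
  have hins' : ∀ i, ins' i < b + 3 := by
    intro i
    refine Fin.cases ?_ (fun i => Fin.cases ?_ (fun i => ?_) i) i
    · simp [ins']
    · simp [ins']
    · have := hins i.succ
      simp only [ins', Fin.cons_succ]; omega
  obtain ⟨K₂, h₂⟩ := hg ins' (b + 3) (b + 4) (fun i => by have := hins' i; omega) (by omega)
    (fun i => (hins' i).ne)
  refine ⟨max (max K₁ K₂) (b + 4), fun k hk => ?_⟩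
  have hkb : b + 4 ≤ k := le_trans (le_max_right _ _) hk
  obtain ⟨p₁, hp₁⟩ := h₁ k (le_trans (le_max_left _ _) (le_trans (le_max_left _ _) hk))
  obtain ⟨p₂, hp₂⟩ := h₂ k (le_trans (le_max_right _ _) (le_trans (le_max_left _ _) hk))
  have hin0 := hins 0
  refine ⟨seq p₁ (seq (copy k (ins 0) b (b + 3)) (seq (whl k b (seq (dec k b)
    (seq p₂ (seq (clear k (b + 2)) (seq (move k (b + 3) (b + 2)) (inc k (b + 1)))))))
    (seq (move k (b + 2) out) (clear k (b + 1))))), fun s hs h0 => ?_⟩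
  let v : List.Vector ℕ n := List.Vector.ofFn fun i => s (ins i.succ)
  let N := s (ins 0)
  let R : ℕ → ℕ := fun y => Nat.rec (f v) (fun y IH => g (y ::ᵥ IH ::ᵥ v)) y
  let F : ℕ → ℕ → ℕ := fun m r => if r = b then m else if r = b + 1 then N - m else
    if r = b + 2 then R (N - m) else s r
  have hgoal : (List.Vector.ofFn fun i => s (ins i)).head.rec
      (f (List.Vector.ofFn fun i => s (ins i)).tail)
      (fun y IH => g (y ::ᵥ IH ::ᵥ (List.Vector.ofFn fun i => s (ins i)).tail)) = R N := by
    simp only [R, v, N, List.Vector.head_ofFn, List.Vector.tail_ofFn]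
  simp only [hgoal]
  have hb := hs b le_rfl
  have hb1 := hs (b + 1) (by omega)
  have hb2 := hs (b + 2) (by omega)
  have hb3 := hs (b + 3) (by omega)
  refine Exec.seq (hp₁ s (fun j hj => hs j (by omega)) hb2) ?_
  refine Exec.seq (t' := RS k (F N)) ((exec_copy (by omega) (by omega) (by omega) (by omega)
    (by omega) (by omega) _ ?_).of_eq ?_) ?_
  · rw [update_of_ne (by omega), hb3]
  · funext r
    simp only [update_apply, F, R, N, v, Nat.sub_self]
    split_ifs <;> first | omega | simp_all
  refine Exec.seq (t' := RS k (F 0)) (exec_for (by omega) F N (fun n _ => by simp [F])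
    fun m hm => ?_) ?_
  · refine Exec.seq (exec_dec (by omega) (n := m) (by simp [F])) ?_
    refine Exec.seq (hp₂ _ ?_ ?_) ?_
    · intro j hj
      simp only [update_apply, F]
      rw [if_neg (by omega), if_neg (by omega), if_neg (by omega), if_neg (by omega),
        hs j (by omega)]
    · simp only [update_apply, F]
      rw [if_neg (by omega), if_neg (by omega), if_neg (by omega), if_neg (by omega), hb3]
    · have e : (List.Vector.ofFn fun i => update (F (m + 1)) b m (ins' i)) =
          (N - (m + 1)) ::ᵥ R (N - (m + 1)) ::ᵥ v := by
        have e1 : update (F (m + 1)) b m (ins' 0) = N - (m + 1) := by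
          simp [ins', F]
        have e2 : update (F (m + 1)) b m (ins' (Fin.succ 0)) = R (N - (m + 1)) := by
          simp [ins', F]
        have e3 : ∀ i : Fin n, update (F (m + 1)) b m (ins' i.succ.succ) = s (ins i.succ) := by
          intro i
          have := hins i.succ
          simp only [ins', Fin.cons_succ, update_apply, F]
          rw [if_neg (by omega), if_neg (by omega), if_neg (by omega), if_neg (by omega)]
        simp only [List.Vector.ofFn, v]
        rw [e1, e2]
        congr 2
        congr 1
        funext i
        exact e3 i
      rw [e]
      refine Exec.seq (exec_clear (by omega) _) (Exec.seq (exec_move (by omega) (by omega)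
        (by omega) _) ((exec_inc (by omega) _).of_eq ?_))
      have hR : R (N - m) = g ((N - (m + 1)) ::ᵥ R (N - (m + 1)) ::ᵥ v) := by
        have : N - m = (N - (m + 1)) + 1 := by omega
        rw [this]
      funext r
      simp only [update_apply, F, hR]
      split_ifs <;> first | omega | simp_all
  · refine Exec.seq (exec_move (by omega) (by omega) (by omega) _)
      ((exec_clear (by omega) _).of_eq ?_)
    funext r
    simp only [update_apply, F, Nat.sub_zero]
    split_ifs <;> first | omega | simp_all

theorem regComputable_of_primrec {n : ℕ} {f : List.Vector ℕ n → ℕ} (hf : Nat.Primrec' f) :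
    RegComputable f := by
  induction hf with
  | zero => exact RegComputable.zero
  | succ => exact RegComputable.succ
  | get i => exact RegComputable.get i
  | comp g _ _ hf hg => exact hf.comp hg
  | prec _ _ hf hg => exact hf.prec hg

open TProg Function

/-! ### From binary strings to unary numbers -/

/-- The number with a given binary representation, the least significant bit first. -/
def bitsVal (u : List Bool) : ℕ := u.foldr Nat.bit 0

@[simp] theorem bitsVal_cons (b : Bool) (u : List Bool) :
    bitsVal (b :: u) = Nat.bit b (bitsVal u) := rfl

/-- The additional `1` at the end makes the binary representation free of leading zeros, so that the
string can be recovered from the number. -/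
theorem bits_bitsVal (w : List Bool) : (bitsVal (w ++ [true])).bits = w ++ [true] := by
  have hpos : ∀ w : List Bool, bitsVal (w ++ [true]) ≠ 0 := by
    intro w
    induction w with
    | nil => simp [bitsVal]
    | cons b w ih =>
      rw [List.cons_append, bitsVal_cons]
      cases b <;> simp [ih]
  induction w with
  | nil => simp [bitsVal]
  | cons b w ih =>
    rw [List.cons_append, bitsVal_cons, Nat.bits_append_bit _ _ fun h => absurd h (hpos w), ih]

/-- Either the string consists of zeros only, or it has the form `0…01r`, and then `1…10r`
represents the predecessor. -/
theorem bitsVal_cases (u : List Bool) :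
    (bitsVal u = 0 ∧ u = List.replicate u.length false) ∨
      ∃ j r, u = List.replicate j false ++ true :: r ∧
        bitsVal u = bitsVal (List.replicate j true ++ false :: r) + 1 := by
  induction u with
  | nil => left; simp [bitsVal]
  | cons b u ih =>
    cases b with
    | true => exact Or.inr ⟨0, u, by simp, by simp [Nat.bit]⟩
    | false =>
      rcases ih with ⟨h1, h2⟩ | ⟨j, r, h1, h2⟩
      · left
        refine ⟨by simp [h1], ?_⟩
        rw [List.length_cons, List.replicate_succ, ← h2]
      · right
        refine ⟨j + 1, r, by rw [h1]; rfl, ?_⟩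
        rw [bitsVal_cons, h2, List.replicate_succ, List.cons_append, bitsVal_cons]
        simp only [Nat.bit, cond]
        omega

namespace TProg

/-- Replace a block of `0`s by `1`s, from left to right. -/
def flipBits : TProg := loop (· == some false) (act (fun _ => some true) .right)

/-- The second half of the decrement of a binary number, the first one being `flipBits`, and the
increment of the unary number to the right of it, followed by the first half of the next
decrement. -/
def transfer : TProg :=
  seq (act (fun _ => some false) .right) (seq runR (seq moveR (seq runR
    (seq (act (fun _ => some true) .left) (seq (loop Option.isSome moveL) (seq moveL
      (seq home flipBits)))))))

/-- Replace a string `w` by the unary representation of the number `bitsVal (w ++ [true])`. -/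
def convert : TProg :=
  seq (push true) (seq (seq flipBits (loop isOne transfer))
    (seq moveL (seq home (seq (loop Option.isSome pop) pop))))

end TProg

theorem exec_flip (j : ℕ) (l r : List (Option Bool)) (hr : r.headI ≠ some false) :
    Exec flipBits (tp l ((List.replicate j false).map some ++ r))
      (tp ((List.replicate j true).map some ++ l) r) := by
  induction j generalizing l with
  | zero => exact Exec.done (by simpa using hr)
  | succ j ih =>
    refine Exec.step (by simp [List.replicate_succ]) (Exec.act _ _ _) ?_
    have h := ih (some true :: l)
    have e : List.replicate (j + 1) true = List.replicate j true ++ [true] :=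
      List.replicate_succ'
    rw [e]
    rw [flipBits] at h
    simpa [List.replicate_succ] using h

/-- The loop moves the value of the binary number, unit by unit, to the unary number to the right of
it. A decrement starts with `flipBits`; if this finds no `1`, the binary number was `0`, and the
loop ends. -/
theorem exec_flip_transfer (u : List Bool) (m : ℕ) :
    ∃ ℓ, Exec (seq flipBits (loop isOne transfer))
      (tp [] (u.map some ++ none :: (List.replicate m true).map some))
      (tp ((List.replicate ℓ true).map some)
        (none :: (List.replicate (m + bitsVal u) true).map some)) := by
  induction h : bitsVal u generalizing u m with
  | zero =>
    rcases bitsVal_cases u with ⟨-, h2⟩ | ⟨j, r, -, h2⟩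
    · refine ⟨u.length, ?_⟩
      rw [h2]
      refine Exec.seq (exec_flip u.length [] _ (by simp)) ?_
      simpa using Exec.done (by simp [isOne])
    · omega
  | succ N ih =>
    rcases bitsVal_cases u with ⟨h1, -⟩ | ⟨j, r, h1, h2⟩
    · omega
    · obtain ⟨ℓ, hE⟩ := ih (List.replicate j true ++ false :: r) (m + 1) (by omega)
      refine ⟨ℓ, ?_⟩
      obtain ⟨hf, hl⟩ : ∃ t, Exec flipBits (tp [] ((List.replicate j true ++ false :: r).map some ++
          none :: (List.replicate (m + 1) true).map some)) t ∧ Exec (loop isOne transfer) t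
            (tp ((List.replicate ℓ true).map some)
              (none :: (List.replicate (m + 1 + N) true).map some)) := by
        cases hE with
        | seq h h' => exact ⟨_, h, h'⟩
      obtain ⟨hf, hl⟩ := hl
      rw [h1]
      refine Exec.seq (t' := tp ((List.replicate j true).map some)
        (some true :: (r.map some ++ none :: (List.replicate m true).map some))) ?_ ?_
      · simpa using exec_flip j []
          (some true :: (r.map some ++ none :: (List.replicate m true).map some)) (by simp)
      refine Exec.step (by simp [isOne]) ?_
        (by rw [show m + (N + 1) = m + 1 + N by omega]; exact hl)
      refine Exec.seq (Exec.act _ _ _) ?_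
      rw [write_tp, right_tp]
      refine Exec.seq (exec_runR r _ _) (Exec.seq (exec_moveR _) ?_)
      rw [right_tp]
      refine Exec.seq (exec_runR_end _ _) (Exec.seq (Exec.act _ _ _) ?_)
      rw [write_tp]
      refine Exec.seq (t' := tp ((List.replicate j true ++ false :: r).reverse.map some)
        (none :: (List.replicate (m + 1) true).map some)) ?_ (Exec.seq (exec_moveL _) ?_)
      · have h := exec_runL (List.replicate m true)
          ((List.replicate j true ++ false :: r).reverse.map some) [some true]
        have e : List.replicate (m + 1) true = List.replicate m true ++ [true] :=
          List.replicate_succ'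
        rw [e]
        simpa using h
      · refine Exec.seq (exec_home_end _ _) ?_
        rwa [← List.map_reverse, List.reverse_reverse]

theorem exec_erase (u : List Bool) (r : List (Option Bool)) :
    Exec (loop Option.isSome pop) (tp [] (u.map some ++ none :: r)) (tp [] (none :: r)) := by
  induction u with
  | nil => exact Exec.done rfl
  | cons b u ih => exact Exec.step rfl (Exec.act_eq (by simp)) ih

theorem exec_convert (w : List Bool) :
    Exec convert (queue w) (queue (List.replicate (bitsVal (w ++ [true])) true)) := by
  refine Exec.seq (exec_push true w) ?_
  obtain ⟨ℓ, h⟩ := exec_flip_transfer (w ++ [true]) 0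
  rw [Nat.zero_add] at h
  have e : queue (w ++ [true]) = tp [] ((w ++ [true]).map some ++ none ::
      (List.replicate 0 true).map some) := (tp_append_none_right _ _).symm
  rw [e]
  refine Exec.seq h (Exec.seq (exec_moveL _) (Exec.seq
    (exec_home_end _ _) ?_))
  rw [← List.map_reverse]
  refine Exec.seq (exec_erase _ _) (Exec.act_eq ?_)
  simp [queue]

/-! ### Every recursively enumerable set of strings is accepted by a Turing machine -/

/-- Append `k` symbols `0`. -/
def TProg.pushN : ℕ → TProg
  | 0 => skip
  | k + 1 => seq (pushN k) (push false)

theorem exec_pushN (k : ℕ) (u : List Bool) :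
    Exec (pushN k) (queue u) (queue (u ++ List.replicate k false)) := by
  induction k with
  | zero => simpa [pushN] using exec_skip (queue u)
  | succ k ih =>
    refine Exec.seq ih ?_
    have h := exec_push false (u ++ List.replicate k false)
    rwa [List.append_assoc, ← List.replicate_succ'] at h

/-- A unary number followed by zeros is a list of registers that are `0` except for the first one.
-/
theorem queue_eq_RS (k n : ℕ) :
    queue (List.replicate n true ++ List.replicate (k + 1) false) =
      RS (k + 1) fun i => if i = 0 then n else 0 := by
  rw [RS, regs]
  congr 1
  induction k with
  | zero => simp [block]
  | succ k ih =>
    rw [List.range_succ, List.map_append, List.flatMap_append, ← ih]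
    rw [List.replicate_succ' (n := k + 1), List.append_assoc]
    simp [block]

/-- The Turing machine converts its input to the number `bitsVal (w ++ [true])` and searches for a
zero of `h`. Without a zero, the search loop is never left. -/
theorem exists_TM_of_primrec {h : ℕ → ℕ → ℕ} (hh : Primrec₂ h) :
    ∃ M : TM, ∀ w, M.Accepts w ↔ ∃ n, h (bitsVal (w ++ [true])) n = 0 := by
  have hr := regComputable_of_primrec (Nat.Primrec'.prim_iff₂.2 hh)
  -- the register `0` holds the input, `1` the search bound, and `2` the value of `h`
  obtain ⟨K, hK⟩ := hr (fun i => i) 2 3 (fun i => by omega) (by omega) (fun i => by omega)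
  obtain ⟨q, hq⟩ := hK (max K 3 + 1) (by omega)
  set k := max K 3 + 1 with hk
  let body : TProg := seq (clear k 2) (seq (inc k 1) q)
  let srch : TProg := loop isOne (seq (rotN (k - 2)) (seq body (rotN 2)))
  let pre : TProg := seq convert (seq (pushN k) (seq q (rotN 2)))
  let prog : TProg := seq pre (seq srch (rotN (k - 2)))
  let S : ℕ → ℕ → ℕ → ℕ := fun W n i =>
    if i = 0 then W else if i = 1 then n else if i = 2 then h W n else 0
  have hqS : ∀ W n, Exec q (RS k fun i => if i = 0 then W else if i = 1 then n else 0)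
      (RS k (S W n)) := by
    intro W n
    refine (hq _ (fun j hj => ?_) (by simp)).of_eq ?_
    · rw [if_neg (by omega), if_neg (by omega)]
    · funext i
      simp only [update_apply, S]
      by_cases hi : i = 2
      · subst hi
        simp [List.Vector.ofFn]
      · simp [hi]
  have hpre : ∀ w, Exec pre (queue w) (RSat k 2 (S (bitsVal (w ++ [true])) 0)) := by
    intro w
    refine Exec.seq (exec_convert w) (Exec.seq (exec_pushN k _) (Exec.seq ?_
      (exec_goto (by omega) _)))
    rw [hk, queue_eq_RS, ← hk]
    have := hqS (bitsVal (w ++ [true])) 0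
    simpa using this
  have hbody : ∀ W n, Exec body (RS k (S W n)) (RS k (S W (n + 1))) := by
    intro W n
    refine Exec.seq (exec_clear (by omega) _) (Exec.seq ((exec_inc (by omega) _).of_eq
      (s' := fun i => if i = 0 then W else if i = 1 then n + 1 else 0) ?_) (hqS W (n + 1)))
    funext i
    simp only [update_apply, S]
    split_ifs <;> first | omega | simp_all
  have hload : Loaded (prog.compile 0) 0 prog := ⟨[], [], by simp, rfl⟩
  refine ⟨TM.ofTable (prog.compile 0), fun w => ?_⟩
  have hinit : (TM.ofTable (prog.compile 0)).init w = ⟨0, queue w⟩ := rfl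
  constructor
  · rintro ⟨c, hc, hyes⟩
    by_contra hno
    push Not at hno
    have hstep : (TM.ofTable (prog.compile 0)).step c = none := by
      rw [TM.step, if_pos (Or.inl hyes)]
    rw [hinit] at hc
    have h1 := ((hpre w).reaches hload.seq_left).1
    have h2 : StateTransition.Reaches (TM.ofTable (prog.compile 0)).step
        ⟨0 + pre.size, RSat k 2 (S (bitsVal (w ++ [true])) 0)⟩ c := by
      rcases StateTransition.reaches_total h1 hc with h | h
      · exact h
      · rcases h.cases_head with h | ⟨x, hx, -⟩
        · rw [h]
          exact Relation.ReflTransGen.refl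
        · rw [hstep] at hx; cases hx
    refine Loaded.not_reaches (hload.seq_right.seq_left)
      (I := fun t => ∃ n, t = RSat k 2 (S (bitsVal (w ++ [true])) n)) ?_ ⟨0, rfl⟩ hstep h2
    rintro _ ⟨n, rfl⟩
    refine ⟨?_, _, Exec.seq (exec_back _) (Exec.seq (hbody _ n) (exec_goto (by omega) _)),
      n + 1, rfl⟩
    rw [RSat_head (by omega)]
    simpa [S] using hno n
  · intro hex
    have key : ∀ d n, h (bitsVal (w ++ [true])) (n + d) = 0 → ∃ t, Exec srch
        (RSat k 2 (S (bitsVal (w ++ [true])) n)) (RSat k 2 t) := by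
      intro d
      induction d with
      | zero => exact fun n hn => ⟨_, exec_inner_done (by omega) (by simpa [S] using hn)⟩
      | succ d ih =>
        intro n hn
        by_cases h0 : h (bitsVal (w ++ [true])) n = 0
        · exact ⟨_, exec_inner_done (by omega) (by simpa [S] using h0)⟩
        · obtain ⟨t, ht⟩ := ih (n + 1) (by rwa [show n + 1 + d = n + (d + 1) by omega])
          exact ⟨t, exec_inner_step (by omega) (by simpa [S] using h0) (hbody _ n) ht⟩
    obtain ⟨n, hn⟩ := hex
    obtain ⟨t, ht⟩ := key n 0 (by simpa using hn)
    have hE : Exec prog (queue w) (RS k t) := Exec.seq (hpre w) (Exec.seq ht (exec_back t))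
    refine ⟨_, (hE.reaches hload).1, ?_⟩
    simp [TM.ofTable, TProg.length_compile]

/-- Every recursively enumerable set of strings is accepted by a Turing machine. -/
theorem exists_TM_of_re {p : List Bool → Prop} (hp : REPred p) :
    ∃ M : TM, ∀ w, M.Accepts w ↔ p w := by
  obtain ⟨f, hf, -, hfp⟩ := exists_primrec_of_re hp
  have hd : Primrec fun n : ℕ => n.bits.take (n.bits.length - 1) :=
    Primrec.list_take.comp (Primrec.nat_sub.comp (Primrec.list_length.comp primrec_bits)
      (Primrec.const 1)) primrec_bits
  have hh : Primrec₂ fun n m : ℕ =>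
      cond (f (n.bits.take (n.bits.length - 1)) m) 0 1 :=
    Primrec.cond (hf.comp (hd.comp Primrec.fst) Primrec.snd) (Primrec.const 0) (Primrec.const 1)
  obtain ⟨M, hM⟩ := exists_TM_of_primrec hh
  refine ⟨M, fun w => ?_⟩
  rw [hM, hfp]
  refine exists_congr fun n => ?_
  rw [bits_bitsVal]
  cases hc : f w n <;> simp [hc]

/-! ### Universal simulation -/

/-- The finite objects that present Turing machines. -/
abbrev Tup : Type := ℕ × List ℕ × List ℕ × List (ℕ × Option Bool × ℕ × Option Bool × Bool)

/-- The presentation of a Turing machine, whose code is `encTM`. -/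
def TM.tup (M : TM) : Tup := (M.start, M.yes, M.no, M.instr.map Instr.toTuple)

/-- A tuple presents a Turing machine. -/
def IsTM (t : Tup) : Prop :=
  (t.2.1 ++ t.2.2.1 ≠ [] ∧ ∀ q ∈ t.2.1, q ∉ t.2.2.1) ∧
    ∀ i ∈ t.2.2.2, ∀ j ∈ t.2.2.2, i.1 = j.1 → i.2.1 = j.2.1 → i = j

theorem TM.isTM_tup (M : TM) : IsTM M.tup := by
  refine ⟨⟨M.halting_nonempty, M.halting_disjoint⟩, fun i hi j hj h1 h2 => ?_⟩
  obtain ⟨i, hi', rfl⟩ := List.mem_map.1 hi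
  obtain ⟨j, hj', rfl⟩ := List.mem_map.1 hj
  rw [M.deterministic i hi' j hj' h1 h2]

/-- The instruction with given components. -/
def Instr.ofTuple (i : ℕ × Option Bool × ℕ × Option Bool × Bool) : Instr :=
  ⟨i.1, i.2.1, i.2.2.1, i.2.2.2.1, if i.2.2.2.2 then .right else .left⟩

theorem Instr.toTuple_ofTuple (i : ℕ × Option Bool × ℕ × Option Bool × Bool) :
    (Instr.ofTuple i).toTuple = i := by
  obtain ⟨a, b, c, d, e⟩ := i
  cases e <;> rfl

theorem IsTM.exists {t : Tup} (h : IsTM t) : ∃ M : TM, M.tup = t := by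
  obtain ⟨a, b, c, d⟩ := t
  refine ⟨⟨a, b, c, d.map Instr.ofTuple, h.1.1, h.1.2, fun i hi j hj h1 h2 => ?_⟩, ?_⟩
  · obtain ⟨i, hi', rfl⟩ := List.mem_map.1 hi
    obtain ⟨j, hj', rfl⟩ := List.mem_map.1 hj
    rw [h.2 i hi' j hj' h1 h2]
  · simp [TM.tup, Function.comp_def, Instr.toTuple_ofTuple]

theorem primrecPred_isTM : PrimrecPred IsTM := by
  refine PrimrecPred.and (PrimrecPred.and (PrimrecPred.not ?_) ?_) ?_
  · exact Primrec.eq.comp (Primrec.list_append.comp (Primrec.fst.comp Primrec.snd)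
      (Primrec.fst.comp (Primrec.snd.comp Primrec.snd))) (Primrec.const _)
  · have h : PrimrecRel fun (q : ℕ) (l : List ℕ) => q ∉ l := primrecPred_mem_list.not
    exact h.forall_mem_list.comp (Primrec.fst.comp Primrec.snd)
      (Primrec.fst.comp (Primrec.snd.comp Primrec.snd))
  · have h : PrimrecRel fun (i j : ℕ × Option Bool × ℕ × Option Bool × Bool) =>
        i.1 = j.1 → i.2.1 = j.2.1 → j = i := by
      have h1 : PrimrecPred fun x : (ℕ × Option Bool × ℕ × Option Bool × Bool) ×
          (ℕ × Option Bool × ℕ × Option Bool × Bool) => x.1.1 = x.2.1 :=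
        Primrec.eq.comp (Primrec.fst.comp Primrec.fst) (Primrec.fst.comp Primrec.snd)
      have h2 : PrimrecPred fun x : (ℕ × Option Bool × ℕ × Option Bool × Bool) ×
          (ℕ × Option Bool × ℕ × Option Bool × Bool) => x.1.2.1 = x.2.2.1 :=
        Primrec.eq.comp (Primrec.fst.comp (Primrec.snd.comp Primrec.fst))
          (Primrec.fst.comp (Primrec.snd.comp Primrec.snd))
      have h3 : PrimrecPred fun x : (ℕ × Option Bool × ℕ × Option Bool × Bool) ×
          (ℕ × Option Bool × ℕ × Option Bool × Bool) => x.2 = x.1 :=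
        Primrec.eq.comp Primrec.snd Primrec.fst
      exact (h1.not.or (h2.not.or h3)).of_eq fun x => by tauto
    have h' := h.forall_mem_list
    have h1 : PrimrecRel fun
      (j : ℕ × Option Bool × ℕ × Option Bool × Bool)
      (l : List (ℕ × Option Bool × ℕ × Option Bool × Bool)) =>
        ∀ i ∈ l, i.1 = j.1 → i.2.1 = j.2.1 → j = i := h'.comp Primrec.snd Primrec.fst
    have h2 := h1.forall_mem_list
    have h3 := h2.comp (Primrec.id (α := List (ℕ × Option Bool × ℕ × Option Bool × Bool)))
      Primrec.id
    refine (h3.comp (Primrec.snd.comp (Primrec.snd.comp Primrec.snd))).of_eq fun t => ?_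
    exact ⟨fun h i hi j hj e1 e2 => h i hi j hj e1.symm e2.symm,
      fun h i hi j hj e1 e2 => h i hi j hj e1.symm e2.symm⟩

/-- Configurations with the tape given as by `tp`. -/
abbrev TupCfg : Type := ℕ × List (Option Bool) × List (Option Bool)

/-- The configuration that is presented by finite lists. -/
def toCfg (c : TupCfg) : Cfg := ⟨c.1, tp c.2.1 c.2.2⟩

/-- The result of an instruction. -/
def tupApply (i : ℕ × Option Bool × ℕ × Option Bool × Bool) (c : TupCfg) : TupCfg :=
  if i.2.2.2.2 = true then (i.2.2.1, i.2.2.2.1 :: c.2.1, c.2.2.tail)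
  else (i.2.2.1, c.2.1.tail, c.2.1.headI :: i.2.2.2.1 :: c.2.2.tail)

/-- One step of computation on finite presentations; final configurations are repeated. -/
def tupStep (t : Tup) (c : TupCfg) : TupCfg :=
  if c.1 ∈ t.2.1 ∨ c.1 ∈ t.2.2.1 then c
  else ((t.2.2.2.find? fun i => decide (i.1 = c.1 ∧ i.2.1 = c.2.2.headI)).map
    fun i => tupApply i c).getD c

theorem toCfg_tupStep (M : TM) (c : TupCfg) :
    toCfg (tupStep M.tup c) = (M.step (toCfg c)).getD (toCfg c) := by
  by_cases h : c.1 ∈ M.yes ∨ c.1 ∈ M.no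
  · rw [tupStep, TM.step, if_pos (show c.1 ∈ M.tup.2.1 ∨ c.1 ∈ M.tup.2.2.1 from h),
      if_pos (show (toCfg c).state ∈ M.yes ∨ (toCfg c).state ∈ M.no from h)]
    rfl
  · rw [tupStep, TM.step, if_neg (show ¬ (c.1 ∈ M.tup.2.1 ∨ c.1 ∈ M.tup.2.2.1) from h),
      if_neg (show ¬ ((toCfg c).state ∈ M.yes ∨ (toCfg c).state ∈ M.no) from h)]
    generalize ho : M.instr.find? (fun i => decide (i.src = (toCfg c).state ∧
      i.read = (toCfg c).tape.head)) = o
    have e : M.tup.2.2.2.find? (fun i => decide (i.1 = c.1 ∧ i.2.1 = c.2.2.headI)) =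
        o.map Instr.toTuple := by
      rw [← ho]
      exact List.find?_map
    rw [e]
    rcases o with _ | ⟨a, b, d, w, dir⟩
    · rfl
    · cases dir <;> simp [Instr.toTuple, tupApply, toCfg]

theorem TM.reaches_iff (M : TM) (c : TupCfg) (d : Cfg) :
    StateTransition.Reaches M.step (toCfg c) d ↔ ∃ n, toCfg ((tupStep M.tup)^[n] c) = d := by
  constructor
  · intro h
    induction h with
    | refl => exact ⟨0, rfl⟩
    | tail _ hs ih =>
      obtain ⟨n, rfl⟩ := ih
      refine ⟨n + 1, ?_⟩
      rw [Function.iterate_succ_apply', toCfg_tupStep, Option.mem_def.1 hs]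
      rfl
  · rintro ⟨n, rfl⟩
    induction n with
    | zero => exact Relation.ReflTransGen.refl
    | succ n ih =>
      rw [Function.iterate_succ_apply', toCfg_tupStep]
      cases hs : M.step (toCfg ((tupStep M.tup)^[n] c)) with
      | none => exact ih
      | some d => exact ih.tail hs

theorem TM.accepts_iff (M : TM) (w : List Bool) :
    M.Accepts w ↔ ∃ n, ((tupStep M.tup)^[n] (M.tup.1, [], w.map some)).1 ∈ M.tup.2.1 := by
  have h : M.init w = toCfg (M.tup.1, [], w.map some) := rfl
  rw [TM.Accepts, h]
  simp only [TM.reaches_iff]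
  constructor
  · rintro ⟨_, ⟨n, rfl⟩, hy⟩
    exact ⟨n, hy⟩
  · rintro ⟨n, hy⟩
    exact ⟨_, ⟨n, rfl⟩, hy⟩

theorem primrec_tupApply : Primrec₂ tupApply := by
  have hi := (Primrec.fst : Primrec fun x :
    (ℕ × Option Bool × ℕ × Option Bool × Bool) × TupCfg => x.1)
  have hc := (Primrec.snd : Primrec fun x :
    (ℕ × Option Bool × ℕ × Option Bool × Bool) × TupCfg => x.2)
  have hi2 := Primrec.snd.comp (Primrec.snd.comp hi)
  have hi3 := Primrec.snd.comp hi2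
  refine Primrec.ite (Primrec.eq.comp (Primrec.snd.comp hi3) (Primrec.const true)) ?_ ?_
  · exact Primrec.pair (Primrec.fst.comp hi2) (Primrec.pair
      (Primrec.list_cons.comp (Primrec.fst.comp hi3) (Primrec.fst.comp (Primrec.snd.comp hc)))
      (Primrec.list_tail.comp (Primrec.snd.comp (Primrec.snd.comp hc))))
  · exact Primrec.pair (Primrec.fst.comp hi2) (Primrec.pair
      (Primrec.list_tail.comp (Primrec.fst.comp (Primrec.snd.comp hc)))
      (Primrec.list_cons.comp (Primrec.list_headI.comp (Primrec.fst.comp (Primrec.snd.comp hc)))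
        (Primrec.list_cons.comp (Primrec.fst.comp hi3)
          (Primrec.list_tail.comp (Primrec.snd.comp (Primrec.snd.comp hc))))))

theorem primrec_list_find? {α β : Type} [Primcodable α] [Primcodable β] {f : α → List β}
    {p : α → β → Bool} (hf : Primrec f) (hp : Primrec₂ p) :
    Primrec fun a => (f a).find? (p a) :=
  (Primrec.list_getElem?.comp hf (Primrec.list_findIdx hf hp)).of_eq fun _ =>
    List.find?_eq_getElem?_findIdx.symm

/-- The instruction that applies to a configuration. -/
def tupFind (x : Tup × TupCfg) : Option (ℕ × Option Bool × ℕ × Option Bool × Bool) :=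
  x.1.2.2.2.find? fun i => decide (i.1 = x.2.1 ∧ i.2.1 = x.2.2.2.headI)

theorem primrec_tupFind : Primrec tupFind := by
  have hp : PrimrecPred fun x : (Tup × TupCfg) × (ℕ × Option Bool × ℕ × Option Bool × Bool) =>
      x.2.1 = x.1.2.1 ∧ x.2.2.1 = x.1.2.2.2.headI :=
    PrimrecPred.and
      (Primrec.eq.comp (Primrec.fst.comp Primrec.snd)
        (Primrec.fst.comp (Primrec.snd.comp Primrec.fst)))
      (Primrec.eq.comp (Primrec.fst.comp (Primrec.snd.comp Primrec.snd))
        (Primrec.list_headI.comp (Primrec.snd.comp (Primrec.snd.comp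
          (Primrec.snd.comp Primrec.fst)))))
  have hl : Primrec fun x : Tup × TupCfg => x.1.2.2.2 :=
    Primrec.snd.comp (Primrec.snd.comp (Primrec.snd.comp Primrec.fst))
  have hd : Primrec₂ fun (x : Tup × TupCfg) (i : ℕ × Option Bool × ℕ × Option Bool × Bool) =>
      decide (i.1 = x.2.1 ∧ i.2.1 = x.2.2.2.headI) := hp.decide
  exact primrec_list_find? hl hd

theorem primrec_tupStep : Primrec₂ tupStep := by
  have hc := (Primrec.snd : Primrec fun x : Tup × TupCfg => x.2)
  have h1 : PrimrecPred fun x : Tup × TupCfg => x.2.1 ∈ x.1.2.1 ∨ x.2.1 ∈ x.1.2.2.1 :=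
    PrimrecPred.or
      (primrecPred_mem_list.comp (Primrec.fst.comp hc)
        (Primrec.fst.comp (Primrec.snd.comp Primrec.fst)))
      (primrecPred_mem_list.comp (Primrec.fst.comp hc)
        (Primrec.fst.comp (Primrec.snd.comp (Primrec.snd.comp Primrec.fst))))
  have h2 : Primrec fun x : Tup × TupCfg => ((tupFind x).map fun i => tupApply i x.2).getD x.2 :=
    Primrec.option_getD.comp (Primrec.option_map primrec_tupFind
      (primrec_tupApply.comp₂ Primrec₂.right (hc.comp₂ Primrec₂.left))) hc
  exact Primrec.ite h1 hc h2

/-- Turing machines are simulated effectively. -/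
theorem re_accepts :
    REPred fun x : List Bool × List Bool => ∃ M : TM, encTM M = x.1 ∧ M.Accepts x.2 := by
  have h : REPred fun x : List Bool × List Bool => ∃ t : Tup, ∃ n : ℕ, (IsTM t ∧ enc t = x.1) ∧
      ((tupStep t)^[n] (t.1, [], x.2.map some)).1 ∈ t.2.1 := by
    refine re_exists (p := fun x t => _) (re_exists (p := fun x n => _) (re_of_primrecPred ?_))
    refine PrimrecPred.and (PrimrecPred.and
      (primrecPred_isTM.comp (Primrec.snd.comp Primrec.fst))
      (Primrec.eq.comp (primrec_enc.comp (Primrec.snd.comp Primrec.fst))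
        (Primrec.fst.comp (Primrec.fst.comp Primrec.fst)))) ?_
    refine primrecPred_mem_list.comp (Primrec.fst.comp (Primrec.nat_iterate Primrec.snd ?_ ?_))
      (Primrec.fst.comp (Primrec.snd.comp (Primrec.snd.comp Primrec.fst)))
    · exact Primrec.pair (Primrec.fst.comp (Primrec.snd.comp Primrec.fst))
        (Primrec.pair (Primrec.const [])
          (Primrec.list_map (Primrec.snd.comp (Primrec.fst.comp Primrec.fst))
            (Primrec.option_some.comp₂ Primrec₂.right)))
    · exact primrec_tupStep.comp₂ ((Primrec.snd.comp Primrec.fst).comp₂ Primrec₂.left)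
        Primrec₂.right
  refine h.of_eq fun x => ?_
  constructor
  · rintro ⟨t, n, ⟨ht, he⟩, hn⟩
    obtain ⟨M, rfl⟩ := ht.exists
    exact ⟨M, he, (M.accepts_iff _).2 ⟨n, hn⟩⟩
  · rintro ⟨M, he, hM⟩
    obtain ⟨n, hn⟩ := (M.accepts_iff _).1 hM
    exact ⟨M.tup, n, ⟨M.isTM_tup, he⟩, hn⟩

/-! ### Built-in parameters -/

/-- The configuration of `TM.hardwire` that corresponds to a configuration of the given machine. -/
def Cfg.shift (k : ℕ) (c : Cfg) : Cfg := ⟨c.state + k, c.tape⟩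

/-- After the input has been extended, the machine with a built-in string works as the given one,
with shifted states. -/
theorem TM.hardwire_step (P : TM) (s : List Bool) (c : Cfg) :
    (P.hardwire s).step (c.shift (s.length + 2)) =
      (P.step c).map (Cfg.shift (s.length + 2)) := by
  have hy : ∀ l : List ℕ, c.state + (s.length + 2) ∈ l.map (· + (s.length + 2)) ↔
      c.state ∈ l := by
    intro l
    simp
  by_cases h : c.state ∈ P.yes ∨ c.state ∈ P.no
  · rw [TM.step, TM.step, if_pos h, if_pos]
    · rfl
    · exact h.imp (hy _).2 (hy _).2
  · have h' : ¬ (c.state + (s.length + 2) ∈ (P.hardwire s).yes ∨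
        c.state + (s.length + 2) ∈ (P.hardwire s).no) := fun h'' =>
      h (h''.imp (hy _).1 (hy _).1)
    cases hf : P.instr.find? fun i => decide (i.src = c.state ∧ i.read = c.tape.head) with
    | some i =>
      have hi1 := List.mem_of_find?_eq_some hf
      have hi2 := List.find?_some hf
      simp only [decide_eq_true_eq] at hi2
      rw [TM.step_eq (M := P) hi1 hi2.1 hi2.2 (fun h2 => h (Or.inl h2))
        (fun h2 => h (Or.inr h2)), TM.step_eq (M := P.hardwire s) (c := c.shift (s.length + 2))
          (i := ⟨i.src + (s.length + 2), i.read, i.dst + (s.length + 2), i.write, i.dir⟩)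
          ?_ ?_ hi2.2 (fun h2 => h' (Or.inl h2)) (fun h2 => h' (Or.inr h2))]
      · rfl
      · exact List.mem_append_right _ (List.mem_map.2 ⟨i, hi1, rfl⟩)
      · simp [Cfg.shift, hi2.1]
    | none =>
      rw [TM.step, TM.step, if_neg h, hf, if_neg (show ¬ ((c.shift (s.length + 2)).state ∈
        (P.hardwire s).yes ∨ (c.shift (s.length + 2)).state ∈ (P.hardwire s).no) from h')]
      have : (P.hardwire s).instr.find? (fun i => decide (i.src = (c.shift (s.length + 2)).state ∧
          i.read = (c.shift (s.length + 2)).tape.head)) = none := by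
        refine List.find?_eq_none.2 fun j hj => ?_
        simp only [hardwire, hardwireInstr, List.mem_append, List.mem_map, List.mem_range,
          List.mem_singleton] at hj
        intro hd
        obtain ⟨h1, h2⟩ := of_decide_eq_true hd
        change _ = c.state + (s.length + 2) at h1
        change _ = c.tape.head at h2
        rcases hj with ((⟨a, _, rfl⟩ | ⟨a, ha, rfl⟩) | rfl) | ⟨i, hi, rfl⟩
        · simp only at h1; omega
        · simp only at h1; omega
        · simp only at h1; omega
        · have := List.find?_eq_none.1 hf i hi
          simp only [decide_eq_true_eq] at this
          simp only at h1 h2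
          exact this ⟨by omega, h2⟩
      rw [this]
      rfl

/-- The initial phase: `s` is written, from its last symbol to its first one, to the left of the
input. -/
theorem TM.hardwire_reaches_start (P : TM) (s w : List Bool) :
    StateTransition.Reaches (P.hardwire s).step ((P.hardwire s).init w)
      ((P.init (s ++ w)).shift (s.length + 2)) := by
  have hy : ∀ q < s.length + 2, q ∉ (P.hardwire s).yes := by
    intro q hq h
    obtain ⟨a, _, h⟩ := List.mem_map.1 h
    omega
  have hn : ∀ q < s.length + 2, q ∉ (P.hardwire s).no := by
    intro q hq h
    obtain ⟨a, _, h⟩ := List.mem_map.1 h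
    omega
  have key : ∀ j ≤ s.length, StateTransition.Reaches (P.hardwire s).step ((P.hardwire s).init w)
      ⟨j + 1, tp [] (none :: ((s.reverse.take j).reverse ++ w).map some)⟩ := by
    intro j
    induction j with
    | zero =>
      intro _
      refine Relation.ReflTransGen.single (Option.mem_def.2 ?_)
      rw [TM.step_eq (i := ⟨0, (w.map some).headI, 1, (w.map some).headI, .left⟩) ?_ rfl rfl
        (hy 0 (by omega)) (hn 0 (by omega))]
      · have : (P.hardwire s).init w = ⟨0, tp [] (w.map some)⟩ := rfl
        rw [this]
        cases w with
        | nil =>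
          have h : tp [] [none, none] = tp [] [] := by simpa using tp_append_none_right [] [none]
          simp only [write_tp, left_tp, List.map_nil, List.tail_nil]
          exact congrArg (fun t => some (Cfg.mk 1 t)) h
        | cons b w => simp; rfl
      · refine List.mem_append_left _ (List.mem_append_left _ (List.mem_append_left _
          (List.mem_map.2 ⟨(w.map some).headI, ?_, rfl⟩)))
        rcases (w.map some).headI with _ | _ | _ <;> simp
    | succ j ih =>
      intro hj
      refine (ih (by omega)).tail (Option.mem_def.2 ?_)
      rw [TM.step_eq (i := ⟨j + 1, none, j + 2, s.reverse[j]?, .left⟩) ?_ rfl rfl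
        (hy _ (by simp only; omega)) (hn _ (by simp only; omega))]
      · have hl : j < s.reverse.length := by simpa using hj
        rw [List.getElem?_eq_getElem hl, List.take_succ_eq_append_getElem hl]
        simp
        rfl
      · exact List.mem_append_left _ (List.mem_append_left _ (List.mem_append_right _
          (List.mem_map.2 ⟨j, List.mem_range.2 (by omega), rfl⟩)))
  refine (key s.length le_rfl).tail (Option.mem_def.2 ?_)
  rw [TM.step_eq (i := ⟨s.length + 1, none, P.start + (s.length + 2), none, .right⟩) ?_ rfl rfl
    (hy _ (by simp only; omega)) (hn _ (by simp only; omega))]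
  · have : s.reverse.take s.length = s.reverse := List.take_of_length_le (by simp)
    rw [this]
    simp only [write_tp, right_tp, List.headI, List.tail, tp_none_left, List.reverse_reverse]
    rfl
  · exact List.mem_append_left _ (List.mem_append_right _ (List.mem_singleton.2 rfl))

/-- Building `s` into a Turing machine amounts to writing `s` in front of the input. -/
theorem TM.hardwire_accepts (P : TM) (s w : List Bool) :
    (P.hardwire s).Accepts w ↔ P.Accepts (s ++ w) := by
  have hfwd : ∀ c d, StateTransition.Reaches P.step c d → StateTransition.Reaches
      (P.hardwire s).step (c.shift (s.length + 2)) (d.shift (s.length + 2)) := by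
    intro c d h
    refine Relation.ReflTransGen.lift (Cfg.shift (s.length + 2)) (fun a b hab => ?_) _ _ h
    change (P.hardwire s).step _ = some _
    rw [TM.hardwire_step, Option.mem_def.1 hab]
    rfl
  have hbwd : ∀ c e, StateTransition.Reaches (P.hardwire s).step (c.shift (s.length + 2)) e →
      ∃ d, StateTransition.Reaches P.step c d ∧ d.shift (s.length + 2) = e := by
    intro c e h
    induction h with
    | refl => exact ⟨c, Relation.ReflTransGen.refl, rfl⟩
    | tail _ hs ih =>
      obtain ⟨d, hd, rfl⟩ := ih
      rw [Option.mem_def, TM.hardwire_step, Option.map_eq_some_iff] at hs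
      obtain ⟨d', hd', rfl⟩ := hs
      exact ⟨d', hd.tail hd', rfl⟩
  have hyes : ∀ d : Cfg, (d.shift (s.length + 2)).state ∈ (P.hardwire s).yes ↔
      d.state ∈ P.yes := by
    intro d
    simp [Cfg.shift, hardwire]
  constructor
  · rintro ⟨c, hc, hy⟩
    have hstep : (P.hardwire s).step c = none := by
      rw [TM.step, if_pos (Or.inl hy)]
    have h2 : StateTransition.Reaches (P.hardwire s).step
        ((P.init (s ++ w)).shift (s.length + 2)) c := by
      rcases StateTransition.reaches_total (P.hardwire_reaches_start s w) hc with h | h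
      · exact h
      · rcases h.cases_head with h | ⟨x, hx, -⟩
        · rw [h]
          exact Relation.ReflTransGen.refl
        · rw [hstep] at hx; cases hx
    obtain ⟨d, hd, rfl⟩ := hbwd _ _ h2
    exact ⟨d, hd, (hyes d).1 hy⟩
  · rintro ⟨d, hd, hy⟩
    exact ⟨_, (P.hardwire_reaches_start s w).trans (hfwd _ _ hd), (hyes d).2 hy⟩

theorem primrec_hardwire (P : TM) : Primrec fun s : List Bool => (P.hardwire s).tup := by
  have hk : Primrec fun s : List Bool => s.length + 2 :=
    Primrec.nat_add.comp Primrec.list_length (Primrec.const 2)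
  have hadd : ∀ l : List ℕ, Primrec fun s : List Bool => l.map (· + (s.length + 2)) := fun l =>
    Primrec.list_map (Primrec.const l)
      (Primrec.nat_add.comp₂ Primrec₂.right (hk.comp₂ Primrec₂.left))
  refine Primrec.pair (Primrec.const 0) (Primrec.pair (hadd P.yes) (Primrec.pair (hadd P.no) ?_))
  have h : Primrec fun s : List Bool =>
      ([none, some false, some true].map fun a => (0, a, 1, a, false)) ++
      ((List.range s.length).map fun j => (j + 1, none, j + 2, s.reverse[j]?, false)) ++
      [(s.length + 1, none, P.start + (s.length + 2), none, true)] ++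
      ((P.instr.map Instr.toTuple).map fun i =>
        (i.1 + (s.length + 2), i.2.1, i.2.2.1 + (s.length + 2), i.2.2.2.1, i.2.2.2.2)) := by
    refine Primrec.list_append.comp (Primrec.list_append.comp (Primrec.list_append.comp
      (Primrec.const _) ?_) ?_) ?_
    · refine Primrec.list_map (Primrec.list_range.comp Primrec.list_length) ?_
      exact Primrec.pair (Primrec.succ.comp Primrec.snd) (Primrec.pair (Primrec.const none)
        (Primrec.pair (Primrec.nat_add.comp Primrec.snd (Primrec.const 2)) (Primrec.pair
          (Primrec.list_getElem?.comp (Primrec.list_reverse.comp Primrec.fst) Primrec.snd)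
          (Primrec.const false))))
    · refine Primrec.list_cons.comp ?_ (Primrec.const [])
      exact Primrec.pair (Primrec.succ.comp Primrec.list_length) (Primrec.pair (Primrec.const none)
        (Primrec.pair (Primrec.nat_add.comp (Primrec.const _) hk) (Primrec.const (none, true))))
    · refine Primrec.list_map (Primrec.const _) ?_
      have h1 := (Primrec.snd : Primrec fun x :
        List Bool × (ℕ × Option Bool × ℕ × Option Bool × Bool) => x.2)
      have h2 := hk.comp (Primrec.fst : Primrec fun x :
        List Bool × (ℕ × Option Bool × ℕ × Option Bool × Bool) => x.1)
      have h3 := Primrec.snd.comp (Primrec.snd.comp h1)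
      exact Primrec.pair (Primrec.nat_add.comp (Primrec.fst.comp h1) h2) (Primrec.pair
        (Primrec.fst.comp (Primrec.snd.comp h1)) (Primrec.pair
          (Primrec.nat_add.comp (Primrec.fst.comp h3) h2) (Primrec.snd.comp h3)))
  refine h.of_eq fun s => ?_
  simp [TM.hardwire, hardwireInstr, Instr.toTuple, Function.comp_def]

/-! ### Databases as lists -/

section DatabaseLists

variable {σ : DatabaseSignature} {Δ : Type}

theorem Database.rename_val_rename (D : Database σ Δ) {τ : Δ → Δ} (hτ : Function.Injective τ)
    (α : Fact σ Δ) : (D.rename τ hτ).val (α.rename τ) = D.val α := by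
  simp only [rename]
  exact (Fact.rename_injective hτ).extend_apply _ _ _

theorem Database.rename_val_of_not_exists (D : Database σ Δ) {τ : Δ → Δ}
    (hτ : Function.Injective τ) {β : Fact σ Δ} (h : ¬ ∃ α, Fact.rename τ α = β) {s : SignType}
    (hv : (D.rename τ hτ).val β = some s) : s = -1 ∧ σ.CWA β.pred := by
  classical
  have h1 : (D.rename τ hτ).val β = if σ.CWA β.pred then some (-1) else none := by
    simp only [rename]
    rw [Function.extend_apply' _ _ _ h]
  rw [h1] at hv
  split_ifs at hv with hC
  cases hv
  exact ⟨rfl, hC⟩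

theorem Database.positive_rename {D : Database σ Δ} (hD : D.Positive) (τ : Δ → Δ)
    (hτ : Function.Injective τ) : (D.rename τ hτ).Positive := by
  intro β hβ
  by_cases h : ∃ α, Fact.rename τ α = β
  · obtain ⟨α, rfl⟩ := h
    exact hD α (by rwa [rename_val_rename] at hβ)
  · exact absurd (D.rename_val_of_not_exists hτ h hβ).1 (by decide)

theorem Database.mem_support_rename {D : Database σ Δ} {τ : Δ → Δ} {hτ : Function.Injective τ}
    {x : Fact σ Δ × SignType} :
    x ∈ (D.rename τ hτ).support ↔ ∃ y ∈ D.support, (y.1.rename τ, y.2) = x := by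
  obtain ⟨β, s⟩ := x
  constructor
  · rintro ⟨hv, hs⟩
    simp only at hv hs
    by_cases h : ∃ α, Fact.rename τ α = β
    · obtain ⟨α, rfl⟩ := h
      rw [rename_val_rename] at hv
      exact ⟨(α, s), ⟨hv, hs⟩, rfl⟩
    · obtain ⟨rfl, hC⟩ := D.rename_val_of_not_exists hτ h hv
      exact absurd hs (by simp [hC])
  · rintro ⟨⟨α, t⟩, ⟨hv, hs⟩, h⟩
    cases h
    exact ⟨(D.rename_val_rename hτ α).trans hv, hs⟩

/-- Extension in terms of supports. A value of `D` outside of its support is the value `-1` of a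
CWA-atom, where `D₀` is defined as well, and it is `-1` unless the atom belongs to the support
of `D₀`. -/
theorem Database.extends_iff {D₀ D : Database σ Δ} :
    D₀.Extends D ↔ (∀ x ∈ D.support, x ∈ D₀.support) ∧
      ∀ x ∈ D₀.support, σ.CWA x.1.pred → x ∈ D.support := by
  constructor
  · intro h
    refine ⟨fun x hx => ⟨h _ _ hx.1, hx.2⟩, fun x hx hC => ?_⟩
    obtain ⟨t, ht⟩ := Option.isSome_iff_exists.1 (D.complete _ hC)
    have := h _ _ ht
    rw [hx.1] at this
    cases this
    exact ⟨ht, hx.2⟩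
  · rintro ⟨h1, h2⟩ α s hs
    by_cases hx : 0 ≤ s ∨ ¬ σ.CWA α.pred
    · exact (h1 (α, s) ⟨hs, hx⟩).1
    · push Not at hx
      obtain ⟨t, ht⟩ := Option.isSome_iff_exists.1 (D₀.complete _ hx.2)
      by_cases h0 : 0 ≤ t
      · have := (h2 (α, t) ⟨ht, Or.inl h0⟩ hx.2).1
        rw [hs] at this
        cases this
        exact absurd h0 (not_le.2 hx.1)
      · have : ∀ s t : SignType, s < 0 → ¬ 0 ≤ t → t = s := by decide
        rw [ht, this s t hx.1 h0]

theorem Database.Extends.trans {D₁ D₂ D₃ : Database σ Δ} (h : D₁.Extends D₂)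
    (h' : D₂.Extends D₃) : D₁.Extends D₃ :=
  fun α s hs => h α s (h' α s hs)

theorem Database.extends_rename_iff {D₀ D : Database σ Δ} {τ : Δ → Δ}
    {hτ : Function.Injective τ} :
    D₀.Extends (D.rename τ hτ) ↔ (∀ y ∈ D.support, (y.1.rename τ, y.2) ∈ D₀.support) ∧
      ∀ x ∈ D₀.support, σ.CWA x.1.pred → ∃ y ∈ D.support, (y.1.rename τ, y.2) = x := by
  rw [extends_iff]
  simp only [mem_support_rename]
  refine and_congr ⟨fun h y hy => h _ ⟨y, hy, rfl⟩, ?_⟩ Iff.rfl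
  rintro h _ ⟨y, hy, rfl⟩
  exact h y hy

theorem Database.extends_rename_id (D : Database σ Δ) :
    D.Extends (D.rename id Function.injective_id) :=
  extends_rename_iff.2 ⟨fun _ hy => hy, fun x hx _ => ⟨x, hx, rfl⟩⟩

theorem Database.Extends.rename_comp {D₀ D : Database σ Δ} {τ : Δ → Δ}
    {hτ : Function.Injective τ} (h : D₀.Extends (D.rename τ hτ)) (ρ : Δ → Δ)
    (hρ : Function.Injective ρ) :
    (D₀.rename ρ hρ).Extends (D.rename (ρ ∘ τ) (hρ.comp hτ)) := by
  rw [extends_rename_iff] at h ⊢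
  simp only [mem_support_rename]
  refine ⟨fun y hy => ⟨_, h.1 y hy, rfl⟩, ?_⟩
  rintro _ ⟨x, hx, rfl⟩ hC
  obtain ⟨y, hy, rfl⟩ := h.2 x hx hC
  exact ⟨y, hy, rfl⟩

/-- Lists of facts with codes of truth values, as finite objects. -/
abbrev FactList (σ : DatabaseSignature) (Δ : Type) : Type := List ((σ.Pred × List Δ) × ℕ)

/-- An element of the support of a database as an element of a `FactList`. -/
def factCode (y : Fact σ Δ × SignType) : (σ.Pred × List Δ) × ℕ :=
  ((y.1.pred, List.ofFn y.1.args), signCode y.2)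

theorem signCode_injective : Function.Injective signCode := by decide

theorem factCode_injective : Function.Injective (factCode (σ := σ) (Δ := Δ)) := by
  rintro ⟨⟨p, a⟩, s⟩ ⟨⟨q, b⟩, t⟩ h
  simp only [factCode, Prod.mk.injEq] at h
  obtain ⟨⟨rfl, h1⟩, h2⟩ := h
  rw [List.ofFn_injective h1, signCode_injective h2]

/-- Renaming of the constants in an element of a `FactList`. -/
def renameFact (τ : Δ → Δ) (x : (σ.Pred × List Δ) × ℕ) : (σ.Pred × List Δ) × ℕ :=
  ((x.1.1, x.1.2.map τ), x.2)

theorem factCode_rename (τ : Δ → Δ) (y : Fact σ Δ × SignType) :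
    factCode (y.1.rename τ, y.2) = renameFact τ (factCode y) := by
  simp only [factCode, renameFact, Fact.rename, List.map_ofFn]
  rfl

variable [Primcodable Δ]

/-- `L` lists the support of `D` in the order of the codes. -/
def Represents (L : FactList σ Δ) (D : Database σ Δ) : Prop :=
  (L.map Encodable.encode).SortedLT ∧ ∀ x, x ∈ L ↔ ∃ y ∈ D.support, factCode y = x

theorem encode_map_encode {α : Type} [Encodable α] (L : List α) :
    Encodable.encode (L.map Encodable.encode) = Encodable.encode L := by
  induction L with
  | nil => rfl
  | cons a L ih => simp [Encodable.encode_list_cons, ih]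

/-- The codes of the elements of a `FactList` are those on which `encDB` is based. -/
theorem encode_factCode (y : Fact σ Δ × SignType) :
    Encodable.encode (factCode y) = Nat.pair y.1.code (signCode y.2) := rfl

theorem mem_sort_support (D : Database σ Δ) (n : ℕ) :
    n ∈ (D.finite_support.toFinset.image
      fun x => Nat.pair x.1.code (signCode x.2)).sort (· ≤ ·) ↔
        ∃ y ∈ D.support, Encodable.encode (factCode y) = n := by
  simp [encode_factCode]

/-- The list represents a database exactly as `encDB` does, so that both have the same string. -/
theorem Represents.enc {L : FactList σ Δ} {D : Database σ Δ} (h : Represents L D) :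
    enc L = encDB D := by
  rw [encDB, KR.enc, KR.enc, ← encode_map_encode L]
  congr 2
  refine h.1.eq_of_mem_iff (Finset.sortedLT_sort _) fun n => ?_
  rw [mem_sort_support, List.mem_map]
  constructor
  · rintro ⟨x, hx, rfl⟩
    obtain ⟨y, hy, rfl⟩ := (h.2 x).1 hx
    exact ⟨y, hy, rfl⟩
  · rintro ⟨y, hy, rfl⟩
    exact ⟨_, (h.2 _).2 ⟨y, hy, rfl⟩, rfl⟩

theorem exists_list_map {α β : Type*} {p : α → Prop} {f : α → β} (l : List β)
    (h : ∀ b ∈ l, ∃ a, p a ∧ f a = b) : ∃ l' : List α, (∀ a ∈ l', p a) ∧ l'.map f = l := by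
  induction l with
  | nil => exact ⟨[], by simp, rfl⟩
  | cons b l ih =>
    obtain ⟨a, ha, rfl⟩ := h b List.mem_cons_self
    obtain ⟨l', h1, rfl⟩ := ih fun b' hb' => h b' (List.mem_cons_of_mem _ hb')
    refine ⟨a :: l', fun a' ha' => ?_, rfl⟩
    rcases List.mem_cons.1 ha' with rfl | ha'
    exacts [ha, h1 a' ha']

theorem exists_represents (D : Database σ Δ) : ∃ L : FactList σ Δ, Represents L D := by
  obtain ⟨L, hL, e⟩ := exists_list_map (p := fun x => ∃ y ∈ D.support, factCode y = x)
    (f := Encodable.encode) ((D.finite_support.toFinset.image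
      fun x => Nat.pair x.1.code (signCode x.2)).sort (· ≤ ·)) (fun n hn => by
      obtain ⟨y, hy, rfl⟩ := (mem_sort_support D n).1 hn
      exact ⟨_, ⟨y, hy, rfl⟩, rfl⟩)
  refine ⟨L, e ▸ Finset.sortedLT_sort _, fun x => ⟨hL x, ?_⟩⟩
  rintro ⟨y, hy, rfl⟩
  have h := (mem_sort_support D _).2 ⟨y, hy, rfl⟩
  rw [← e, List.mem_map] at h
  obtain ⟨x, hx, h⟩ := h
  rwa [← Encodable.encode_injective h]

/-- For given lists and a given renaming on their constants, extension is decidable. -/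
theorem Represents.extends_rename_iff {L L₀ : FactList σ Δ} {D D₀ : Database σ Δ}
    (h : Represents L D) (h₀ : Represents L₀ D₀) {τ : Δ → Δ} {hτ : Function.Injective τ} :
    D₀.Extends (D.rename τ hτ) ↔ (∀ y ∈ L, renameFact τ y ∈ L₀) ∧
      ∀ x ∈ L₀, ¬ σ.CWA x.1.1 ∨ ∃ y ∈ L, renameFact τ y = x := by
  rw [Database.extends_rename_iff]
  refine and_congr ?_ ?_
  · constructor
    · intro h1 y hy
      obtain ⟨y, hy', rfl⟩ := (h.2 _).1 hy
      exact (h₀.2 _).2 ⟨_, h1 y hy', factCode_rename τ y⟩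
    · intro h1 y hy
      obtain ⟨z, hz, e⟩ := (h₀.2 _).1 (h1 _ ((h.2 _).2 ⟨y, hy, rfl⟩))
      rw [← factCode_rename] at e
      rwa [← factCode_injective e]
  · constructor
    · intro h1 x hx
      obtain ⟨x, hx', rfl⟩ := (h₀.2 _).1 hx
      by_cases hC : σ.CWA x.1.pred
      · obtain ⟨y, hy, rfl⟩ := h1 x hx' hC
        exact Or.inr ⟨_, (h.2 _).2 ⟨y, hy, rfl⟩, (factCode_rename τ y).symm⟩
      · exact Or.inl hC
    · intro h1 x hx hC
      rcases h1 _ ((h₀.2 _).2 ⟨x, hx, rfl⟩) with hn | ⟨y, hy, e⟩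
      · exact absurd hC hn
      · obtain ⟨y, hy', rfl⟩ := (h.2 _).1 hy
        rw [← factCode_rename] at e
        exact ⟨y, hy', factCode_injective e⟩

theorem Represents.positive_iff {L : FactList σ Δ} {D : Database σ Δ} (h : Represents L D) :
    D.Positive ↔ ∀ x ∈ L, x.2 ≠ 0 := by
  constructor
  · intro hp x hx h0
    obtain ⟨⟨α, s⟩, hy, rfl⟩ := (h.2 _).1 hx
    obtain rfl : s = 0 := signCode_injective h0
    exact hp α hy.1
  · intro hp α hα
    exact hp _ ((h.2 _).2 ⟨(α, 0), ⟨hα, Or.inl le_rfl⟩, rfl⟩) rfl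

/-- The conditions under which a list represents a database. -/
def IsDB (L : FactList σ Δ) : Prop :=
  (L.map Encodable.encode).SortedLT ∧ ∀ x ∈ L,
    (σ.arity x.1.1 = x.1.2.length ∧ (x.2 < 2 ∨ x.2 = 2 ∧ ¬ σ.CWA x.1.1)) ∧
      ∀ y ∈ L, y.1 = x.1 → y.2 = x.2

theorem isDB_iff (L : FactList σ Δ) : IsDB L ↔ ∃ D : Database σ Δ, Represents L D := by
  classical
  constructor
  · rintro ⟨hs, hL⟩
    have hcode : ∀ x ∈ L, ∃ y : Fact σ Δ × SignType, factCode y = x := by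
      rintro ⟨⟨p, l⟩, n⟩ hx
      obtain ⟨⟨ha, hn⟩, -⟩ := hL _ hx
      simp only at ha hn
      have h1 : ∃ s, signCode s = n := by
        have h2 : n = 0 ∨ n = 1 ∨ n = 2 := by omega
        rcases h2 with rfl | rfl | rfl
        exacts [⟨0, rfl⟩, ⟨1, rfl⟩, ⟨-1, rfl⟩]
      obtain ⟨s, rfl⟩ := h1
      refine ⟨(⟨p, fun k => l[k]'(ha ▸ k.2)⟩, s), ?_⟩
      simp only [factCode, Prod.mk.injEq, true_and, and_true]
      refine List.ext_getElem (by simp [ha]) fun i h1 h2 => by simp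
    have hfin : {y : Fact σ Δ × SignType | factCode y ∈ L}.Finite :=
      L.finite_toSet.preimage factCode_injective.injOn
    have huniq : ∀ (α : Fact σ Δ) s t, factCode (α, s) ∈ L → factCode (α, t) ∈ L → s = t :=
      fun α s t h h' => signCode_injective ((hL _ h').2 _ h rfl)
    let v : Fact σ Δ → Option SignType := fun α =>
      if h : ∃ s, factCode (α, s) ∈ L then some h.choose
      else if σ.CWA α.pred then some (-1) else none
    have hv : ∀ α s, factCode (α, s) ∈ L → v α = some s := by
      intro α s h
      have hex : ∃ s, factCode (α, s) ∈ L := ⟨s, h⟩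
      simp only [v, dif_pos hex]
      rw [huniq α _ _ hex.choose_spec h]
    have hv' : ∀ α s, v α = some s → factCode (α, s) ∈ L ∨ s = -1 ∧ σ.CWA α.pred := by
      intro α s h
      simp only [v] at h
      split_ifs at h with h1 h2
      · cases h
        exact Or.inl h1.choose_spec
      · cases h
        exact Or.inr ⟨rfl, h2⟩
    refine ⟨⟨v, ?_, ?_, ?_⟩, hs, fun x => ?_⟩
    · refine (hfin.image Prod.fst).subset ?_
      rintro α ⟨s, h, h0⟩
      rcases hv' α s h with h | ⟨rfl, -⟩
      · exact ⟨(α, s), h, rfl⟩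
      · exact absurd h0 (by decide)
    · intro α hα
      simp only [v]
      split_ifs <;> rfl
    · refine (hfin.image Prod.fst).subset ?_
      rintro α ⟨hC, h⟩
      obtain ⟨s, h⟩ := Option.isSome_iff_exists.1 h
      rcases hv' α s h with h | ⟨-, h⟩
      · exact ⟨(α, s), h, rfl⟩
      · exact absurd h hC
    · constructor
      · intro hx
        obtain ⟨⟨α, s⟩, rfl⟩ := hcode x hx
        refine ⟨(α, s), ⟨hv α s hx, ?_⟩, rfl⟩
        rcases (hL _ hx).1.2 with h | ⟨-, h⟩
        · left
          have : ∀ s, signCode s < 2 → 0 ≤ s := by decide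
          exact this s h
        · exact Or.inr h
      · rintro ⟨⟨α, s⟩, ⟨h, h0⟩, rfl⟩
        rcases hv' α s h with h | ⟨rfl, hC⟩
        · exact h
        · rcases h0 with h0 | h0
          · exact absurd (show (0 : SignType) ≤ -1 from h0) (by decide)
          · exact absurd hC h0
  · rintro ⟨D, hs, hL⟩
    refine ⟨hs, fun x hx => ?_⟩
    obtain ⟨⟨α, s⟩, hy, rfl⟩ := (hL _).1 hx
    refine ⟨⟨by simp [factCode], ?_⟩, fun z hz h => ?_⟩
    · have : ∀ s, (0 ≤ s → signCode s < 2) ∧ (signCode s < 2 ∨ signCode s = 2) := by decide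
      rcases (this s).2 with h | h
      · exact Or.inl h
      · refine Or.inr ⟨h, fun hC => ?_⟩
        rcases hy.2 with h0 | h0
        · exact absurd ((this s).1 h0) (by rw [h]; decide)
        · exact h0 hC
    · obtain ⟨⟨β, t⟩, hz', rfl⟩ := (hL _).1 hz
      have : α = β := by
        have h2 : factCode (β, s) = factCode (α, s) := Prod.ext h rfl
        exact (congrArg Prod.fst (factCode_injective h2)).symm
      subst this
      have h3 := hz'.1
      simp only at h3
      rw [hy.1] at h3
      cases h3
      rfl

theorem primrecPred_sortedLT : PrimrecPred fun l : List ℕ => l.SortedLT := by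
  have h0 : ∀ {f g : (ℕ × ℕ × List ℕ) → ℕ}, Primrec f → Primrec g →
      PrimrecPred fun x => (x.2.2[f x]?).getD 0 < (x.2.2[g x]?).getD 0 := by
    intro f g hf hg
    have h : ∀ {f : (ℕ × ℕ × List ℕ) → ℕ}, Primrec f →
        Primrec fun x => (x.2.2[f x]?).getD 0 := fun hf =>
      Primrec.option_getD.comp (Primrec.list_getElem?.comp (Primrec.snd.comp Primrec.snd) hf)
        (Primrec.const 0)
    exact Primrec.nat_lt.comp (h hf) (h hg)
  have h1 : PrimrecRel fun (j : ℕ) (x : ℕ × List ℕ) =>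
      (x.2[j]?).getD 0 < (x.2[x.1]?).getD 0 :=
    h0 Primrec.fst (Primrec.fst.comp Primrec.snd)
  have h2 : PrimrecRel fun (i : ℕ) (l : List ℕ) =>
      ∀ j ∈ List.range i, (l[j]?).getD 0 < (l[i]?).getD 0 :=
    h1.forall_mem_list.comp (Primrec.list_range.comp Primrec.fst) (Primrec.id (α := ℕ × List ℕ))
  refine (h2.forall_mem_list.comp (Primrec.list_range.comp Primrec.list_length)
    Primrec.id).of_eq fun l => ?_
  rw [List.sortedLT_iff_getElem_lt_getElem_of_lt]
  simp only [List.mem_range, id]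
  constructor
  · intro h i j hi hj hij
    simpa [hi, hj] using h j hj i hij
  · intro h i hi j hj
    have hi' : i < l.length := hi
    simpa [hi', hj.trans hi'] using h (hi := hj.trans hi') (hj := hi') hj

theorem re_isDB : REPred (IsDB (σ := σ) (Δ := Δ)) := by
  refine re_and (re_of_primrecPred (primrecPred_sortedLT.comp (Primrec.list_map Primrec.id
    (Primrec.encode.comp₂ Primrec₂.right)))) (re_forall_mem (p := fun L x => _) ?_ Primrec.id)
  have hx : Primrec fun y : FactList σ Δ × ((σ.Pred × List Δ) × ℕ) => y.2 := Primrec.snd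
  have hp := Primrec.fst.comp (Primrec.fst.comp hx)
  refine re_and (re_and ?_ ?_) ?_
  · exact re_comp (re_of_primrecPred (Primrec.eq (α := ℕ)))
      (Computable.pair (σ.computable_arity.comp hp.to_comp)
        (Primrec.list_length.comp (Primrec.snd.comp (Primrec.fst.comp hx))).to_comp)
  · refine re_or (re_of_primrecPred (Primrec.nat_lt.comp (Primrec.snd.comp hx)
      (Primrec.const 2))) (re_and (re_of_primrecPred (Primrec.eq.comp (Primrec.snd.comp hx)
      (Primrec.const 2))) ?_)
    exact re_comp σ.computable_CWA.not.to_re hp.to_comp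
  · refine re_forall_mem (p := fun (y : FactList σ Δ × ((σ.Pred × List Δ) × ℕ)) z =>
      z.1 = y.2.1 → z.2 = y.2.2) (re_of_primrecPred ?_) Primrec.fst
    refine (PrimrecPred.or (PrimrecPred.not (Primrec.eq.comp (Primrec.fst.comp Primrec.snd)
      (Primrec.fst.comp (Primrec.snd.comp Primrec.fst)))) (Primrec.eq.comp
      (Primrec.snd.comp Primrec.snd)
      (Primrec.snd.comp (Primrec.snd.comp Primrec.fst)))).of_eq fun y => ?_
    tauto

end DatabaseLists

/-! ### Renaming of constants -/

section Swaps

variable {Δ : Type}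

open Classical in
/-- The composition of a finite sequence of transpositions. -/
noncomputable def swaps (l : List (Δ × Δ)) (c : Δ) : Δ :=
  l.foldr (fun x c => Equiv.swap x.1 x.2 c) c

theorem swaps_injective (l : List (Δ × Δ)) : Function.Injective (swaps l) := by
  induction l with
  | nil => exact fun _ _ h => h
  | cons x l ih => exact (Equiv.injective _).comp ih

/-- On a finite set, every injection is a composition of transpositions. -/
theorem exists_swaps_eq {τ : Δ → Δ} (hτ : Function.Injective τ) (S : List Δ) :
    ∃ l, ∀ c ∈ S, swaps l c = τ c := by
  classical
  induction S with
  | nil => exact ⟨[], by simp⟩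
  | cons c S ih =>
    obtain ⟨l, hl⟩ := ih
    refine ⟨(swaps l c, τ c) :: l, fun d hd => ?_⟩
    change Equiv.swap (swaps l c) (τ c) (swaps l d) = τ d
    by_cases hdc : d = c
    · subst hdc
      rw [Equiv.swap_apply_left]
    · have hd : d ∈ S := (List.mem_cons.1 hd).resolve_left hdc
      rw [Equiv.swap_apply_of_ne_of_ne (fun h => hdc (swaps_injective l h))
        (fun h => hdc (hτ ((hl d hd).symm.trans h))), hl d hd]

theorem primrec_swaps [Primcodable Δ] : Primrec₂ (swaps (Δ := Δ)) := by
  classical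
  have hc : Primrec fun y : (List (Δ × Δ) × Δ) × (Δ × Δ) × Δ => y.2.2 :=
    Primrec.snd.comp Primrec.snd
  have ha : Primrec fun y : (List (Δ × Δ) × Δ) × (Δ × Δ) × Δ => y.2.1.1 :=
    Primrec.fst.comp (Primrec.fst.comp Primrec.snd)
  have hb : Primrec fun y : (List (Δ × Δ) × Δ) × (Δ × Δ) × Δ => y.2.1.2 :=
    Primrec.snd.comp (Primrec.fst.comp Primrec.snd)
  have h : Primrec₂ fun (_ : List (Δ × Δ) × Δ) (y : (Δ × Δ) × Δ) =>
      if y.2 = y.1.1 then y.1.2 else if y.2 = y.1.2 then y.1.1 else y.2 :=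
    Primrec.ite (Primrec.eq.comp hc ha) hb (Primrec.ite (Primrec.eq.comp hc hb) ha hc)
  refine (Primrec.list_foldr Primrec.fst Primrec.snd h).of_eq fun x => ?_
  simp only [swaps, Equiv.swap_apply_def]

end Swaps

section RenameSentences

variable {σ : QuerySignature} {Δ : Type}

theorem renameHom_id : renameHom σ (id : Δ → Δ) = Language.LHom.id (σ.lang Δ) := by
  refine Language.LHom.funext ?_ rfl
  funext n f
  cases (f : QFun σ Δ n) <;> rfl

theorem renameHom_comp (ρ τ : Δ → Δ) :
    renameHom σ (ρ ∘ τ) = (renameHom σ ρ).comp (renameHom σ τ) := by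
  refine Language.LHom.funext ?_ rfl
  funext n f
  cases (f : QFun σ Δ n) <;> rfl

theorem renameSentence_id (φ : σ.Sentence Δ) : renameSentence id φ = φ := by
  have h := congrFun (Language.LHom.id_onBoundedFormula (L := σ.lang Δ) (α := Empty) (n := 0)) φ
  rw [← renameHom_id] at h
  exact h

theorem renameSentence_comp (ρ τ : Δ → Δ) (φ : σ.Sentence Δ) :
    renameSentence (ρ ∘ τ) φ = renameSentence ρ (renameSentence τ φ) := by
  have h := congrFun (Language.LHom.comp_onBoundedFormula (α := Empty) (n := 0)
    (renameHom σ ρ) (renameHom σ τ)) φ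
  rw [← renameHom_comp] at h
  exact h

/-- Entailment is invariant under renaming: a model of the renamed sentences becomes a model of the
original ones if every constant `c` is interpreted as `τ c` was. -/
theorem entails_rename (τ : Δ → Δ) {T : (σ.lang Δ).Theory} {φ : σ.Sentence Δ} (h : T ⊨ᵇ φ) :
    (renameHom σ τ).onTheory T ⊨ᵇ renameSentence τ φ := by
  rw [Language.Theory.models_sentence_iff] at h ⊢
  intro M
  have h1 := h (M.reduct (renameHom σ τ))
  exact (@Language.LHom.realize_onSentence _ _ M ((renameHom σ τ).reduct M) M.struc
    (renameHom σ τ) (Language.LHom.isExpansionOn_reduct _ M) φ).2 h1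

/-- Renaming a term depends on finitely many constants only. -/
theorem exists_term_constants {n : ℕ} (t : (σ.lang Δ).Term (Empty ⊕ Fin n)) :
    ∃ S : List Δ, ∀ τ τ' : Δ → Δ, (∀ c ∈ S, τ c = τ' c) →
      (renameHom σ τ).onTerm t = (renameHom σ τ').onTerm t := by
  induction t with
  | var x => exact ⟨[], fun _ _ _ => rfl⟩
  | @func l f ts ih =>
    choose S hS using ih
    have h : ∃ S₀ : List Δ, ∀ τ τ' : Δ → Δ, (∀ c ∈ S₀, τ c = τ' c) →
        (renameHom σ τ).onFunction f = (renameHom σ τ').onFunction f := by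
      cases f with
      | const c => exact ⟨[c], fun τ τ' h => congrArg QFun.const (h c List.mem_cons_self)⟩
      | func f => exact ⟨[], fun _ _ _ => rfl⟩
    obtain ⟨S₀, hS₀⟩ := h
    refine ⟨S₀ ++ (List.ofFn S).flatten, fun τ τ' h => ?_⟩
    simp only [Language.LHom.onTerm]
    rw [hS₀ τ τ' fun c hc => h c (List.mem_append_left _ hc)]
    congr 1
    funext i
    exact hS i τ τ' fun c hc => h c (List.mem_append_right _
      (List.mem_flatten.2 ⟨S i, List.mem_ofFn.2 ⟨i, rfl⟩, hc⟩))

/-- Renaming a formula depends on finitely many constants only. -/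
theorem exists_formula_constants {n : ℕ} (φ : (σ.lang Δ).BoundedFormula Empty n) :
    ∃ S : List Δ, ∀ τ τ' : Δ → Δ, (∀ c ∈ S, τ c = τ' c) →
      (renameHom σ τ).onBoundedFormula φ = (renameHom σ τ').onBoundedFormula φ := by
  induction φ with
  | falsum => exact ⟨[], fun _ _ _ => rfl⟩
  | equal s t =>
    obtain ⟨S, hS⟩ := exists_term_constants s
    obtain ⟨S', hS'⟩ := exists_term_constants t
    refine ⟨S ++ S', fun τ τ' h => ?_⟩
    simp only [Language.LHom.onBoundedFormula]
    rw [hS τ τ' fun c hc => h c (List.mem_append_left _ hc),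
      hS' τ τ' fun c hc => h c (List.mem_append_right _ hc)]
  | rel R ts =>
    choose S hS using fun i => exists_term_constants (ts i)
    refine ⟨(List.ofFn S).flatten, fun τ τ' h => ?_⟩
    simp only [Language.LHom.onBoundedFormula]
    have : (renameHom σ τ).onTerm ∘ ts = (renameHom σ τ').onTerm ∘ ts := funext fun i =>
      hS i τ τ' fun c hc => h c (List.mem_flatten.2 ⟨S i, List.mem_ofFn.2 ⟨i, rfl⟩, hc⟩)
    rw [this]
    rfl
  | imp φ ψ ih₁ ih₂ =>
    obtain ⟨S, hS⟩ := ih₁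
    obtain ⟨S', hS'⟩ := ih₂
    refine ⟨S ++ S', fun τ τ' h => ?_⟩
    simp only [Language.LHom.onBoundedFormula]
    rw [hS τ τ' fun c hc => h c (List.mem_append_left _ hc),
      hS' τ τ' fun c hc => h c (List.mem_append_right _ hc)]
  | all φ ih =>
    obtain ⟨S, hS⟩ := ih
    refine ⟨S, fun τ τ' h => ?_⟩
    simp only [Language.LHom.onBoundedFormula]
    rw [hS τ τ' h]

/-- The renaming of a sentence depends on the renaming of finitely many constants. -/
theorem exists_sentence_constants (φ : σ.Sentence Δ) :
    ∃ S : List Δ, ∀ τ τ' : Δ → Δ, (∀ c ∈ S, τ c = τ' c) →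
      renameSentence τ φ = renameSentence τ' φ :=
  exists_formula_constants φ

end RenameSentences

section RenameCodes

variable {Δ : Type} [Primcodable Δ] (τ : Δ → Δ)

/-- The renaming of constants on codes of function symbols. -/
def renameFunCode (f : ℕ) : ℕ :=
  if f % 2 = 0 then
    2 * (((Encodable.decode (α := Δ) (f / 2)).map fun c => Encodable.encode (τ c)).getD 0)
  else f

/-- The renaming of constants on codes of terms. -/
def renameTermCode (n : ℕ) : ℕ :=
  if n % 2 = 0 then n
  else cFun (renameFunCode τ (n / 2).unpair.1)
    ((natList (n / 2).unpair.2).attach.map fun t => renameTermCode t.1)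
termination_by n
decreasing_by
  have h1 := lt_of_mem_natList t.2
  have h2 := Nat.unpair_right_le (n / 2)
  omega

/-- The renaming of constants on codes of formulas. -/
def renameCode (n : ℕ) : ℕ :=
  match n with
  | 0 => 0
  | n + 1 =>
    if n % 4 = 0 then
      cEq (renameTermCode τ (n / 4).unpair.1) (renameTermCode τ (n / 4).unpair.2)
    else if n % 4 = 1 then
      cRel (n / 4).unpair.1 ((natList (n / 4).unpair.2).map (renameTermCode τ))
    else if n % 4 = 2 then cImp (renameCode (n / 4).unpair.1) (renameCode (n / 4).unpair.2)
    else cAll (renameCode (n / 4))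
termination_by n
decreasing_by
  · have := Nat.unpair_left_le (n / 4); omega
  · have := Nat.unpair_right_le (n / 4); omega
  · omega

theorem renameTermCode_cVar (k : ℕ) : renameTermCode τ (cVar k) = cVar k := by
  rw [renameTermCode]; simp [cVar]

theorem renameTermCode_cFun (f : ℕ) (l : List ℕ) :
    renameTermCode τ (cFun f l) = cFun (renameFunCode τ f) (l.map (renameTermCode τ)) := by
  rw [renameTermCode]
  have h1 : cFun f l % 2 = 1 := by simp only [cFun]; omega
  have h2 : cFun f l / 2 = Nat.pair f (Encodable.encode l) := by simp only [cFun]; omega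
  rw [if_neg (by omega), List.attach_map_val (f := renameTermCode τ), h2, Nat.unpair_pair,
    natList_encode]

theorem renameCode_zero : renameCode τ 0 = 0 := by
  rw [renameCode]

theorem renameCode_cEq (s t : ℕ) :
    renameCode τ (cEq s t) = cEq (renameTermCode τ s) (renameTermCode τ t) := by
  rw [cEq, renameCode]
  simp

theorem renameCode_cRel (R : ℕ) (l : List ℕ) :
    renameCode τ (cRel R l) = cRel R (l.map (renameTermCode τ)) := by
  rw [cRel, renameCode]
  have h1 : (4 * Nat.pair R (Encodable.encode l) + 1) % 4 = 1 := by omega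
  have h2 : (4 * Nat.pair R (Encodable.encode l) + 1) / 4 = Nat.pair R (Encodable.encode l) := by
    omega
  simp [h1, h2]

theorem renameCode_cImp (p q : ℕ) :
    renameCode τ (cImp p q) = cImp (renameCode τ p) (renameCode τ q) := by
  rw [cImp, renameCode]
  have h1 : (4 * Nat.pair p q + 2) % 4 = 2 := by omega
  have h2 : (4 * Nat.pair p q + 2) / 4 = Nat.pair p q := by omega
  simp [h1, h2]

theorem renameCode_cAll (p : ℕ) : renameCode τ (cAll p) = cAll (renameCode τ p) := by
  rw [cAll, renameCode]
  have h1 : (4 * p + 3) % 4 = 3 := by omega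
  have h2 : (4 * p + 3) / 4 = p := by omega
  simp [h1, h2]

variable {σ : QuerySignature}

theorem code_rename_qfun {n : ℕ} (f : QFun σ Δ n) :
    (QFun.rename τ f).code = renameFunCode τ f.code := by
  cases f with
  | const c => simp [QFun.rename, QFun.code, renameFunCode]
  | func f =>
    have h : (2 * Encodable.encode f + 1) % 2 = 1 := by omega
    simp [QFun.rename, QFun.code, renameFunCode, h]

theorem termCode_rename {n : ℕ} (t : (σ.lang Δ).Term (Empty ⊕ Fin n)) :
    termCode ((renameHom σ τ).onTerm t) = renameTermCode τ (termCode t) := by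
  induction t with
  | var x =>
    rcases x with x | k
    · exact x.elim
    · exact (renameTermCode_cVar τ k).symm
  | func f ts ih =>
    refine Eq.trans ?_ (renameTermCode_cFun τ (QFun.code (σ := σ) f)
      (List.ofFn fun k => termCode (ts k))).symm
    rw [List.map_ofFn]
    have h := code_rename_qfun (σ := σ) τ f
    have h2 : (fun k => termCode ((renameHom σ τ).onTerm (ts k))) =
      renameTermCode τ ∘ fun k => termCode (ts k) := funext ih
    rw [← h, ← h2]
    rfl

theorem formulaCode_rename {n : ℕ} (φ : (σ.lang Δ).BoundedFormula Empty n) :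
    formulaCode ((renameHom σ τ).onBoundedFormula φ) = renameCode τ (formulaCode φ) := by
  induction φ with
  | falsum => exact (renameCode_zero τ).symm
  | equal s t =>
    refine Eq.trans ?_ (renameCode_cEq τ _ _).symm
    rw [← termCode_rename, ← termCode_rename]
    rfl
  | rel R ts =>
    refine Eq.trans ?_ (renameCode_cRel τ (QRel.code (σ := σ) R)
      (List.ofFn fun k => termCode (ts k))).symm
    rw [List.map_ofFn]
    have h2 : (fun k => termCode ((renameHom σ τ).onTerm (ts k))) =
      renameTermCode τ ∘ fun k => termCode (ts k) := funext fun k => termCode_rename τ (ts k)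
    rw [← h2]
    rfl
  | imp φ ψ ih₁ ih₂ =>
    refine Eq.trans ?_ (renameCode_cImp τ _ _).symm
    rw [← ih₁, ← ih₂]
    rfl
  | all φ ih =>
    refine Eq.trans ?_ (renameCode_cAll τ _).symm
    rw [← ih]
    rfl

theorem formulaCode_renameSentence (φ : σ.Sentence Δ) :
    formulaCode (renameSentence τ φ) = renameCode τ (formulaCode φ) :=
  formulaCode_rename τ φ

theorem primrec_renameFunCode :
    Primrec₂ fun (l : List (Δ × Δ)) f => renameFunCode (swaps l) f := by
  refine Primrec.ite (Primrec.eq.comp (Primrec.nat_mod.comp Primrec.snd (Primrec.const 2))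
    (Primrec.const 0)) (Primrec.nat_mul.comp (Primrec.const 2) (Primrec.option_getD.comp
      (Primrec.option_map (Primrec.decode.comp (Primrec.nat_div.comp Primrec.snd
        (Primrec.const 2))) ?_) (Primrec.const 0))) Primrec.snd
  exact Primrec.encode.comp (primrec_swaps.comp (Primrec.fst.comp Primrec.fst) Primrec.snd)

theorem primrec_natList : Primrec natList := Primrec.ofNat (List ℕ)

theorem primrec_renameTermCode :
    Primrec₂ fun (l : List (Δ × Δ)) n => renameTermCode (swaps l) n := by
  have hn : Primrec fun x : List (Δ × Δ) × List ℕ => x.2.length :=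
    Primrec.list_length.comp Primrec.snd
  have hu : Primrec fun x : List (Δ × Δ) × List ℕ => (x.2.length / 2).unpair :=
    Primrec.unpair.comp (Primrec.nat_div.comp hn (Primrec.const 2))
  refine Primrec.nat_strong_rec _ (g := fun l h => some (if h.length % 2 = 0 then h.length
    else cFun (renameFunCode (swaps l) (h.length / 2).unpair.1)
      ((natList (h.length / 2).unpair.2).map fun t => (h[t]?).getD 0))) ?_ fun l n => ?_
  · refine Primrec.option_some.comp (Primrec.ite (Primrec.eq.comp (Primrec.nat_mod.comp hn
      (Primrec.const 2)) (Primrec.const 0)) hn (primrec_cFun.comp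
        (primrec_renameFunCode.comp Primrec.fst (Primrec.fst.comp hu))
        (Primrec.list_map (primrec_natList.comp (Primrec.snd.comp hu)) ?_)))
    exact Primrec.option_getD.comp (Primrec.list_getElem?.comp (Primrec.snd.comp Primrec.fst)
      Primrec.snd) (Primrec.const 0)
  · simp only [List.length_map, List.length_range, Option.some.injEq]
    conv_rhs => rw [renameTermCode]
    split_ifs with h
    · rfl
    · rw [List.attach_map_val (f := renameTermCode (swaps l))]
      congr 1
      refine List.map_congr_left fun t ht => ?_
      have h1 := lt_of_mem_natList ht
      have h2 := Nat.unpair_right_le (n / 2)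
      have h3 : t < n := by omega
      simp [h3]

theorem primrec_renameCode :
    Primrec₂ fun (l : List (Δ × Δ)) n => renameCode (swaps l) n := by
  have hn : Primrec fun x : List (Δ × Δ) × List ℕ => x.2.length - 1 :=
    Primrec.pred.comp (Primrec.list_length.comp Primrec.snd)
  have hd : Primrec fun x : List (Δ × Δ) × List ℕ => (x.2.length - 1) / 4 :=
    Primrec.nat_div.comp hn (Primrec.const 4)
  have hm : ∀ k, PrimrecPred fun x : List (Δ × Δ) × List ℕ => (x.2.length - 1) % 4 = k :=
    fun k => Primrec.eq.comp (Primrec.nat_mod.comp hn (Primrec.const 4)) (Primrec.const k)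
  have hu : Primrec fun x : List (Δ × Δ) × List ℕ => ((x.2.length - 1) / 4).unpair :=
    Primrec.unpair.comp hd
  have hh : ∀ {f : List (Δ × Δ) × List ℕ → ℕ}, Primrec f → Primrec fun x => (x.2[f x]?).getD 0 :=
    fun hf => Primrec.option_getD.comp (Primrec.list_getElem?.comp Primrec.snd hf)
      (Primrec.const 0)
  refine Primrec.nat_strong_rec _ (g := fun l h => some (if h.length = 0 then 0
    else if (h.length - 1) % 4 = 0 then
      cEq (renameTermCode (swaps l) ((h.length - 1) / 4).unpair.1)
        (renameTermCode (swaps l) ((h.length - 1) / 4).unpair.2)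
    else if (h.length - 1) % 4 = 1 then
      cRel ((h.length - 1) / 4).unpair.1
        ((natList ((h.length - 1) / 4).unpair.2).map (renameTermCode (swaps l)))
    else if (h.length - 1) % 4 = 2 then
      cImp ((h[((h.length - 1) / 4).unpair.1]?).getD 0) ((h[((h.length - 1) / 4).unpair.2]?).getD 0)
    else cAll ((h[(h.length - 1) / 4]?).getD 0))) ?_ fun l n => ?_
  · refine Primrec.option_some.comp (Primrec.ite (Primrec.eq.comp (Primrec.list_length.comp
      Primrec.snd) (Primrec.const 0)) (Primrec.const 0) (Primrec.ite (hm 0) ?_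
      (Primrec.ite (hm 1) ?_ (Primrec.ite (hm 2) ?_ ?_))))
    · exact primrec_cEq.comp (primrec_renameTermCode.comp Primrec.fst (Primrec.fst.comp hu))
        (primrec_renameTermCode.comp Primrec.fst (Primrec.snd.comp hu))
    · exact primrec_cRel.comp (Primrec.fst.comp hu) (Primrec.list_map
        (primrec_natList.comp (Primrec.snd.comp hu))
        (primrec_renameTermCode.comp (Primrec.fst.comp Primrec.fst) Primrec.snd))
    · exact primrec_cImp.comp (hh (Primrec.fst.comp hu)) (hh (Primrec.snd.comp hu))
    · exact primrec_cAll.comp (hh hd)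
  · simp only [List.length_map, List.length_range, Option.some.injEq]
    rcases n with _ | n
    · simp [renameCode_zero]
    · conv_rhs => rw [renameCode]
      have h1 : (n / 4).unpair.1 < n + 1 := by
        have := Nat.unpair_left_le (n / 4); omega
      have h2 : (n / 4).unpair.2 < n + 1 := by
        have := Nat.unpair_right_le (n / 4); omega
      have h3 : n / 4 < n + 1 := by omega
      simp [h1, h2, h3]

end RenameCodes

/-! ### The closure of a class of pairs -/

section Closure

variable {σD : DatabaseSignature} {σQ : QuerySignature} {Δ : Type}

/-- The pairs `(D, φ)` such that `φ` follows from finitely many sentences `τ(ψ)`, where `(D', ψ)`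
is in `K` and `D` extends `τ(D')`. -/
def derivable (𝒟 : Set (Database σD Δ)) (𝒬 : Set (σQ.Sentence Δ))
    (K : Set (Database σD Δ × σQ.Sentence Δ)) : Set (Database σD Δ × σQ.Sentence Δ) :=
  {x | x.1 ∈ 𝒟 ∧ x.2 ∈ 𝒬 ∧ ∃ Γ : List (σQ.Sentence Δ),
    (∀ γ ∈ Γ, ∃ D' ψ, (D', ψ) ∈ K ∧ ∃ (τ : Δ → Δ) (hτ : Function.Injective τ),
      x.1.Extends (D'.rename τ hτ) ∧ renameSentence τ ψ = γ) ∧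
    ({ψ | ψ ∈ Γ} : (σQ.lang Δ).Theory) ⊨ᵇ x.2}

theorem models_of_forall_models {L : Language} {T T' : L.Theory} {φ : L.Sentence}
    (h : T ⊨ᵇ φ) (hT : ∀ ψ ∈ T, T' ⊨ᵇ ψ) : T' ⊨ᵇ φ := by
  rw [Language.Theory.models_sentence_iff] at h ⊢
  intro M
  have : M ⊨ T := by
    rw [Language.Theory.model_iff]
    exact fun ψ hψ => Language.Theory.models_sentence_iff.1 (hT ψ hψ) M
  exact h (Language.Theory.ModelType.of T M)

theorem models_inf {L : Language} {T : L.Theory} {φ ψ : L.Sentence} :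
    T ⊨ᵇ φ ⊓ ψ ↔ T ⊨ᵇ φ ∧ T ⊨ᵇ ψ := by
  simp only [Language.Theory.models_sentence_iff, ← forall_and]
  refine forall_congr' fun M => ?_
  exact Language.BoundedFormula.realize_inf

theorem rename_mem_databases {𝒟 : Set (Database σD Δ)}
    (h𝒟 : 𝒟 = Set.univ ∨ 𝒟 = {D | D.Positive}) {D : Database σD Δ} (hD : D ∈ 𝒟) (τ : Δ → Δ)
    (hτ : Function.Injective τ) : D.rename τ hτ ∈ 𝒟 := by
  rcases h𝒟 with rfl | rfl
  · trivial
  · exact Database.positive_rename hD τ hτ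

variable {𝒟 : Set (Database σD Δ)} {𝒬 : Set (σQ.Sentence Δ)}
  {K : Set (Database σD Δ × σQ.Sentence Δ)}

theorem isKB_derivable [Primcodable Δ] (h𝒟 : 𝒟 = Set.univ ∨ 𝒟 = {D | D.Positive})
    (h𝒬 : IsQueryLanguage 𝒬) : IsKB 𝒟 𝒬 (derivable 𝒟 𝒬 K) where
  subset := fun x hx => ⟨hx.1, hx.2.1⟩
  tautology := fun D hD φ hφ ht => ⟨hD, hφ, [], by simp, models_of_forall_models ht (by simp)⟩
  entails := by
    rintro D φ ψ ⟨hD, -, Γ, hΓ, he⟩ hψ h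
    refine ⟨hD, hψ, Γ, hΓ, models_of_forall_models h ?_⟩
    rintro _ rfl
    exact he
  inf := by
    rintro D φ ψ ⟨hD, hφ, Γ, hΓ, he⟩ ⟨-, hψ, Γ', hΓ', he'⟩
    refine ⟨hD, h𝒬.inf_mem _ hφ _ hψ, Γ ++ Γ', fun γ hγ => ?_, ?_⟩
    · rcases List.mem_append.1 hγ with hγ | hγ
      exacts [hΓ γ hγ, hΓ' γ hγ]
    · refine models_inf.2 ⟨models_of_forall_models he fun γ hγ => ?_,
        models_of_forall_models he' fun γ hγ => ?_⟩
      · exact Language.Theory.models_sentence_of_mem (List.mem_append_left _ hγ)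
      · exact Language.Theory.models_sentence_of_mem (List.mem_append_right _ hγ)
  extend := by
    rintro D φ ⟨hD, hφ, Γ, hΓ, he⟩ D₀ hD₀ hext
    refine ⟨hD₀, hφ, Γ, fun γ hγ => ?_, he⟩
    obtain ⟨D', ψ, hK, τ, hτ, h, h'⟩ := hΓ γ hγ
    exact ⟨D', ψ, hK, τ, hτ, hext.trans h, h'⟩
  rename := by
    rintro D φ ⟨hD, hφ, Γ, hΓ, he⟩ ρ hρ
    refine ⟨rename_mem_databases h𝒟 hD ρ hρ, h𝒬.rename_mem ρ hρ φ hφ,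
      Γ.map (renameSentence ρ), fun γ hγ => ?_, models_of_forall_models (entails_rename ρ he) ?_⟩
    · obtain ⟨γ, hγ', rfl⟩ := List.mem_map.1 hγ
      obtain ⟨D', ψ, hK, τ, hτ, h, rfl⟩ := hΓ γ hγ'
      exact ⟨D', ψ, hK, ρ ∘ τ, hρ.comp hτ, h.rename_comp ρ hρ, renameSentence_comp ρ τ ψ⟩
    · rintro _ ⟨γ, hγ, rfl⟩
      exact Language.Theory.models_sentence_of_mem (List.mem_map.2 ⟨γ, hγ, rfl⟩)

/-- The sentences that a knowledge base assigns to a database are closed under nonempty finite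
conjunctions. -/
theorem IsKB.exists_conj (hK : IsKB 𝒟 𝒬 K) {D : Database σD Δ} (γ : σQ.Sentence Δ)
    (Γ : List (σQ.Sentence Δ)) (h : ∀ ψ ∈ γ :: Γ, (D, ψ) ∈ K) :
    ∃ χ, (D, χ) ∈ K ∧ ∀ ψ ∈ γ :: Γ, Entails χ ψ := by
  induction Γ generalizing γ with
  | nil =>
    refine ⟨γ, h γ List.mem_cons_self, fun ψ hψ => ?_⟩
    obtain rfl := List.mem_singleton.1 hψ
    exact Language.Theory.models_sentence_of_mem rfl
  | cons δ Γ ih =>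
    obtain ⟨χ, hχ, hΓ⟩ := ih δ fun ψ hψ => h ψ (List.mem_cons_of_mem _ hψ)
    refine ⟨γ ⊓ χ, hK.inf D _ _ (h γ List.mem_cons_self) hχ, fun ψ hψ => ?_⟩
    obtain ⟨h1, h2⟩ := models_inf.1
      (Language.Theory.models_sentence_of_mem (T := {γ ⊓ χ}) (Set.mem_singleton (γ ⊓ χ)))
    rcases List.mem_cons.1 hψ with rfl | hψ
    · exact h1
    · refine models_of_forall_models (hΓ ψ hψ) ?_
      rintro _ rfl
      exact h2

/-- A knowledge base is closed under `derivable`, because each constituent of a derivation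
corresponds to a closure condition. The empty list of premises needs the condition on tautologies.
-/
theorem IsKB.derivable_subset {K' : Set (Database σD Δ × σQ.Sentence Δ)} (hK' : IsKB 𝒟 𝒬 K')
    (h : K ⊆ K') : derivable 𝒟 𝒬 K ⊆ K' := by
  rintro ⟨D, φ⟩ ⟨hD, hφ, Γ, hΓ, he⟩
  have h1 : ∀ γ ∈ Γ, (D, γ) ∈ K' := by
    intro γ hγ
    obtain ⟨D', ψ, hK, τ, hτ, hext, rfl⟩ := hΓ γ hγ
    exact hK'.extend _ _ (hK'.rename _ _ (h hK) τ hτ) D hD hext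
  cases Γ with
  | nil => exact hK'.tautology D hD φ hφ (models_of_forall_models he (by simp))
  | cons γ Γ =>
    obtain ⟨χ, hχ, h2⟩ := hK'.exists_conj γ Γ h1
    exact hK'.entails D χ φ hχ hφ (models_of_forall_models he h2)

theorem subset_derivable (hK : K ⊆ 𝒟 ×ˢ 𝒬) : K ⊆ derivable 𝒟 𝒬 K := by
  rintro ⟨D, φ⟩ h
  refine ⟨(hK h).1, (hK h).2, [φ], fun γ hγ => ?_,
    Language.Theory.models_sentence_of_mem (List.mem_singleton.2 rfl)⟩
  obtain rfl := List.mem_singleton.1 hγ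
  exact ⟨D, γ, h, id, Function.injective_id, D.extends_rename_id, renameSentence_id γ⟩

/-- The least knowledge base that includes `K` is obtained in one step. -/
theorem cl_eq_derivable [Primcodable Δ] (h𝒟 : 𝒟 = Set.univ ∨ 𝒟 = {D | D.Positive})
    (h𝒬 : IsQueryLanguage 𝒬) (hK : K ⊆ 𝒟 ×ˢ 𝒬) : cl 𝒟 𝒬 K = derivable 𝒟 𝒬 K := by
  refine Set.Subset.antisymm ?_ ?_
  · exact Set.sInter_subset_of_mem ⟨isKB_derivable h𝒟 h𝒬, subset_derivable hK⟩
  · exact Set.subset_sInter fun K' hK' => hK'.1.derivable_subset hK'.2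

theorem isKB_cl [Primcodable Δ] (h𝒟 : 𝒟 = Set.univ ∨ 𝒟 = {D | D.Positive})
    (h𝒬 : IsQueryLanguage 𝒬) (hK : K ⊆ 𝒟 ×ˢ 𝒬) : IsKB 𝒟 𝒬 (cl 𝒟 𝒬 K) :=
  cl_eq_derivable h𝒟 h𝒬 hK ▸ isKB_derivable h𝒟 h𝒬

theorem IsKB.cl_eq (hK : IsKB 𝒟 𝒬 K) : cl 𝒟 𝒬 K = K :=
  Set.Subset.antisymm (Set.sInter_subset_of_mem ⟨hK, subset_rfl⟩)
    (Set.subset_sInter fun _ hK' => hK'.2)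

end Closure

/-! ### Enumeration of the closure -/

section Enumeration

variable {σD : DatabaseSignature} {σQ : QuerySignature} {Δ : Type} [Primcodable Δ]
  {𝒟 : Set (Database σD Δ)} {𝒬 : Set (σQ.Sentence Δ)}

/-- The list `x.1` and the number `x.2` present a database in `𝒟` and a sentence in `𝒬`. -/
def IsPair (𝒟 : Set (Database σD Δ)) (𝒬 : Set (σQ.Sentence Δ)) (x : FactList σD Δ × ℕ) : Prop :=
  (∃ D ∈ 𝒟, Represents x.1 D) ∧ ∃ φ ∈ 𝒬, formulaCode φ = x.2

theorem re_isPair (h𝒟 : 𝒟 = Set.univ ∨ 𝒟 = {D | D.Positive}) (h𝒬 : IsQueryLanguage 𝒬) :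
    REPred (IsPair 𝒟 𝒬) := by
  refine re_and (re_comp (f := Prod.fst) (p := fun L => ∃ D ∈ 𝒟, Represents L D) ?_
    Computable.fst) ?_
  · rcases h𝒟 with rfl | rfl
    · refine re_isDB.of_eq fun L => ?_
      rw [isDB_iff]
      simp
    · have h1 : PrimrecPred fun x : (σD.Pred × List Δ) × ℕ => x.2 ≠ 0 :=
        PrimrecPred.not (Primrec.eq.comp Primrec.snd (Primrec.const 0))
      refine (re_and re_isDB (re_of_primrecPred h1.forall_mem_list)).of_eq fun L => ?_
      rw [isDB_iff]
      constructor
      · rintro ⟨⟨D, hD⟩, h⟩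
        exact ⟨D, hD.positive_iff.2 h, hD⟩
      · rintro ⟨D, hp, hD⟩
        exact ⟨⟨D, hD⟩, hD.positive_iff.1 hp⟩
  · refine (re_comp (f := fun x : FactList σD Δ × ℕ => enc x.2) h𝒬.recursive.to_re
      (primrec_enc.comp Primrec.snd).to_comp).of_eq fun x => ?_
    exact exists_congr fun φ => and_congr_right fun _ => enc_injective.eq_iff

theorem encPair_eq {L : FactList σD Δ} {D : Database σD Δ} (h : Represents L D)
    (φ : σQ.Sentence Δ) : pairStr (enc L) (enc (formulaCode φ)) = encPair D φ := by
  rw [h.enc]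
  rfl

/-- The strings that encode pairs in `𝒟 × 𝒬`. -/
theorem re_encPair (h𝒟 : 𝒟 = Set.univ ∨ 𝒟 = {D | D.Positive}) (h𝒬 : IsQueryLanguage 𝒬) :
    REPred fun w => ∃ D ∈ 𝒟, ∃ φ ∈ 𝒬, encPair D φ = w := by
  have h : REPred fun w => ∃ x : FactList σD Δ × ℕ, IsPair 𝒟 𝒬 x ∧
      pairStr (enc x.1) (enc x.2) = w := by
    refine re_exists (p := fun w (x : FactList σD Δ × ℕ) => _) (re_and
      (re_comp (re_isPair h𝒟 h𝒬) Computable.snd) (re_of_primrecPred (Primrec.eq.comp ?_ ?_)))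
    · exact primrec_pairStr.comp (primrec_enc.comp (Primrec.fst.comp Primrec.snd))
        (primrec_enc.comp (Primrec.snd.comp Primrec.snd))
    · exact Primrec.fst
  refine h.of_eq fun w => ?_
  constructor
  · rintro ⟨⟨L, q⟩, ⟨⟨D, hD, hL⟩, φ, hφ, rfl⟩, rfl⟩
    exact ⟨D, hD, φ, hφ, (encPair_eq hL φ).symm⟩
  · rintro ⟨D, hD, φ, hφ, rfl⟩
    obtain ⟨L, hL⟩ := exists_represents D
    exact ⟨(L, formulaCode φ), ⟨⟨D, hD, hL⟩, φ, hφ, rfl⟩, encPair_eq hL φ⟩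

/-- The certificate that the sentence with the code `d.2` is `τ(ψ)` for a pair `(D', ψ)` accepted by
the Turing machine with the string `d.1.1`, where the database with the list `d.1.2.1` extends
`τ(D')`. It consists of `D'` as a list, the code of `ψ`, and a sequence of transpositions for `τ`.
-/
def IsCertificate (𝒟 : Set (Database σD Δ)) (𝒬 : Set (σQ.Sentence Δ))
    (d : (List Bool × FactList σD Δ × ℕ) × ℕ) (y : (FactList σD Δ × ℕ) × List (Δ × Δ)) : Prop :=
  (IsPair 𝒟 𝒬 y.1 ∧
    ∃ M : TM, encTM M = d.1.1 ∧ M.Accepts (pairStr (enc y.1.1) (enc y.1.2))) ∧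
  ((∀ z ∈ y.1.1, renameFact (swaps y.2) z ∈ d.1.2.1) ∧
    ∀ z ∈ d.1.2.1, ¬ σD.CWA z.1.1 ∨ ∃ z' ∈ y.1.1, renameFact (swaps y.2) z' = z) ∧
  renameCode (swaps y.2) y.1.2 = d.2

/-- `derivable` on codes: the Turing machine is given by its string, databases as lists, sentences
by their codes, and injections by sequences of transpositions. -/
def DerivableCode (𝒟 : Set (Database σD Δ)) (𝒬 : Set (σQ.Sentence Δ))
    (x : List Bool × FactList σD Δ × ℕ) : Prop :=
  ∃ G : List ℕ, (∀ g ∈ G, ∃ y, IsCertificate 𝒟 𝒬 (x, g) y) ∧ CodeEntails G x.2.2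

theorem primrec_renameFact :
    Primrec₂ fun (l : List (Δ × Δ)) (x : (σD.Pred × List Δ) × ℕ) => renameFact (swaps l) x := by
  refine Primrec.pair (Primrec.pair (Primrec.fst.comp (Primrec.fst.comp Primrec.snd))
    (Primrec.list_map (Primrec.snd.comp (Primrec.fst.comp Primrec.snd)) ?_))
    (Primrec.snd.comp Primrec.snd)
  exact primrec_swaps.comp (Primrec.fst.comp Primrec.fst) Primrec.snd

theorem re_isCertificate (h𝒟 : 𝒟 = Set.univ ∨ 𝒟 = {D | D.Positive}) (h𝒬 : IsQueryLanguage 𝒬) :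
    REPred fun c : ((List Bool × FactList σD Δ × ℕ) × ℕ) × (FactList σD Δ × ℕ) × List (Δ × Δ) =>
      IsCertificate 𝒟 𝒬 c.1 c.2 := by
  have hl : Primrec fun c : ((List Bool × FactList σD Δ × ℕ) × ℕ) ×
      (FactList σD Δ × ℕ) × List (Δ × Δ) => c.1.1.2.1 :=
    Primrec.fst.comp (Primrec.snd.comp (Primrec.fst.comp Primrec.fst))
  have hy : Primrec fun c : ((List Bool × FactList σD Δ × ℕ) × ℕ) ×
      (FactList σD Δ × ℕ) × List (Δ × Δ) => c.2.1.1 :=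
    Primrec.fst.comp (Primrec.fst.comp Primrec.snd)
  have hq : Primrec fun c : ((List Bool × FactList σD Δ × ℕ) × ℕ) ×
      (FactList σD Δ × ℕ) × List (Δ × Δ) => c.2.1.2 :=
    Primrec.snd.comp (Primrec.fst.comp Primrec.snd)
  have hs : Primrec fun c : ((List Bool × FactList σD Δ × ℕ) × ℕ) ×
      (FactList σD Δ × ℕ) × List (Δ × Δ) => c.2.2 :=
    Primrec.snd.comp Primrec.snd
  refine re_and (re_and ?_ ?_) (re_and (re_and ?_ ?_) ?_)
  · exact re_comp (re_isPair h𝒟 h𝒬) (Computable.fst.comp Computable.snd)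
  · refine re_comp re_accepts (f := fun c : ((List Bool × FactList σD Δ × ℕ) × ℕ) ×
      (FactList σD Δ × ℕ) × List (Δ × Δ) =>
        (c.1.1.1, pairStr (enc c.2.1.1) (enc c.2.1.2))) (Primrec.to_comp ?_)
    exact Primrec.pair (Primrec.fst.comp (Primrec.fst.comp Primrec.fst))
      (primrec_pairStr.comp (primrec_enc.comp hy) (primrec_enc.comp hq))
  · exact re_forall_mem (p := fun (c : ((List Bool × FactList σD Δ × ℕ) × ℕ) ×
      (FactList σD Δ × ℕ) × List (Δ × Δ)) z => renameFact (swaps c.2.2) z ∈ c.1.1.2.1)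
      (re_of_primrecPred (primrecPred_mem_list.comp (primrec_renameFact.comp
        (hs.comp Primrec.fst) Primrec.snd) (hl.comp Primrec.fst))) hy
  · have h : PrimrecRel fun (z' : (σD.Pred × List Δ) × ℕ)
        (e : List (Δ × Δ) × (σD.Pred × List Δ) × ℕ) => renameFact (swaps e.1) z' = e.2 :=
      Primrec.eq.comp (primrec_renameFact.comp (Primrec.fst.comp Primrec.snd) Primrec.fst)
        (Primrec.snd.comp Primrec.snd)
    refine re_forall_mem (p := fun (c : ((List Bool × FactList σD Δ × ℕ) × ℕ) ×
      (FactList σD Δ × ℕ) × List (Δ × Δ)) z =>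
        ¬ σD.CWA z.1.1 ∨ ∃ z' ∈ c.2.1.1, renameFact (swaps c.2.2) z' = z) (re_or ?_ ?_) hl
    · exact re_comp σD.computable_CWA.not.to_re
        (Primrec.fst.comp (Primrec.fst.comp Primrec.snd)).to_comp
    · exact re_of_primrecPred (h.exists_mem_list.comp (hy.comp Primrec.fst)
        (Primrec.pair (hs.comp Primrec.fst) Primrec.snd))
  · exact re_of_primrecPred (Primrec.eq.comp (primrec_renameCode.comp hs hq)
      (Primrec.snd.comp Primrec.fst))

theorem re_derivableCode (h𝒟 : 𝒟 = Set.univ ∨ 𝒟 = {D | D.Positive}) (h𝒬 : IsQueryLanguage 𝒬) :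
    REPred (DerivableCode 𝒟 𝒬) := by
  have h1 : REPred fun a : ((List Bool × FactList σD Δ × ℕ) × List ℕ) × ℕ =>
      ∃ y, IsCertificate 𝒟 𝒬 (a.1.1, a.2) y := by
    refine re_exists (p := fun (a : ((List Bool × FactList σD Δ × ℕ) × List ℕ) × ℕ) y =>
      IsCertificate 𝒟 𝒬 (a.1.1, a.2) y) ?_
    have hf : Primrec fun b : (((List Bool × FactList σD Δ × ℕ) × List ℕ) × ℕ) ×
        (FactList σD Δ × ℕ) × List (Δ × Δ) => ((b.1.1.1, b.1.2), b.2) :=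
      Primrec.pair (Primrec.pair (Primrec.fst.comp (Primrec.fst.comp Primrec.fst))
        (Primrec.snd.comp Primrec.fst)) Primrec.snd
    have h := re_isCertificate h𝒟 h𝒬
    have h' := re_comp h hf.to_comp
    exact h'.of_eq fun b => Iff.rfl
  have h2 : REPred fun a : (List Bool × FactList σD Δ × ℕ) × List ℕ =>
      ∀ g ∈ a.2, ∃ y, IsCertificate 𝒟 𝒬 (a.1, g) y :=
    re_forall_mem (p := fun (a : (List Bool × FactList σD Δ × ℕ) × List ℕ) (g : ℕ) =>
      ∃ y, IsCertificate 𝒟 𝒬 (a.1, g) y) h1 Primrec.snd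
  refine re_exists (p := fun (x : List Bool × FactList σD Δ × ℕ) (G : List ℕ) =>
    (∀ g ∈ G, ∃ y, IsCertificate 𝒟 𝒬 (x, g) y) ∧ CodeEntails G x.2.2) (re_and h2 ?_)
  exact re_comp re_codeEntails (Computable.pair Computable.snd
    (Computable.snd.comp (Computable.snd.comp Computable.fst)))

/-- `DerivableCode` describes the closure. Sequences of transpositions suffice as injections,
because renaming depends on finitely many constants only. -/
theorem derivableCode_iff (h𝒟 : 𝒟 = Set.univ ∨ 𝒟 = {D | D.Positive}) (h𝒬 : IsQueryLanguage 𝒬)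
    (M : TM) {D : Database σD Δ} (hD : D ∈ 𝒟) {φ : σQ.Sentence Δ} (hφ : φ ∈ 𝒬)
    {L : FactList σD Δ} (hL : Represents L D) :
    DerivableCode 𝒟 𝒬 (encTM M, L, formulaCode φ) ↔ (D, φ) ∈ cl 𝒟 𝒬 (M.kb 𝒟 𝒬) := by
  rw [cl_eq_derivable h𝒟 h𝒬 fun x hx => ⟨hx.1, hx.2.1⟩]
  constructor
  · rintro ⟨G, hG, he⟩
    obtain ⟨Γ, hΓ, rfl⟩ := exists_list_map (f := formulaCode) (p := fun γ => ∃ D' ψ,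
      (D', ψ) ∈ M.kb 𝒟 𝒬 ∧ ∃ (τ : Δ → Δ) (hτ : Function.Injective τ),
        D.Extends (D'.rename τ hτ) ∧ renameSentence τ ψ = γ) G fun g hg => by
      obtain ⟨⟨⟨L', q⟩, l⟩, ⟨⟨⟨D', hD', hL'⟩, ψ, hψ, rfl⟩, M', hM', hacc⟩, hext, rfl⟩ := hG g hg
      obtain rfl := encTM_injective hM'
      refine ⟨renameSentence (swaps l) ψ, ⟨D', ψ, ⟨hD', hψ, ?_⟩, swaps l, swaps_injective l,
        (hL'.extends_rename_iff hL).2 hext, rfl⟩, formulaCode_renameSentence _ ψ⟩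
      rwa [← encPair_eq hL']
    exact ⟨hD, hφ, Γ, hΓ, (codeEntails_iff Γ φ).1 he⟩
  · rintro ⟨-, -, Γ, hΓ, he⟩
    refine ⟨Γ.map formulaCode, fun g hg => ?_, (codeEntails_iff Γ φ).2 he⟩
    obtain ⟨γ, hγ, rfl⟩ := List.mem_map.1 hg
    obtain ⟨D', ψ, ⟨hD', hψ, hacc⟩, τ, hτ, hext, rfl⟩ := hΓ γ hγ
    obtain ⟨L', hL'⟩ := exists_represents D'
    obtain ⟨S, hS⟩ := exists_sentence_constants ψ
    -- only the constants of the sentence and of the observed facts matter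
    obtain ⟨l, hl⟩ := exists_swaps_eq hτ (S ++ L'.flatMap fun z => z.1.2)
    have hfact : ∀ z ∈ L', renameFact τ z = renameFact (swaps l) z := by
      intro z hz
      simp only [renameFact]
      rw [List.map_congr_left fun c hc => (hl c (List.mem_append_right _
        (List.mem_flatMap.2 ⟨z, hz, hc⟩))).symm]
    refine ⟨((L', formulaCode ψ), l), ⟨⟨⟨D', hD', hL'⟩, ψ, hψ, rfl⟩, M, rfl, ?_⟩, ?_, ?_⟩
    · rwa [encPair_eq hL']
    · obtain ⟨h1, h2⟩ := (hL'.extends_rename_iff hL).1 hext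
      refine ⟨fun z hz => hfact z hz ▸ h1 z hz, fun z hz => (h2 z hz).imp id ?_⟩
      rintro ⟨y, hy, rfl⟩
      exact ⟨y, hy, (hfact y hy).symm⟩
    · rw [← formulaCode_renameSentence]
      exact congrArg formulaCode (hS _ _ fun c hc => hl c (List.mem_append_left _ hc))

/-- The closure procedure can be implemented. -/
theorem exists_implementsClosure (h𝒟 : 𝒟 = Set.univ ∨ 𝒟 = {D | D.Positive})
    (h𝒬 : IsQueryLanguage 𝒬) : ∃ P : TM, ImplementsClosure 𝒟 𝒬 P := by
  have h : REPred fun w : List Bool => ∃ x : List Bool × FactList σD Δ × ℕ,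
      DerivableCode 𝒟 𝒬 x ∧ pairStr x.1 (pairStr (enc x.2.1) (enc x.2.2)) = w := by
    refine re_exists (p := fun w (x : List Bool × FactList σD Δ × ℕ) => _) (re_and
      (re_comp (re_derivableCode h𝒟 h𝒬) Computable.snd)
      (re_of_primrecPred (Primrec.eq.comp ?_ ?_)))
    · exact primrec_pairStr.comp (Primrec.fst.comp Primrec.snd) (primrec_pairStr.comp
        (primrec_enc.comp (Primrec.fst.comp (Primrec.snd.comp Primrec.snd)))
        (primrec_enc.comp (Primrec.snd.comp (Primrec.snd.comp Primrec.snd))))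
    · exact Primrec.fst
  obtain ⟨P, hP⟩ := exists_TM_of_re h
  refine ⟨P, fun M D hD φ hφ => ?_⟩
  obtain ⟨L, hL⟩ := exists_represents D
  rw [hP, ← derivableCode_iff h𝒟 h𝒬 M hD hφ hL, ← encPair_eq hL]
  constructor
  · rintro ⟨⟨m, L', q⟩, hx, e⟩
    obtain ⟨rfl, e⟩ := pairStr_injective e
    obtain ⟨e1, e2⟩ := pairStr_injective e
    obtain rfl := enc_injective e1
    obtain rfl := enc_injective e2
    exact hx
  · intro hx
    exact ⟨_, hx, rfl⟩

end Enumeration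

/-! ### The canonical mapping -/

section Canonical

variable {σD : DatabaseSignature} {σQ : QuerySignature} {Δ : Type} [Primcodable Δ]
  {𝒟 : Set (Database σD Δ)} {𝒬 : Set (σQ.Sentence Δ)} {P : TM}

theorem TM.kb_subset (M : TM) : M.kb 𝒟 𝒬 ⊆ 𝒟 ×ˢ 𝒬 := fun _ hx => ⟨hx.1, hx.2.1⟩

theorem encPair_injective {D D' : Database σD Δ} {φ φ' : σQ.Sentence Δ}
    (h : encPair D φ = encPair D' φ') : D = D' ∧ φ = φ' :=
  ⟨encDB_injective (pairStr_injective h).1, encSentence_injective (pairStr_injective h).2⟩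

theorem re_accepts_of_TM (M : TM) : REPred M.Accepts := by
  refine (re_comp re_accepts (f := fun w : List Bool => (encTM M, w))
    (Computable.pair (Computable.const _) Computable.id)).of_eq fun w => ?_
  constructor
  · rintro ⟨M', h, hM⟩
    rwa [encTM_injective h] at hM
  · exact fun h => ⟨M, rfl, h⟩

/-- Every recursively enumerable class of pairs is that of a Turing machine. The language accepted
may consist of the strings of these pairs, since pairs are encoded injectively. -/
theorem IsRE.exists_TM {K : Set (Database σD Δ × σQ.Sentence Δ)} (hK : K ⊆ 𝒟 ×ˢ 𝒬)
    (h : IsRE K) : ∃ M : TM, M.kb 𝒟 𝒬 = K := by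
  obtain ⟨M, hM⟩ := exists_TM_of_re h
  refine ⟨M, Set.ext fun ⟨D, φ⟩ => ⟨?_, fun hx => ⟨(hK hx).1, (hK hx).2, (hM _).2 ⟨D, φ, hx, rfl⟩⟩⟩⟩
  rintro ⟨-, -, hacc⟩
  obtain ⟨D', φ', hx, e⟩ := (hM _).1 hacc
  obtain ⟨rfl, rfl⟩ := encPair_injective e
  exact hx

/-- On `⟨D, φ⟩`, the machine `M*` behaves as `P` on `⟨M, D, φ⟩`. -/
theorem TM.star_kb (h𝒟 : 𝒟 = Set.univ ∨ 𝒟 = {D | D.Positive}) (h𝒬 : IsQueryLanguage 𝒬)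
    (hP : ImplementsClosure 𝒟 𝒬 P) (M : TM) :
    (M.star P).kb 𝒟 𝒬 = cl 𝒟 𝒬 (M.kb 𝒟 𝒬) := by
  refine Set.ext fun ⟨D, φ⟩ => ?_
  have h : (M.star P).Accepts (encPair D φ) ↔ P.Accepts (pairStr (encTM M) (encPair D φ)) :=
    TM.hardwire_accepts _ _ _
  constructor
  · rintro ⟨hD, hφ, hx⟩
    exact (hP M D hD φ hφ).1 (h.1 hx)
  · intro hx
    obtain ⟨hD, hφ⟩ := (isKB_cl h𝒟 h𝒬 M.kb_subset).subset hx
    exact ⟨hD, hφ, h.2 ((hP M D hD φ hφ).2 hx)⟩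

/-- The value of the canonical mapping is well defined, because a string determines its Turing
machine. -/
theorem mem_theta {w : List Bool} {K : Set (Database σD Δ × σQ.Sentence Δ)} :
    K ∈ Theta 𝒟 𝒬 P w ↔ ∃ M : TM, encTM (M.star P) = w ∧ (M.star P).kb 𝒟 𝒬 = K := by
  have h : ∀ M : TM, encTM (M.star P) = w → {x | ∃ M : TM, encTM (M.star P) = w ∧
      x ∈ (M.star P).kb 𝒟 𝒬} = (M.star P).kb 𝒟 𝒬 := by
    intro M hM
    refine Set.ext fun x => ⟨?_, fun hx => ⟨M, hM, hx⟩⟩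
    rintro ⟨M', hM', hx⟩
    rwa [encTM_injective (hM.trans hM'.symm)]
  constructor
  · rintro ⟨⟨M, hM⟩, rfl⟩
    exact ⟨M, hM, (h M hM).symm⟩
  · rintro ⟨M, hM, rfl⟩
    exact ⟨⟨M, hM⟩, h M hM⟩

theorem primrec_pow_two : Primrec fun n : ℕ => 2 ^ n :=
  (Primrec₂.unpaired'.1 Nat.Primrec.pow).comp (Primrec.const 2) Primrec.id

/-- It is decidable whether a string is `⟨M*⟩` for some Turing machine `M`: the string `⟨M⟩` is
built into the instructions of `M*`, so that its length is bounded. -/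
theorem computablePred_star (P : TM) :
    ComputablePred fun w => ∃ M : TM, encTM (M.star P) = w := by
  classical
  have h : PrimrecRel fun (m : ℕ) (w : List Bool) => ((Encodable.decode (α := Tup) m).map fun t =>
      (decide (IsTM t) && decide (enc (P.hardwire (delimit (enc t))).tup = w))) = some true := by
    refine Primrec.eq.comp (Primrec.option_map (Primrec.decode.comp Primrec.fst) ?_)
      (Primrec.const _)
    have h1 : PrimrecPred fun x : (ℕ × List Bool) × Tup =>
        enc (P.hardwire (delimit (enc x.2))).tup = x.1.2 :=
      Primrec.eq.comp (primrec_enc.comp ((primrec_hardwire P).comp (primrec_delimit.comp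
        (primrec_enc.comp Primrec.snd)))) (Primrec.snd.comp Primrec.fst)
    exact Primrec.and.comp (primrecPred_isTM.decide.comp Primrec.snd) h1.decide
  have h' : PrimrecPred fun w : List Bool => ∃ m < 2 ^ (2 ^ w.length),
      ((Encodable.decode (α := Tup) m).map fun t =>
        (decide (IsTM t) && decide (enc (P.hardwire (delimit (enc t))).tup = w))) = some true := by
    refine (h.exists_mem_list.comp (Primrec.list_range.comp (primrec_pow_two.comp
      (primrec_pow_two.comp Primrec.list_length))) (Primrec.id (α := List Bool))).of_eq fun w => ?_
    simp only [List.mem_range, id]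
  refine h'.computablePred.of_eq fun w => ?_
  constructor
  · rintro ⟨m, -, hm⟩
    obtain ⟨t, -, ht⟩ := Option.map_eq_some_iff.1 hm
    rw [Bool.and_eq_true, decide_eq_true_eq, decide_eq_true_eq] at ht
    obtain ⟨M, rfl⟩ := ht.1.exists
    exact ⟨M, ht.2⟩
  · rintro ⟨M, rfl⟩
    refine ⟨Encodable.encode M.tup, ?_, ?_⟩
    · have hlt : ∀ n : ℕ, n < 2 ^ n.bits.length := fun n => by
        rw [Nat.size_eq_bits_len]
        exact Nat.lt_size_self n
      have h1 : (encTM M).length ≤ (M.star P).tup.2.2.2.length := by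
        have h2 : (encTM M).length ≤ (delimit (encTM M)).length := by
          simp [delimit, List.length_flatMap]
          omega
        refine h2.trans ?_
        simp only [TM.tup, TM.star, TM.hardwire, hardwireInstr, List.length_map, List.length_append,
          List.length_range]
        omega
      have h3 : (M.star P).tup.2.2.2.length ≤ Encodable.encode (M.star P).tup :=
        (Encodable.length_le_encode _).trans ((Nat.right_le_pair _ _).trans
          ((Nat.right_le_pair _ _).trans (Nat.right_le_pair _ _)))
      exact (hlt _).trans_le (Nat.pow_le_pow_right two_pos
        ((h1.trans h3).trans (hlt (Encodable.encode (M.star P).tup)).le))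
    · rw [Encodable.encodek]
      simp only [Option.map_some, Option.some.injEq, Bool.and_eq_true, decide_eq_true_eq]
      exact ⟨M.isTM_tup, rfl⟩

theorem theta_isKRF (h𝒟 : 𝒟 = Set.univ ∨ 𝒟 = {D | D.Positive}) (h𝒬 : IsQueryLanguage 𝒬)
    (hP : ImplementsClosure 𝒟 𝒬 P) : IsKRF 𝒟 𝒬 (Theta 𝒟 𝒬 P) where
  recursive_dom := computablePred_star P
  isKB := by
    intro π K hK
    obtain ⟨M, -, rfl⟩ := mem_theta.1 hK
    rw [TM.star_kb h𝒟 h𝒬 hP]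
    exact isKB_cl h𝒟 h𝒬 M.kb_subset
  re := by
    have h : REPred fun w => ∃ y : List Bool × List Bool, ((∃ M : TM, encTM (M.star P) = y.1) ∧
        (∃ D ∈ 𝒟, ∃ φ ∈ 𝒬, encPair D φ = y.2) ∧ ∃ M : TM, encTM M = y.1 ∧ M.Accepts y.2) ∧
        pairStr y.1 y.2 = w := by
      refine re_exists (p := fun w (y : List Bool × List Bool) => _) (re_and (re_and ?_
        (re_and ?_ ?_)) ?_)
      · exact re_comp (computablePred_star P).to_re (Computable.fst.comp Computable.snd)
      · exact re_comp (re_encPair h𝒟 h𝒬) (Computable.snd.comp Computable.snd)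
      · exact re_comp re_accepts Computable.snd
      · exact re_of_primrecPred (Primrec.eq.comp (primrec_pairStr.comp
          (Primrec.fst.comp Primrec.snd) (Primrec.snd.comp Primrec.snd)) Primrec.fst)
    refine h.of_eq fun w => ?_
    constructor
    · rintro ⟨⟨π, v⟩, ⟨⟨M, rfl⟩, ⟨D, hD, φ, hφ, rfl⟩, M', hM', hacc⟩, rfl⟩
      obtain rfl := encTM_injective hM'
      exact ⟨_, _, mem_theta.2 ⟨M, rfl, rfl⟩, D, φ, ⟨hD, hφ, hacc⟩, rfl⟩
    · rintro ⟨π, K, hK, D, φ, hx, rfl⟩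
      obtain ⟨M, rfl, rfl⟩ := mem_theta.1 hK
      exact ⟨(_, _), ⟨⟨M, rfl⟩, ⟨D, hx.1, φ, hx.2.1, rfl⟩, _, rfl, hx.2.2⟩, rfl⟩

theorem primrec_encTM_star (M P : TM) :
    Primrec fun π : List Bool => encTM ((M.hardwire (delimit π)).star P) :=
  primrec_enc.comp ((primrec_hardwire P).comp (primrec_delimit.comp (primrec_enc.comp
    ((primrec_hardwire M).comp primrec_delimit))))

/-- A Turing machine `M` accepts the strings `⟨π, D, φ⟩` with `(D, φ)` in `Γ(π)`. With `π` built in,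
it accepts `⟨D, φ⟩` iff `(D, φ)` is in `Γ(π)`, and the closure of this knowledge base is itself.
Hence `π` can be mapped to `⟨M_π*⟩`, where `M_π` is `M` with `π` built in. -/
theorem IsKRF.reducible_theta {Γ : List Bool →. Set (Database σD Δ × σQ.Sentence Δ)}
    (hΓ : IsKRF 𝒟 𝒬 Γ) (h𝒟 : 𝒟 = Set.univ ∨ 𝒟 = {D | D.Positive}) (h𝒬 : IsQueryLanguage 𝒬)
    (hP : ImplementsClosure 𝒟 𝒬 P) : Reducible Γ (Theta 𝒟 𝒬 P) := by
  obtain ⟨M, hM⟩ := exists_TM_of_re hΓ.re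
  have hkb : ∀ π, ∀ K ∈ Γ π, ((M.hardwire (delimit π)).star P).kb 𝒟 𝒬 = K := by
    intro π K hK
    have h : (M.hardwire (delimit π)).kb 𝒟 𝒬 = K := by
      refine Set.ext fun ⟨D, φ⟩ => ?_
      have h1 : (M.hardwire (delimit π)).Accepts (encPair D φ) ↔ (D, φ) ∈ K := by
        rw [TM.hardwire_accepts]
        refine (hM (pairStr π (encPair D φ))).trans ⟨?_, fun hx => ⟨π, K, hK, D, φ, hx, rfl⟩⟩
        rintro ⟨π', K', hK', D', φ', hx, e⟩
        obtain ⟨rfl, e'⟩ := pairStr_injective e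
        obtain ⟨rfl, rfl⟩ := encPair_injective e'
        rwa [Part.mem_unique hK hK']
      have h2 := (hΓ.isKB π K hK).subset
      exact ⟨fun hx => h1.1 hx.2.2, fun hx => ⟨(h2 hx).1, (h2 hx).2, h1.2 hx⟩⟩
    rw [TM.star_kb h𝒟 h𝒬 hP, h, (hΓ.isKB π K hK).cl_eq]
  let p : List Bool →. List Bool := fun π => (Part.assert (π ∈ Γ.Dom) fun _ => Part.some ()).map
    fun _ => encTM ((M.hardwire (delimit π)).star P)
  have hp : ∀ π b, b ∈ p π ↔ π ∈ Γ.Dom ∧ encTM ((M.hardwire (delimit π)).star P) = b := by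
    intro π b
    simp only [p, Part.mem_map_iff, Part.mem_assert_iff, Part.mem_some_iff]
    constructor
    · rintro ⟨_, ⟨h, -⟩, e⟩
      exact ⟨h, e⟩
    · rintro ⟨h, e⟩
      exact ⟨(), ⟨h, trivial⟩, e⟩
  have hdom : p.Dom = Γ.Dom := by
    ext π
    rw [PFun.mem_dom]
    constructor
    · rintro ⟨b, hb⟩
      exact ((hp π b).1 hb).1
    · exact fun h => ⟨_, (hp π _).2 ⟨h, rfl⟩⟩
  refine ⟨p, ⟨?_, hdom ▸ hΓ.recursive_dom⟩, hdom, ?_⟩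
  · exact Partrec.map (hΓ.recursive_dom.to_re : Partrec _)
      ((primrec_encTM_star M P).comp Primrec.fst).to_comp
  · refine PFun.ext fun π K => ?_
    refine Iff.trans ?_ (Part.mem_bind_iff (f := p π) (g := Theta 𝒟 𝒬 P)).symm
    constructor
    · intro hK
      exact ⟨_, (hp π _).2 ⟨(PFun.mem_dom _ _).2 ⟨K, hK⟩, rfl⟩, mem_theta.2 ⟨_, rfl, hkb π K hK⟩⟩
    · rintro ⟨b, hb, hK⟩
      obtain ⟨hd, rfl⟩ := (hp π b).1 hb
      obtain ⟨K', hK'⟩ := (PFun.mem_dom _ _).1 hd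
      obtain ⟨M', e, rfl⟩ := mem_theta.1 hK
      rw [encTM_injective e, hkb π K' hK']
      exact hK'

/-- A recursively enumerable knowledge base is `𝕂(M)` for some `M`, and hence equal to `𝕂(M*)`. -/
theorem theta_expressivelyComplete (h𝒟 : 𝒟 = Set.univ ∨ 𝒟 = {D | D.Positive})
    (h𝒬 : IsQueryLanguage 𝒬) (hP : ImplementsClosure 𝒟 𝒬 P) :
    ExpressivelyComplete 𝒟 𝒬 (Theta 𝒟 𝒬 P) := by
  refine Set.ext fun K => ?_
  constructor
  · rintro ⟨π, hK⟩
    refine ⟨(theta_isKRF h𝒟 h𝒬 hP).isKB π K hK, ?_⟩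
    obtain ⟨M, -, rfl⟩ := mem_theta.1 hK
    refine (re_and (re_encPair h𝒟 h𝒬) (re_accepts_of_TM (M.star P))).of_eq fun w => ?_
    constructor
    · rintro ⟨⟨D, hD, φ, hφ, rfl⟩, h⟩
      exact ⟨D, φ, ⟨hD, hφ, h⟩, rfl⟩
    · rintro ⟨D, φ, ⟨hD, hφ, h⟩, rfl⟩
      exact ⟨⟨D, hD, φ, hφ, rfl⟩, h⟩
  · rintro ⟨hK, hre⟩
    obtain ⟨M, rfl⟩ := hre.exists_TM hK.subset
    exact ⟨_, mem_theta.2 ⟨M, rfl, (TM.star_kb h𝒟 h𝒬 hP M).trans hK.cl_eq⟩⟩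

end Canonical
end KR

theorem mainTheorem2 (Δ : Type) [Primcodable Δ] [Infinite Δ]
    (σD : DatabaseSignature) (σQ : QuerySignature)
    (𝒟 : Set (Database σD Δ)) (h𝒟 : 𝒟 = Set.univ ∨ 𝒟 = {D | D.Positive})
    (𝒬 : Set (σQ.Sentence Δ)) (h𝒬 : IsQueryLanguage 𝒬) :
    (∃ P : TM, ImplementsClosure 𝒟 𝒬 P) ∧
    ∀ P : TM, ImplementsClosure 𝒟 𝒬 P →
      (∀ M : TM, (M.star P).kb 𝒟 𝒬 = cl 𝒟 𝒬 (M.kb 𝒟 𝒬)) ∧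
      IsUniversalKRF 𝒟 𝒬 (Theta 𝒟 𝒬 P) ∧
      ExpressivelyComplete 𝒟 𝒬 (Theta 𝒟 𝒬 P) := by
  refine ⟨exists_implementsClosure h𝒟 h𝒬, fun P hP => ⟨TM.star_kb h𝒟 h𝒬 hP, ⟨?_, ?_⟩, ?_⟩⟩
  · exact theta_isKRF h𝒟 h𝒬 hP
  · exact fun Γ hΓ => hΓ.reducible_theta h𝒟 h𝒬 hP
  · exact theta_expressivelyComplete h𝒟 h𝒬 hP
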